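/- Let $a,b\in\mathbb{C}$ with $a\notin\mathbb{Z}_{\le 0}$, let $c\in\mathbb{C}\setminus\mathbb{Z}_{\le 0}$, and let $d,\,a-b\in\mathbb{C}\setminus\mathbb{Z}$. Let $w>0$ satisfy $w>\max\{\Re(a),\Re(b),\Re(d)\}$, and suppose that the fractional parts of $w-\Re(a)$ and $w-\Re(b)$ both lie in $(\varepsilon,1)$ for some $\varepsilon>0$. Write $${}_2F_2\left[\begin{matrix}a,b\\c,d\end{matrix};z\right]=\sum_{k=0}^\infty\frac{(a)_k(b)_k}{(c)_k(d)_k}\frac{z^k}{k!},$$ where $(x)_k=x(x+1)\cdots(x+k-1)$. For every integer $n\ge 0$ such that $b-n\notin\mathbb{Z}_{\le 0}$ (every $n\ge0$ if $b\notin\mathbb{Z}$) and every $z\ne 0$ with $|\arg z|<\pi$, define $R_{n,w}(z)$ by $${}_2F_2\left[\begin{matrix}a,b-n\\c,d-n\end{matrix};-z\right]=\frac{\Gamma(c)\Gamma(d-n)}{\Gamma(a)\Gamma(b-n)}\bigl\{S_n(z)+T_n(z)+R_{n,w}(z)\bigr\},$$ where, with principal values of the powers and with $1/\Gamma$ understood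 as an entire function, $$S_n(z)=\sum_{k=0}^{\lfloor w-\Re(a)\rfloor}\frac{\Gamma(a+k)\Gamma(b-a-n-k)}{\Gamma(c-a-k)\Gamma(d-a-n-k)}\frac{(-1)^k}{k!}z^{-a-k},$$ $$T_n(z)=\sum_{k=0}^{\lfloor w-\Re(b)\rfloor+n}\frac{\Gamma(b-n+k)\Gamma(a-b+n-k)}{\Gamma(d-b-k)\Gamma(c-b+n-k)}\frac{(-1)^k}{k!}z^{n-b-k}.$$ Then, as $z\to\infty$ with $|\arg z|<\pi$ and $z$ bounded away from the points $-b+k$ $(k\in\mathbb{Z})$, $$R_{n,w}(z)=O\left((n+1)^{\max\{0,\Re(b-d)\}}|z|^{-w}\right)+O\left((n+1)^{2|b-d|}|z|^{\Re(a+b-c-d)}e^{-\Re(z)}\right)$$ uniformly in $n$. That is, for every $\delta>0$ there are $K,r>0$, which depend only on $a,b,c,d,w,\varepsilon,\delta$, such that for all these $n$ and all $z$ with $|z|\ge r$, $|\arg z|<\pi$ and $|z-(-b+k)|\ge\delta$ for all $k\in\mathbb{Z}$, $$|R_{n,w}(z)|\le K(n+1)^{\max\{0,\Re(b-d)\}}|z|^{-w}+K(n+1)^{2|b-d|}|z|^{\Re(a+b-c-d)}e^{-\Re(z)}.$$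 -/

import Mathlib

noncomputable section

/-- The generalized hypergeometric function `₂F₂[a, b; c, d; z]`, defined by its power series
`∑ (a)_k (b)_k / ((c)_k (d)_k) * z ^ k / k!`, where `(x)_k` is the rising factorial. -/
def hyp2F2 (a b c d z : ℂ) : ℂ :=
  ∑' k : ℕ, (ascPochhammer ℂ k).eval a * (ascPochhammer ℂ k).eval b /
    ((ascPochhammer ℂ k).eval c * (ascPochhammer ℂ k).eval d) * (z ^ k / (k.factorial : ℂ))

/-- Up to the normalization `Γ(c) Γ(d)`, the terms of the series are those of Mathlib's
regularized hypergeometric series. -/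
theorem hyp2F2_term_eq {a b c d : ℂ} (hc : ∀ m : ℕ, c ≠ -(m : ℂ)) (hd : ∀ m : ℕ, d ≠ -(m : ℂ))
    (z : ℂ) (k : ℕ) :
    (ascPochhammer ℂ k).eval a * (ascPochhammer ℂ k).eval b /
      ((ascPochhammer ℂ k).eval c * (ascPochhammer ℂ k).eval d) * (z ^ k / (k.factorial : ℂ)) =
    Complex.Gamma c * Complex.Gamma d *
      (Complex.regularizedHGFunSeries {a, b} {c, d} k fun _ => z) := by
  have h1 := Complex.Gamma_ne_zero hc
  have h2 := Complex.Gamma_ne_zero hd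
  rw [← Complex.Gamma_add_nat_div_Gamma_eq c hc, ← Complex.Gamma_add_nat_div_Gamma_eq d hd]
  simp only [Complex.regularizedHGFunSeries, FormalMultilinearSeries.ofScalars_apply_eq,
    Complex.regularizedHGFunCoeff, smul_eq_mul, Multiset.insert_eq_cons, Multiset.map_cons,
    Multiset.map_singleton, Multiset.prod_cons, Multiset.prod_singleton]
  have h3 : Complex.Gamma (c + k) ≠ 0 := Complex.Gamma_ne_zero fun m h =>
    hc (m + k) (by push_cast; linear_combination h)
  have h4 : Complex.Gamma (d + k) ≠ 0 := Complex.Gamma_ne_zero fun m h =>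
    hd (m + k) (by push_cast; linear_combination h)
  field_simp

/-- The defining series of `₂F₂` converges for every `z` when `c, d` are not nonpositive
integers. -/
theorem hyp2F2_summable {a b c d : ℂ} (hc : ∀ m : ℕ, c ≠ -(m : ℂ)) (hd : ∀ m : ℕ, d ≠ -(m : ℂ))
    (z : ℂ) :
    Summable fun k : ℕ => (ascPochhammer ℂ k).eval a * (ascPochhammer ℂ k).eval b /
      ((ascPochhammer ℂ k).eval c * (ascPochhammer ℂ k).eval d) *
        (z ^ k / (k.factorial : ℂ)) := by
  simp only [hyp2F2_term_eq hc hd]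
  refine Summable.mul_left _ (FormalMultilinearSeries.summable _ ?_)
  rw [Complex.radius_regularizedHGFunSeries_eq_top (by simp)]
  simp

/-- The finite sum `S_n(z)`, over `0 ≤ k ≤ ⌊w - Re a⌋` (used for `w > Re a`).  `Complex.Gamma`
is zero at its poles, so a quotient by it is the product with the entire function `1 / Γ`. -/
def algSumS (a b c d : ℂ) (w : ℝ) (n : ℕ) (z : ℂ) : ℂ :=
  ∑ k ∈ Finset.range (⌊w - a.re⌋₊ + 1),
    Complex.Gamma (a + k) * Complex.Gamma (b - a - n - k) /
      (Complex.Gamma (c - a - k) * Complex.Gamma (d - a - n - k)) *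
      ((-1) ^ k / (k.factorial : ℂ)) * z ^ (-a - (k : ℂ))

/-- The finite sum `T_n(z)`, over `0 ≤ k ≤ ⌊w - Re b⌋ + n` (used for `w > Re b`). -/
def algSumT (a b c d : ℂ) (w : ℝ) (n : ℕ) (z : ℂ) : ℂ :=
  ∑ k ∈ Finset.range (⌊w - b.re⌋₊ + n + 1),
    Complex.Gamma (b - n + k) * Complex.Gamma (a - b + n - k) /
      (Complex.Gamma (d - b - k) * Complex.Gamma (c - b + n - k)) *
      ((-1) ^ k / (k.factorial : ℂ)) * z ^ ((n : ℂ) - b - (k : ℂ))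

end

noncomputable section

open Filter Topology MeasureTheory

/-! The remainder is taken to be `hypRemainder`: the regularized series minus the two algebraic
sums. For `|arg z| < π / 2` and non-integral `w - Re a`, `w - Re b` it is a Mellin–Barnes integral.
The poles of `Γ(-s)` produce the power series, the poles of `Γ(a + s)` and `Γ(b - n + s)` to the
right of `Re s = -w` produce the two algebraic sums, and the integral over `Re s = N + 1/2` vanishes
as `N → ∞` (`tendsto_sum_sub_algSum`). What is left is the integral over `Re s = -w`.

Put `u = -s` and take `w` large. The reflection formula turns the integrand into `Γ(u) *
dualCoeff(u) * trigRatio(u) * z ^ (-u)` (`mbCoeff_neg_eq`). The signs produced by the shift `n`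
cancel, so `trigRatio` does not depend on `n`, and all dependence on `n` sits in one Gamma quotient
evaluated at `n + u`. Stirling's formula bounds that quotient by `(n + 1) ^ max 0 (Re (b - d))`
times a power of `‖u‖` (`exists_norm_dualCoeff_le`). For `|arg z| ≤ π / 4` the integral converges
absolutely and gives the `‖z‖ ^ (-w)` bound directly (`exists_norm_hypRemainder_sector_le`).

In the rest of the upper half plane `trigRatio` is split into its limit `trigLimit` at `+i∞` plus an
error of size `exp(-2π Im u)`. The error part, `algRemainder`, converges and is `O(‖z‖ ^ (-w))` for
all `0 ≤ arg z ≤ π` (`exists_algRemainder`). The limit part is a multiple of the integral of `Γ(u) *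
dualCoeff(u) * z ^ (-u)`, whose contour may be moved to the right. On the ray `arg z = π / 4` it is
moved through the saddle point `u = z`, which gives `O(x ^ p * exp(-x))` with `x = Re z`, `p = Re (a
+ b - c - d)` (`exists_norm_lineIntegral_gammaDual_le`).

The difference `hypRemainder - algRemainder` is thus exponentially small on that ray, and the
estimate is carried to the negative real direction by Phragmén–Lindelöf
(`norm_le_of_diagonal_of_horizontal`) applied to its product with `exp(z) * z ^ (-p)`. This needs an
a priori bound `O((n + 1) ^ |Re (b - d)| * ‖z‖ ^ p * exp ‖z‖)` in all directions
(`exists_norm_hypRemainder_le_exp`), proved termwise; it is the source of the larger power of `n +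
1` in the exponential term. The sector has opening `3π / 4 < π`, so growth of order one is
admissible.

The lower half plane follows by complex conjugation. A small `w` is reached from `w + N`, because
the extra terms in the sums are `O(‖z‖ ^ (-w))` (`exists_norm_hypRemainder_sub_le`). -/

/-! ### Stirling's formula for the modulus of Gamma in a right half-plane -/

/-- The real part of `(v - 1/2) log v - v`, the exponent in Stirling's formula for `‖Γ(v)‖`. -/
def stirlingExponent (v : ℂ) : ℝ := (v.re - 1 / 2) * Real.log ‖v‖ - v.im * v.arg - v.re

def stirlingLog (v : ℂ) : ℂ := (v - 1 / 2) * Complex.log v - v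

theorem re_stirlingLog (v : ℂ) : (stirlingLog v).re = stirlingExponent v := by
  simp [stirlingLog, stirlingExponent, Complex.log_re, Complex.log_im]

theorem log_add_eq {M v : ℂ} (hM : 0 < M.re) (hv : 0 < (M + v).re) (h : ‖v / M‖ < 1) :
    Complex.log (M + v) = Complex.log M + Complex.log (1 + v / M) := by
  have hM0 : M ≠ 0 := by rintro rfl; simp at hM
  have h1 : M + v = M * (1 + v / M) := by field_simp
  have hre : 0 < (1 + v / M).re := by
    have := (Complex.abs_re_le_norm (v / M)).trans_lt h
    have := (abs_lt.mp this).1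
    simp only [Complex.add_re, Complex.one_re]; linarith
  rw [h1]
  have a1 := (Complex.abs_arg_lt_pi_div_two_iff (z := M)).2 (Or.inl hM)
  have a2 := (Complex.abs_arg_lt_pi_div_two_iff (z := 1 + v / M)).2 (Or.inl hre)
  rw [abs_lt] at a1 a2
  apply Complex.log_mul hM0 (by intro h0; simp [h0] at hre)
  constructor <;> linarith [a1.1, a1.2, a2.1, a2.2]

/-- With `h = 1 / v`, the product `(1 / h + 1 / 2) * (h - h ^ 2 / 2)` equals `1 - h ^ 2 / 4`: the
shift by `1 / 2` in Stirling's exponent is exactly what cancels the term of order `h`. The remaining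
Taylor error is cubic, so the defect is summable along `v, v + 1, ...`. -/
theorem norm_stirling_defect_le {v : ℂ} (hv : 2 ≤ v.re) :
    ‖(v + 1 / 2) * Complex.log (1 + 1 / v) - 1‖ ≤ 2 / ‖v‖ ^ 2 := by
  have hvn : 2 ≤ ‖v‖ := hv.trans (Complex.re_le_norm v)
  have hv0 : v ≠ 0 := by rintro rfl; simp at hvn; linarith
  set h : ℂ := 1 / v with hh
  have hn : ‖h‖ = 1 / ‖v‖ := by simp [hh]
  have hn2 : ‖h‖ ≤ 1 / 2 := by rw [hn]; exact one_div_le_one_div_of_le (by norm_num) hvn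
  have key := Complex.norm_log_sub_logTaylor_le 2 (z := h) (by linarith)
  have ht : Complex.logTaylor (2 + 1) h = h - h ^ 2 / 2 := by
    simp [Complex.logTaylor, Finset.sum_range_succ]; ring
  rw [ht] at key
  set e := Complex.log (1 + h) - (h - h ^ 2 / 2) with he
  have hvh : v * h = 1 := by rw [hh]; field_simp
  have heq : (v + 1 / 2) * Complex.log (1 + h) - 1 = -(h ^ 2) / 4 + (v + 1 / 2) * e := by
    rw [he]
    have h2 : v * h ^ 2 = h := by rw [pow_two, ← mul_assoc, hvh, one_mul]
    linear_combination hvh - (1 / 2) * h2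
  have hinv : (1 - ‖h‖)⁻¹ ≤ 2 := by
    rw [inv_le_comm₀ (by linarith) (by norm_num)]; linarith
  have he3 : ‖e‖ ≤ ‖h‖ ^ 3 * 2 / 3 := by
    refine key.trans ?_
    norm_num
    gcongr
  rw [heq]
  have hvn1 : ‖v‖ * ‖h‖ = 1 := by rw [← norm_mul, hvh]; simp
  calc _ ≤ ‖-(h ^ 2) / 4‖ + ‖(v + 1 / 2)‖ * ‖e‖ := by
        rw [← norm_mul]; exact norm_add_le _ _
    _ ≤ ‖h‖ ^ 2 / 4 + (‖v‖ + 1 / 2) * (‖h‖ ^ 3 * 2 / 3) := by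
        gcongr
        · simp
        · exact (norm_add_le _ _).trans (by simp)
    _ ≤ 2 * ‖h‖ ^ 2 := by
        have : ‖v‖ * ‖h‖ ^ 3 = ‖h‖ ^ 2 := by
          calc _ = (‖v‖ * ‖h‖) * ‖h‖ ^ 2 := by ring
            _ = _ := by rw [hvn1, one_mul]
        nlinarith [norm_nonneg h, sq_nonneg ‖h‖, mul_le_mul_of_nonneg_left hn2 (sq_nonneg ‖h‖)]
    _ = _ := by rw [hn]; ring

/-- Consecutive values of `stirlingLog` differ by `log v` up to a summable error. -/
theorem stirlingLog_add_one {v : ℂ} (hv : 2 ≤ v.re) :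
    stirlingLog (v + 1) =
      stirlingLog v + Complex.log v + ((v + 1 / 2) * Complex.log (1 + 1 / v) - 1) := by
  have hvn : 2 ≤ ‖v‖ := hv.trans (Complex.re_le_norm v)
  rw [stirlingLog, stirlingLog, log_add_eq (by linarith) (by simp; linarith)]
  · ring
  · rw [norm_div, norm_one, div_lt_one (by linarith)]; linarith

/-- Stirling's formula amounts to boundedness of the logarithm of this ratio; only that, not the
limit `√(2π)`, is needed. -/
def stirlingRatio (v : ℂ) : ℝ := ‖Complex.Gamma v‖ * Real.exp (-stirlingExponent v)

theorem abs_log_stirlingRatio_succ {v : ℂ} (hv : 2 ≤ v.re) :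
    |Real.log (stirlingRatio (v + 1)) - Real.log (stirlingRatio v)| ≤ 2 / ‖v‖ ^ 2 := by
  have hvn : 2 ≤ ‖v‖ := hv.trans (Complex.re_le_norm v)
  have hv0 : v ≠ 0 := by rintro rfl; simp at hvn; linarith
  have hG : ‖Complex.Gamma v‖ ≠ 0 :=
    norm_ne_zero_iff.2 (Complex.Gamma_ne_zero_of_re_pos (by linarith))
  have h1 := congrArg Complex.re (stirlingLog_add_one hv)
  rw [re_stirlingLog, Complex.add_re, Complex.add_re, re_stirlingLog, Complex.log_re] at h1
  rw [stirlingRatio, stirlingRatio, Complex.Gamma_add_one v hv0, norm_mul,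
    Real.log_mul (mul_ne_zero (by linarith) hG) (Real.exp_ne_zero _),
    Real.log_mul (by linarith) hG, Real.log_mul hG (Real.exp_ne_zero _), Real.log_exp,
    Real.log_exp, h1]
  refine le_trans ?_ (norm_stirling_defect_le hv)
  refine le_trans (le_of_eq ?_) (Complex.abs_re_le_norm _)
  rw [← abs_neg]; congr 1; ring

/-- The increments are dominated by the telescoping series of `2 / ((k + 1) * (k + 2))`, since `‖v +
k‖ ≥ k + 2`. The bound is therefore at most `2`, uniformly in `v` and `N`. -/
theorem abs_log_stirlingRatio_add_nat {v : ℂ} (hv : 2 ≤ v.re) (N : ℕ) :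
    |Real.log (stirlingRatio (v + N)) - Real.log (stirlingRatio v)| ≤ 2 * (1 - 1 / (N + 1)) := by
  induction N with
  | zero => simp
  | succ N ih =>
    have h2 := abs_log_stirlingRatio_succ (v := v + N) (by simp; linarith [(N.cast_nonneg : (0:ℝ) ≤ N)])
    have h3 : (N : ℝ) + 2 ≤ ‖v + N‖ := by
      refine le_trans ?_ (Complex.re_le_norm _); simp; linarith
    have h4 : 2 / ‖v + N‖ ^ 2 ≤ 2 * (1 / (N + 1) - 1 / (N + 2)) := by
      have : (1 : ℝ) / (N + 1) - 1 / (N + 2) = 1 / ((N + 1) * (N + 2)) := by field_simp; ring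
      rw [this, mul_one_div]
      gcongr
      nlinarith
    push_cast
    rw [← add_assoc]
    have := abs_sub_le (Real.log (stirlingRatio (v + N + 1))) (Real.log (stirlingRatio (v + N)))
      (Real.log (stirlingRatio v))
    have e : (1 : ℝ) / (N + 1 + 1) = 1 / (N + 2) := by ring
    rw [e]
    linarith

theorem tendsto_stirlingLog_sub (v : ℂ) :
    Tendsto (fun N : ℕ => stirlingLog (v + N) - stirlingLog N - v * Real.log N) atTop (𝓝 0) := by
  have h1 : Tendsto (fun N : ℕ => Complex.log (1 + v / N)) atTop (𝓝 0) := by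
    have : Tendsto (fun N : ℕ => 1 + v / N) atTop (𝓝 (1 + 0)) :=
      tendsto_const_nhds.add (tendsto_const_div_atTop_nhds_zero_nat v)
    rw [add_zero] at this
    have h := ((continuousAt_clog (x := 1) (by simp)).tendsto).comp this
    rwa [Complex.log_one] at h
  have h2 : Tendsto (fun N : ℕ => (N : ℂ) * Complex.log (1 + v / N)) atTop (𝓝 v) := by
    refine Complex.tendsto_nat_mul_log_one_add_of_tendsto (tendsto_const_nhds.congr' ?_)
    filter_upwards [eventually_gt_atTop 0] with N hN
    have : (N : ℂ) ≠ 0 := by exact_mod_cast hN.ne'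
    field_simp
  have h3 : Tendsto (fun N : ℕ => (N : ℂ) * Complex.log (1 + v / N) +
      (v - 1 / 2) * Complex.log (1 + v / N) - v) atTop (𝓝 (v + (v - 1 / 2) * 0 - v)) :=
    (h2.add (h1.const_mul _)).sub_const _
  rw [show v + (v - 1 / 2) * 0 - v = 0 by ring] at h3
  refine h3.congr' ?_
  obtain ⟨K, hK⟩ := exists_nat_gt ‖v‖
  filter_upwards [eventually_gt_atTop K] with N hN
  have hN' : ‖v‖ < N := hK.trans (by exact_mod_cast hN)
  have hN0 : (0 : ℝ) < N := (norm_nonneg v).trans_lt hN'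
  have : -‖v‖ ≤ v.re := (abs_le.1 (Complex.abs_re_le_norm v)).1
  rw [add_comm v, stirlingLog, log_add_eq (M := (N : ℂ)) (by simpa using hN0) (by simp; linarith)
    (by rw [norm_div, Complex.norm_natCast, div_lt_one hN0]; exact hN'), stirlingLog,
    ← Complex.natCast_log]
  ring

/-- A restatement of Euler's limit formula: the product in `Complex.GammaSeq` is `Γ(v + N + 1) /
Γ(v)`. -/
theorem tendsto_norm_Gamma_add_nat {v : ℂ} (hv : 0 < v.re) :
    Tendsto (fun N : ℕ => ‖Complex.Gamma (v + N)‖ / (Real.Gamma N * (N : ℝ) ^ v.re)) atTop (𝓝 1) := by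
  have hG : Complex.Gamma v ≠ 0 := Complex.Gamma_ne_zero_of_re_pos hv
  have h1 := (Complex.GammaSeq_tendsto_Gamma v).norm
  have h2 := (tendsto_const_nhds (x := ‖Complex.Gamma v‖)).div h1 (norm_ne_zero_iff.2 hG)
  rw [div_self (norm_ne_zero_iff.2 hG)] at h2
  have h3 : Tendsto (fun N : ℕ => ‖v + N‖ / N) atTop (𝓝 1) := by
    have : Tendsto (fun N : ℕ => ‖v / N + 1‖) atTop (𝓝 ‖(0 : ℂ) + 1‖) :=
      ((tendsto_const_div_atTop_nhds_zero_nat v).add_const 1).norm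
    simp only [zero_add, norm_one] at this
    refine this.congr' ?_
    filter_upwards [eventually_gt_atTop 0] with N hN
    have : (N : ℂ) ≠ 0 := by exact_mod_cast hN.ne'
    rw [← Complex.norm_natCast, ← norm_div]; congr 1; field_simp
  have h4 := h2.div h3 one_ne_zero
  rw [div_one] at h4
  refine h4.congr' ?_
  filter_upwards [eventually_gt_atTop 0] with N hN
  have hN0 : (0 : ℝ) < N := by exact_mod_cast hN
  have hne : ∀ k : ℕ, v ≠ -k := by
    rintro k rfl; simp at hv; linarith [(k.cast_nonneg : (0:ℝ) ≤ k)]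
  have hgam : ∀ M : ℕ, Complex.Gamma (v + M) = Complex.Gamma v * ∏ j ∈ Finset.range M, (v + j) := by
    intro M
    induction M with
    | zero => simp
    | succ M ih =>
      rw [Finset.prod_range_succ, ← mul_assoc, ← ih]; push_cast
      rw [← add_assoc, Complex.Gamma_add_one, mul_comm]
      intro h; exact hne M (eq_neg_of_add_eq_zero_left h)
  have hvN : v + N ≠ 0 := fun h => hne N (eq_neg_of_add_eq_zero_left h)
  have hfac : Real.Gamma N * N = N.factorial := by
    rw [mul_comm, ← Real.Gamma_add_one hN0.ne', Real.Gamma_nat_eq_factorial]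
  have hGN : Real.Gamma N ≠ 0 := (Real.Gamma_pos_of_pos hN0).ne'
  have hpow : ‖(N : ℂ) ^ v‖ = (N : ℝ) ^ v.re := Complex.norm_natCast_cpow_of_pos hN v
  simp only [Pi.div_apply, Complex.GammaSeq]
  rw [norm_div, norm_mul, hpow, Finset.prod_range_succ, norm_mul,
    Complex.norm_natCast, ← hfac, hgam, norm_mul]
  have hp : (N : ℝ) ^ v.re ≠ 0 := (Real.rpow_pos_of_pos hN0 _).ne'
  have hv' : ‖v + N‖ ≠ 0 := norm_ne_zero_iff.2 hvN
  field_simp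

/-- **Stirling's formula** with a multiplicative error, in the half-plane `2 ≤ re v`. -/
theorem exists_norm_Gamma_stirling : ∃ C : ℝ, 1 ≤ C ∧ ∀ v : ℂ, 2 ≤ v.re →
    ‖Complex.Gamma v‖ ≤ C * Real.exp (stirlingExponent v) ∧
    Real.exp (stirlingExponent v) ≤ C * ‖Complex.Gamma v‖ := by
  set L := |Real.log (stirlingRatio 2)| with hL
  have key : ∀ v : ℂ, 2 ≤ v.re → |Real.log (stirlingRatio v)| ≤ L + 5 := by
    intro v hv
    have h1 := (Real.continuousAt_log one_ne_zero).tendsto.comp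
      (tendsto_norm_Gamma_add_nat (v := v) (by linarith))
    rw [Real.log_one] at h1
    have h2 := (Complex.continuous_re.tendsto _).comp (tendsto_stirlingLog_sub v)
    have e1 := (h1.abs.eventually_lt_const (u := 1/2) (by simp))
    have e2 := (h2.abs.eventually_lt_const (u := 1/2) (by simp))
    -- The index `N` depends on `v`, the resulting bound does not: going from `v` to `v + N` costs
    -- `2`, comparing `v + N` with `N` costs `1 / 2 + 1 / 2`, and going from `N` back to `2` costs
    -- `2`, for a total of `5`.
    obtain ⟨N, hN1, hN2, hN3⟩ := (e1.and (e2.and (eventually_ge_atTop 2))).exists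
    have hN0 : (2 : ℝ) ≤ N := by exact_mod_cast hN3
    have a1 := abs_log_stirlingRatio_add_nat hv N
    have a2 := abs_log_stirlingRatio_add_nat (v := 2) (by simp) (N - 2)
    have hc : (2 : ℂ) + ((N - 2 : ℕ) : ℂ) = N := by rw [Nat.cast_sub hN3]; simp
    rw [hc] at a2
    have hp : ∀ M : ℝ, 0 ≤ M → 2 * (1 - 1 / (M + 1)) ≤ 2 := by
      intro M hM; have : 0 ≤ 1 / (M + 1) := by positivity
      linarith
    have a1' := a1.trans (hp _ N.cast_nonneg)
    have a2' := a2.trans (hp _ (N - 2).cast_nonneg)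
    simp only [Function.comp_apply, Complex.sub_re, re_stirlingLog, Complex.re_mul_ofReal] at hN1 hN2
    have hGv : ‖Complex.Gamma (v + N)‖ ≠ 0 := norm_ne_zero_iff.2
      (Complex.Gamma_ne_zero_of_re_pos (by simp; linarith))
    have hGN : Real.Gamma N ≠ 0 := (Real.Gamma_pos_of_pos (by linarith)).ne'
    have hNp : (N : ℝ) ^ v.re ≠ 0 := (Real.rpow_pos_of_pos (by linarith) _).ne'
    rw [Real.log_div hGv (mul_ne_zero hGN hNp), Real.log_mul hGN hNp,
      Real.log_rpow (by linarith)] at hN1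
    rw [stirlingRatio, Real.log_mul hGv (Real.exp_ne_zero _), Real.log_exp] at a1'
    have hGN' : ‖Complex.Gamma (N : ℂ)‖ = Real.Gamma N := by
      rw [← Complex.ofReal_natCast, Complex.Gamma_ofReal, Complex.norm_real, Real.norm_of_nonneg]
      exact (Real.Gamma_pos_of_pos (by linarith)).le
    rw [stirlingRatio, hGN', Real.log_mul hGN (Real.exp_ne_zero _), Real.log_exp] at a2'
    have hLL := abs_le.1 hL.symm.le
    rw [abs_le] at a1' a2' ⊢
    rw [abs_lt] at hN1 hN2
    constructor <;> linarith [a1'.1, a1'.2, a2'.1, a2'.2, hN1.1, hN1.2, hN2.1, hN2.2, hLL.1, hLL.2]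
  refine ⟨Real.exp (L + 5), Real.one_le_exp (by positivity), fun v hv => ?_⟩
  have hG : 0 < ‖Complex.Gamma v‖ := norm_pos_iff.2 (Complex.Gamma_ne_zero_of_re_pos (by linarith))
  have h := key v hv
  rw [stirlingRatio, Real.log_mul hG.ne' (Real.exp_ne_zero _), Real.log_exp, abs_le] at h
  rw [← Real.exp_log hG, ← Real.exp_add, ← Real.exp_add, Real.exp_le_exp, Real.exp_le_exp]
  constructor <;> linarith [h.1, h.2]

/-- The complex increment is `α * log v + (v + α - 1 / 2) * log (1 + α / v) - α`, and everything
after `α * log v` is bounded because `log (1 + α / v) = O(1 / v)`. Taking real parts costs the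
further bounded term `Im α * arg v`. -/
theorem exists_stirlingExponent_add (α : ℂ) : ∃ C M : ℝ, ∀ v : ℂ, M ≤ v.re →
    |stirlingExponent (v + α) - stirlingExponent v - α.re * Real.log ‖v‖| ≤ C := by
  refine ⟨4 * ‖α‖ + ‖α‖ * Real.pi, 2 * ‖α‖ + 2, fun v hv => ?_⟩
  have hvn : 2 * ‖α‖ + 2 ≤ ‖v‖ := hv.trans (Complex.re_le_norm v)
  have hα := norm_nonneg α
  have hαre := (abs_le.1 (Complex.abs_re_le_norm α)).1
  have hv0 : 0 < ‖v‖ := by linarith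
  have hq : ‖α / v‖ ≤ 1 / 2 := by
    rw [norm_div, div_le_iff₀ hv0]; linarith
  have hlog := Complex.norm_log_one_add_half_le_self hq
  have hkey : stirlingLog (v + α) - stirlingLog v - α * Complex.log v =
      (v + α - 1 / 2) * Complex.log (1 + α / v) - α := by
    rw [stirlingLog, log_add_eq (by linarith) (by simp; linarith) (by linarith), stirlingLog]
    ring
  have hre : stirlingExponent (v + α) - stirlingExponent v - α.re * Real.log ‖v‖ =
      ((v + α - 1 / 2) * Complex.log (1 + α / v) - α).re - α.im * v.arg := by
    rw [← hkey]
    simp only [Complex.sub_re, Complex.mul_re, re_stirlingLog, Complex.log_re, Complex.log_im]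
    ring
  have hn : ‖(v + α - 1 / 2) * Complex.log (1 + α / v) - α‖ ≤ 4 * ‖α‖ := by
    calc _ ≤ ‖v + α - 1 / 2‖ * ‖Complex.log (1 + α / v)‖ + ‖α‖ := by
          rw [← norm_mul]; exact norm_sub_le _ _
      _ ≤ (2 * ‖v‖) * (3 / 2 * ‖α / v‖) + ‖α‖ := by
          gcongr
          refine (norm_sub_le _ _).trans ?_
          have := norm_add_le v α
          norm_num
          linarith
      _ = 4 * ‖α‖ := by rw [norm_div]; field_simp; ring
  rw [hre]
  refine (abs_sub _ _).trans ?_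
  rw [abs_mul]
  gcongr
  · exact (Complex.abs_re_le_norm _).trans hn
  · exact Complex.abs_im_le_norm _
  · exact Complex.abs_arg_le_pi _

/-- `Γ(v + α) / Γ(v + β)` grows like `v ^ (α - β)` in a right half-plane. -/
theorem exists_norm_Gamma_div_Gamma_le (α β : ℂ) : ∃ C M : ℝ, 0 < C ∧ ∀ v : ℂ, M ≤ v.re →
    ‖Complex.Gamma (v + α) / Complex.Gamma (v + β)‖ ≤ C * ‖v‖ ^ (α - β).re := by
  obtain ⟨C₀, h0, hst⟩ := exists_norm_Gamma_stirling
  obtain ⟨C₁, M₁, h1⟩ := exists_stirlingExponent_add α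
  obtain ⟨C₂, M₂, h2⟩ := exists_stirlingExponent_add β
  refine ⟨C₀ * C₀ * Real.exp (C₁ + C₂), max (max M₁ M₂) (2 + ‖α‖ + ‖β‖), by positivity,
    fun v hv => ?_⟩
  have hv1 : M₁ ≤ v.re := le_trans (by simp) hv
  have hv2 : M₂ ≤ v.re := le_trans (by simp) hv
  have hv3 : 2 + ‖α‖ + ‖β‖ ≤ v.re := le_trans (by simp) hv
  have hα := (abs_le.1 (Complex.abs_re_le_norm α)).1
  have hβ := (abs_le.1 (Complex.abs_re_le_norm β)).1
  have hvn : 0 < ‖v‖ := by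
    have := Complex.re_le_norm v
    linarith [norm_nonneg α, norm_nonneg β]
  have a1 := (hst (v + α) (by simp; linarith [norm_nonneg β])).1
  have a2 := (hst (v + β) (by simp; linarith [norm_nonneg α])).2
  have hG : 0 < ‖Complex.Gamma (v + β)‖ := norm_pos_iff.2
    (Complex.Gamma_ne_zero_of_re_pos (by simp; linarith [norm_nonneg α, norm_nonneg β]))
  rw [norm_div, div_le_iff₀ hG, Real.rpow_def_of_pos hvn]
  have b1 := abs_le.1 (h1 v hv1)
  have b2 := abs_le.1 (h2 v hv2)
  calc _ ≤ C₀ * Real.exp (stirlingExponent (v + α)) := a1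
    _ ≤ C₀ * (Real.exp (C₁ + C₂) * Real.exp (Real.log ‖v‖ * (α - β).re) *
        Real.exp (stirlingExponent (v + β))) := by
        rw [← Real.exp_add, ← Real.exp_add]
        gcongr
        rw [Complex.sub_re]
        linarith [b1.1, b1.2, b2.1, b2.2]
    _ ≤ C₀ * (Real.exp (C₁ + C₂) * Real.exp (Real.log ‖v‖ * (α - β).re) *
        (C₀ * ‖Complex.Gamma (v + β)‖)) := by gcongr
    _ = _ := by ring

/-! ### Gamma quotients along integer shifts -/

/-- The finitely many exceptional indices are absorbed by enlarging the constant. -/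
theorem exists_forall_le_of_eventually_le {f g : ℕ → ℝ} (hg : ∀ k, 0 < g k) {C : ℝ}
    (h : ∀ᶠ k in atTop, f k ≤ C * g k) : ∃ C' : ℝ, 0 < C' ∧ ∀ k, f k ≤ C' * g k := by
  obtain ⟨N, hN⟩ := eventually_atTop.1 h
  refine ⟨|C| + ∑ k ∈ Finset.range N, |f k / g k| + 1, by positivity, fun k => ?_⟩
  rcases le_or_gt N k with hk | hk
  · refine (hN k hk).trans ?_
    gcongr
    · exact (hg k).le
    · linarith [le_abs_self C, Finset.sum_nonneg (s := Finset.range N)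
        fun k _ => abs_nonneg (f k / g k)]
  · rw [← div_le_iff₀ (hg k)]
    have := Finset.single_le_sum (f := fun k => |f k / g k|) (fun k _ => abs_nonneg _)
      (Finset.mem_range.2 hk)
    linarith [abs_nonneg C, le_abs_self (f k / g k)]

theorem exists_norm_Gamma_add_nat_div_le (α β : ℂ) : ∃ C : ℝ, 0 < C ∧ ∀ k : ℕ,
    ‖Complex.Gamma (α + k) / Complex.Gamma (β + k)‖ ≤ C * ((k : ℝ) + 1) ^ (α - β).re := by
  obtain ⟨C, M, -, h⟩ := exists_norm_Gamma_div_Gamma_le (α - 1) (β - 1)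
  refine exists_forall_le_of_eventually_le (C := C) (fun k => by positivity) ?_
  filter_upwards [tendsto_natCast_atTop_atTop.eventually_ge_atTop M] with k hk
  have := h (k + 1) (by simp; linarith)
  have e : ‖(k : ℂ) + 1‖ = k + 1 := by
    rw [← Nat.cast_succ, Complex.norm_natCast]; simp
  rw [e] at this
  convert this using 3 <;> ring_nf

theorem norm_sin_pi_mul_sub_nat (α : ℂ) (k : ℕ) :
    ‖Complex.sin (Real.pi * (α - k))‖ = ‖Complex.sin (Real.pi * α)‖ := by
  rw [mul_sub, mul_comm (Real.pi : ℂ) (k : ℂ), Complex.sin_antiperiodic.sub_nat_mul_eq]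
  simp

/-- In this inverted form the reflection formula also holds at the poles of `Γ`, where
`Complex.Gamma` and the sine both vanish. -/
theorem inv_Gamma_eq {z : ℂ} (h : Complex.Gamma (1 - z) ≠ 0) :
    (Complex.Gamma z)⁻¹ = Complex.sin (Real.pi * z) * Complex.Gamma (1 - z) / Real.pi := by
  have hπ : (Real.pi : ℂ) ≠ 0 := by exact_mod_cast Real.pi_ne_zero
  have h1 := Complex.Gamma_mul_Gamma_one_sub z
  have h2 : Complex.Gamma z = Real.pi / Complex.sin (Real.pi * z) / Complex.Gamma (1 - z) := by
    rw [← h1]; field_simp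
  rw [h2, inv_div, div_div_eq_mul_div]; ring

/-- Reflection, with the modulus of the sine unaffected by integer shifts. For integral `α` both
sides are zero for large `k`, the right-hand one through division by zero, so no case distinction is
needed later. -/
theorem eventually_norm_Gamma_sub_nat (α : ℂ) : ∀ᶠ k : ℕ in atTop,
    Complex.Gamma (1 - α + k) ≠ 0 ∧
    ‖Complex.Gamma (α - k)‖ =
      Real.pi / ‖Complex.sin (Real.pi * α)‖ / ‖Complex.Gamma (1 - α + k)‖ := by
  filter_upwards [tendsto_natCast_atTop_atTop.eventually_ge_atTop ‖α‖] with k hk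
  have hne : Complex.Gamma (1 - α + k) ≠ 0 := by
    apply Complex.Gamma_ne_zero_of_re_pos
    have := Complex.re_le_norm α
    simp; linarith
  refine ⟨hne, ?_⟩
  have h := inv_Gamma_eq (z := α - k) (by rwa [show 1 - (α - k) = 1 - α + k by ring])
  rw [show 1 - (α - k) = 1 - α + k by ring] at h
  have h2 := congrArg norm h
  rw [norm_inv, norm_div, norm_mul, norm_sin_pi_mul_sub_nat, Complex.norm_real,
    Real.norm_of_nonneg Real.pi_pos.le] at h2
  rw [← inv_inv ‖Complex.Gamma (α - k)‖, h2, inv_div, div_div]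

theorem exists_norm_Gamma_sub_nat_div_le (α β : ℂ) : ∃ C : ℝ, 0 < C ∧ ∀ k : ℕ,
    ‖Complex.Gamma (α - k) / Complex.Gamma (β - k)‖ ≤ C * ((k : ℝ) + 1) ^ (α - β).re := by
  obtain ⟨C, -, h⟩ := exists_norm_Gamma_add_nat_div_le (1 - β) (1 - α)
  refine exists_forall_le_of_eventually_le
    (C := ‖Complex.sin (Real.pi * β)‖ / ‖Complex.sin (Real.pi * α)‖ * C)
    (fun k => by positivity) ?_
  filter_upwards [eventually_norm_Gamma_sub_nat α, eventually_norm_Gamma_sub_nat β] with k h1 h2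
  have h3 := h k
  rw [show 1 - β - (1 - α) = α - β by ring, norm_div] at h3
  rw [norm_div, h1.2, h2.2, mul_assoc]
  refine le_trans (le_of_eq ?_) (mul_le_mul_of_nonneg_left h3 (by positivity))
  have := Real.pi_pos
  have := norm_pos_iff.2 h1.1
  have := norm_pos_iff.2 h2.1
  field_simp

theorem exists_norm_inv_Gamma_sub_nat_mul_factorial_le (β : ℂ) : ∃ C : ℝ, 0 < C ∧ ∀ k : ℕ,
    ‖(Complex.Gamma (β - k) * (k.factorial : ℂ))⁻¹‖ ≤ C * ((k : ℝ) + 1) ^ (-β.re) := by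
  obtain ⟨C, -, h⟩ := exists_norm_Gamma_add_nat_div_le (1 - β) 1
  refine exists_forall_le_of_eventually_le
    (C := ‖Complex.sin (Real.pi * β)‖ / Real.pi * C) (fun k => by positivity) ?_
  filter_upwards [eventually_norm_Gamma_sub_nat β] with k h2
  have h3 := h k
  rw [add_comm (1 : ℂ) k, Complex.Gamma_nat_eq_factorial, norm_div] at h3
  simp only [sub_sub_cancel_left, Complex.neg_re] at h3
  rw [norm_inv, norm_mul, h2.2, mul_assoc]
  refine le_trans (le_of_eq ?_) (mul_le_mul_of_nonneg_left h3 (by positivity))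
  have := Real.pi_pos
  have := norm_pos_iff.2 h2.1
  have : 0 < ‖(k.factorial : ℂ)‖ := by simpa using k.factorial_pos
  field_simp

theorem exists_norm_Gamma_sub_nat_mul_factorial_le (α : ℂ) : ∃ C : ℝ, 0 < C ∧ ∀ k : ℕ,
    ‖Complex.Gamma (α - k) * (k.factorial : ℂ)‖ ≤ C * ((k : ℝ) + 1) ^ α.re := by
  obtain ⟨C, -, h⟩ := exists_norm_Gamma_add_nat_div_le 1 (1 - α)
  refine exists_forall_le_of_eventually_le
    (C := Real.pi / ‖Complex.sin (Real.pi * α)‖ * C) (fun k => by positivity) ?_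
  filter_upwards [eventually_norm_Gamma_sub_nat α] with k h2
  have h3 := h k
  rw [add_comm (1 : ℂ) k, Complex.Gamma_nat_eq_factorial, norm_div] at h3
  simp only [sub_sub_cancel] at h3
  rw [norm_mul, h2.2, mul_assoc]
  refine le_trans (le_of_eq ?_) (mul_le_mul_of_nonneg_left h3 (by positivity))
  ring

/-! ### Gamma on vertical strips -/

/-- Jordan's inequality at `π / 2 - |arg v|`, whose sine is `Re v / ‖v‖`. It lets `Im v * arg v` in
Stirling's exponent be replaced by `π / 2 * |Im v|` at a cost linear in `Re v`. -/
theorem pi_div_two_sub_abs_arg_le {v : ℂ} (hv : 0 < v.re) :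
    0 ≤ Real.pi / 2 - |v.arg| ∧ |v.im| * (Real.pi / 2 - |v.arg|) ≤ Real.pi / 2 * v.re := by
  have h1 := (Complex.abs_arg_lt_pi_div_two_iff (z := v)).2 (Or.inl hv)
  refine ⟨by linarith, ?_⟩
  have h2 := Real.mul_le_sin (x := Real.pi / 2 - |v.arg|) (by linarith)
    (by linarith [abs_nonneg v.arg])
  have hv0 : v ≠ 0 := by rintro rfl; simp at hv
  rw [Real.sin_pi_div_two_sub, Real.cos_abs, Complex.cos_arg hv0] at h2
  have hn : 0 < ‖v‖ := norm_pos_iff.2 hv0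
  have h3 : Real.pi / 2 - |v.arg| ≤ Real.pi / 2 * (v.re / ‖v‖) := by
    have := mul_le_mul_of_nonneg_left h2 (by positivity : 0 ≤ Real.pi / 2)
    refine le_trans (le_of_eq ?_) this
    field_simp
  calc _ ≤ ‖v‖ * (Real.pi / 2 * (v.re / ‖v‖)) := by
        gcongr
        exact Complex.abs_im_le_norm v
    _ = _ := by field_simp

theorem im_mul_arg_eq (v : ℂ) : v.im * v.arg = |v.im| * |v.arg| := by
  rcases le_or_gt 0 v.im with h | h
  · rw [abs_of_nonneg h, abs_of_nonneg (Complex.arg_nonneg_iff.2 h)]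
  · rw [abs_of_neg h, abs_of_neg (Complex.arg_neg_iff.2 h)]; ring

theorem abs_stirlingExponent_add_le {v : ℂ} {V : ℝ} (h2 : 2 ≤ v.re) (hV : v.re ≤ V) :
    abs (stirlingExponent v + Real.pi / 2 * |v.im|) ≤
      V * Real.log (V + 1) + V * Real.log (1 + |v.im|) + Real.pi / 2 * V + V := by
  have hn : 1 ≤ ‖v‖ := by have := Complex.re_le_norm v; linarith
  have hl0 : 0 ≤ Real.log ‖v‖ := Real.log_nonneg hn
  have hl : Real.log ‖v‖ ≤ Real.log (V + 1) + Real.log (1 + |v.im|) := by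
    rw [← Real.log_mul (by linarith) (by positivity)]
    apply Real.log_le_log (by linarith)
    have := Complex.norm_le_abs_re_add_abs_im v
    rw [abs_of_nonneg (by linarith : 0 ≤ v.re)] at this
    nlinarith [abs_nonneg v.im]
  obtain ⟨h3, h4⟩ := pi_div_two_sub_abs_arg_le (v := v) (by linarith)
  have h5 := mul_nonneg (abs_nonneg v.im) h3
  have h6 : Real.pi / 2 * v.re ≤ Real.pi / 2 * V := by gcongr
  have h7 : (v.re - 1 / 2) * Real.log ‖v‖ ≤ V * (Real.log (V + 1) + Real.log (1 + |v.im|)) := by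
    gcongr
    · linarith
    · linarith
  have h8 : 0 ≤ (v.re - 1 / 2) * Real.log ‖v‖ := mul_nonneg (by linarith) hl0
  rw [stirlingExponent, im_mul_arg_eq, abs_le]
  constructor <;> nlinarith

/-- Two-sided bounds for `Γ` on a closed vertical strip inside `2 ≤ re v`. -/
theorem exists_norm_Gamma_strip_right (V : ℝ) : ∃ C : ℝ, ∃ M : ℕ, 0 < C ∧ ∀ v : ℂ, 2 ≤ v.re →
    v.re ≤ V → ‖Complex.Gamma v‖ ≤ C * ((1 + |v.im|) ^ M * Real.exp (-(Real.pi / 2 * |v.im|))) ∧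
      Real.exp (-(Real.pi / 2 * |v.im|)) ≤ C * ((1 + |v.im|) ^ M * ‖Complex.Gamma v‖) := by
  obtain ⟨C₀, h0, hst⟩ := exists_norm_Gamma_stirling
  obtain ⟨M, hM⟩ := exists_nat_ge V
  set D := V * Real.log (V + 1) + Real.pi / 2 * V + V with hD
  refine ⟨C₀ * Real.exp D, M, by positivity, fun v h2 hV => ?_⟩
  have h := abs_le.1 (abs_stirlingExponent_add_le h2 hV)
  have hlog : 0 ≤ Real.log (1 + |v.im|) := Real.log_nonneg (by linarith [abs_nonneg v.im])
  have hVM : V * Real.log (1 + |v.im|) ≤ M * Real.log (1 + |v.im|) := by gcongr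
  have hpow : (1 + |v.im|) ^ M = Real.exp (M * Real.log (1 + |v.im|)) := by
    rw [mul_comm, Real.exp_mul, Real.exp_log (by positivity), Real.rpow_natCast]
  rw [hpow]
  have hs := hst v h2
  constructor
  · refine hs.1.trans ?_
    rw [mul_assoc, ← Real.exp_add, ← Real.exp_add]
    gcongr
    linarith [h.1, h.2]
  · have hx : Real.exp (-(Real.pi / 2 * |v.im|)) ≤ Real.exp D *
        (Real.exp (M * Real.log (1 + |v.im|)) * Real.exp (stirlingExponent v)) := by
      rw [← Real.exp_add, ← Real.exp_add]
      gcongr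
      linarith [h.1, h.2]
    refine hx.trans ?_
    calc _ ≤ Real.exp D * (Real.exp (M * Real.log (1 + |v.im|)) * (C₀ * ‖Complex.Gamma v‖)) := by
          gcongr; exact hs.2
      _ = _ := by ring

theorem Gamma_add_nat_eq_prod {v : ℂ} (hv : ∀ j : ℕ, v + j ≠ 0) (K : ℕ) :
    Complex.Gamma (v + K) = Complex.Gamma v * ∏ j ∈ Finset.range K, (v + j) := by
  induction K with
  | zero => simp
  | succ M ih =>
    rw [Finset.prod_range_succ, ← mul_assoc, ← ih]; push_cast
    rw [← add_assoc, Complex.Gamma_add_one _ (hv M), mul_comm]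

/-- Two-sided bounds for `Γ` on an arbitrary vertical strip, away from the real axis. -/
theorem exists_norm_Gamma_strip (α : ℂ) (σ₁ σ₂ : ℝ) : ∃ C T : ℝ, ∃ M : ℕ, 0 < C ∧ 0 < T ∧
    ∀ s : ℂ, σ₁ ≤ s.re → s.re ≤ σ₂ → T ≤ |s.im| →
    ‖Complex.Gamma (α + s)‖ ≤ C * ((1 + |s.im|) ^ M * Real.exp (-(Real.pi / 2 * |s.im|))) ∧
      Real.exp (-(Real.pi / 2 * |s.im|)) ≤ C * ((1 + |s.im|) ^ M * ‖Complex.Gamma (α + s)‖) := by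
  -- Shifting by `K` moves the whole strip into `2 ≤ re v`; the functional equation undoes the shift
  -- at the price of a product of `K` linear factors.
  obtain ⟨K, hK⟩ := exists_nat_ge (2 - σ₁ - α.re)
  obtain ⟨C, M, hC, h⟩ := exists_norm_Gamma_strip_right (α.re + σ₂ + K)
  set B := |α.im| with hB
  set S := |α.re| + |σ₁| + |σ₂| + B + K + 1 with hS
  set E := Real.exp (Real.pi / 2 * B) with hE
  have hB0 : 0 ≤ B := abs_nonneg _
  have hS1 : 1 ≤ S := by rw [hS]; have := (K.cast_nonneg : (0 : ℝ) ≤ K); linarith [abs_nonneg α.re, abs_nonneg σ₁, abs_nonneg σ₂]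
  refine ⟨C * (1 + B) ^ M * E * S ^ K, B + 1, M + K, by positivity, by positivity,
    fun s h1 h2 hT => ?_⟩
  set t := s.im with ht
  set v := α + s + K with hv
  have hvim : v.im = t + α.im := by simp [hv, ht]; ring
  have hτ1 : |v.im| ≤ |t| + B := by rw [hvim]; exact abs_add_le _ _
  have hτ2 : |t| ≤ |v.im| + B := by
    have := abs_sub (v.im) α.im
    rwa [hvim, add_sub_cancel_right, ← hvim] at this
  have hK0 := (K.cast_nonneg : (0 : ℝ) ≤ K)
  obtain ⟨u1, u2⟩ := h v (by simp [hv]; linarith) (by simp [hv]; linarith)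
  have hpow : (1 + |v.im|) ^ M ≤ (1 + B) ^ M * (1 + |t|) ^ M := by
    rw [← mul_pow]
    gcongr
    nlinarith [abs_nonneg t]
  have he1 : Real.exp (-(Real.pi / 2 * |v.im|)) ≤ E * Real.exp (-(Real.pi / 2 * |t|)) := by
    rw [hE, ← Real.exp_add]
    gcongr
    nlinarith [Real.pi_pos]
  have he2 : Real.exp (-(Real.pi / 2 * |t|)) ≤ E * Real.exp (-(Real.pi / 2 * |v.im|)) := by
    rw [hE, ← Real.exp_add]
    gcongr
    nlinarith [Real.pi_pos]
  -- The threshold `|α.im| + 1` for `|s.im|` makes every factor at least one in modulus, so dropping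
  -- the product is free in one direction. In the other it costs a polynomial of degree `K`.
  have hfac : ∀ j : ℕ, 1 ≤ ‖α + s + j‖ := fun j => by
    refine le_trans ?_ (Complex.abs_im_le_norm _)
    have : (α + s + j).im = v.im := by simp [hv]
    rw [this]; linarith
  have hfac2 : ∀ j ∈ Finset.range K, ‖α + s + j‖ ≤ S * (1 + |t|) := fun j hj => by
    refine (Complex.norm_le_abs_re_add_abs_im _).trans ?_
    have e : (α + s + j).im = v.im := by simp [hv]
    have e2 : |(α + s + j).re| ≤ |α.re| + |s.re| + j := by
      simp only [Complex.add_re, Complex.natCast_re]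
      exact (abs_add_three _ _ _).trans (by simp)
    have hjK : (j : ℝ) ≤ K := by exact_mod_cast (Finset.mem_range.1 hj).le
    have hs : |s.re| ≤ |σ₁| + |σ₂| := abs_le.2
      ⟨by linarith [neg_abs_le σ₁, abs_nonneg σ₂], by linarith [le_abs_self σ₂, abs_nonneg σ₁]⟩
    rw [e]
    nlinarith [abs_nonneg t]
  have hprod := Gamma_add_nat_eq_prod (v := α + s) (fun j h0 => by
    have := hfac j; rw [h0, norm_zero] at this; linarith) K
  set P := ∏ j ∈ Finset.range K, (α + s + j) with hP
  have hP1 : 1 ≤ ‖P‖ := by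
    rw [hP, norm_prod, ← Finset.prod_const_one (s := Finset.range K)]
    exact Finset.prod_le_prod (fun _ _ => zero_le_one) (fun j _ => hfac j)
  have hP2 : ‖P‖ ≤ S ^ K * (1 + |t|) ^ K := by
    rw [hP, norm_prod, ← mul_pow]
    refine (Finset.prod_le_prod (fun _ _ => norm_nonneg _) hfac2).trans ?_
    simp
  rw [← hv] at hprod
  rw [hprod, norm_mul] at u1 u2
  have hG := norm_nonneg (Complex.Gamma (α + s))
  have hSK : 1 ≤ S ^ K := one_le_pow₀ hS1
  have htK : 1 ≤ (1 + |t|) ^ K := one_le_pow₀ (by linarith [abs_nonneg t])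
  constructor
  · calc ‖Complex.Gamma (α + s)‖ ≤ ‖Complex.Gamma (α + s)‖ * ‖P‖ := le_mul_of_one_le_right hG hP1
      _ ≤ C * (((1 + B) ^ M * (1 + |t|) ^ M) * (E * Real.exp (-(Real.pi / 2 * |t|)))) := by
          refine u1.trans ?_
          gcongr
      _ = C * (1 + B) ^ M * E * 1 * ((1 + |t|) ^ M * 1 * Real.exp (-(Real.pi / 2 * |t|))) := by ring
      _ ≤ C * (1 + B) ^ M * E * S ^ K *
          ((1 + |t|) ^ M * (1 + |t|) ^ K * Real.exp (-(Real.pi / 2 * |t|))) := by gcongr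
      _ = _ := by rw [pow_add]
  · calc Real.exp (-(Real.pi / 2 * |t|)) ≤ E * Real.exp (-(Real.pi / 2 * |v.im|)) := he2
      _ ≤ E * (C * (((1 + B) ^ M * (1 + |t|) ^ M) *
          (‖Complex.Gamma (α + s)‖ * (S ^ K * (1 + |t|) ^ K)))) := by
          gcongr
          refine u2.trans ?_
          gcongr
      _ = _ := by rw [pow_add]; ring

/-! ### Residue theorem for rectangles and shifts of vertical lines -/

/-- The integral over the boundary of the rectangle `[x₁, x₂] × [y₁, y₂]`. -/
def rectIntegral (f : ℂ → ℂ) (x₁ x₂ y₁ y₂ : ℝ) : ℂ :=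
  (((∫ x in x₁..x₂, f (x + y₁ * Complex.I)) - ∫ x in x₁..x₂, f (x + y₂ * Complex.I)) +
    Complex.I * ∫ y in y₁..y₂, f (x₂ + y * Complex.I)) -
    Complex.I * ∫ y in y₁..y₂, f (x₁ + y * Complex.I)

theorem rectIntegral_eq_zero {f : ℂ → ℂ} {x₁ x₂ y₁ y₂ : ℝ} (hx : x₁ ≤ x₂) (hy : y₁ ≤ y₂)
    (h : ∀ s : ℂ, s.re ∈ Set.Icc x₁ x₂ → s.im ∈ Set.Icc y₁ y₂ → DifferentiableAt ℂ f s) :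
    rectIntegral f x₁ x₂ y₁ y₂ = 0 := by
  have := Complex.integral_boundary_rect_eq_zero_of_differentiableOn f ⟨x₁, y₁⟩ ⟨x₂, y₂⟩
    (fun s hs => by
      rw [Complex.mem_reProdIm, Set.uIcc_of_le hx, Set.uIcc_of_le hy] at hs
      exact (h s hs.1 hs.2).differentiableWithinAt)
  simpa [rectIntegral] using this

theorem log_I_mul {v : ℂ} (hv : 0 < v.re) :
    Complex.log (Complex.I * v) = Complex.log v + Real.pi / 2 * Complex.I := by
  have h := abs_lt.1 ((Complex.abs_arg_lt_pi_div_two_iff (z := v)).2 (Or.inl hv))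
  rw [Complex.log_mul Complex.I_ne_zero (by rintro rfl; simp at hv), Complex.log_I]
  · ring
  · rw [Complex.arg_I]; constructor <;> linarith [h.1, h.2, Real.pi_pos]

theorem log_neg_I_mul {v : ℂ} (hv : 0 < v.re) :
    Complex.log (-Complex.I * v) = Complex.log v - Real.pi / 2 * Complex.I := by
  have h := abs_lt.1 ((Complex.abs_arg_lt_pi_div_two_iff (z := v)).2 (Or.inl hv))
  rw [Complex.log_mul (neg_ne_zero.2 Complex.I_ne_zero) (by rintro rfl; simp at hv),
    Complex.log_neg_I]
  · ring
  · rw [Complex.arg_neg_I]; constructor <;> linarith [h.1, h.2, Real.pi_pos]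

/-- The integral of `1 / s` along a segment that stays in the slit half-plane `0 < re (c s)`. -/
theorem integral_inv_segment {c v₀ v₁ : ℂ} {a b : ℝ} (hc : c ≠ 0)
    (h : ∀ x ∈ Set.uIcc a b, 0 < (c * (v₀ + x * v₁)).re) :
    v₁ * ∫ x in a..b, (v₀ + x * v₁)⁻¹ =
      Complex.log (c * (v₀ + b * v₁)) - Complex.log (c * (v₀ + a * v₁)) := by
  have hne : ∀ x ∈ Set.uIcc a b, v₀ + x * v₁ ≠ 0 := fun x hx h0 => by
    have := h x hx; rw [h0] at this; simp at this
  rw [← intervalIntegral.integral_const_mul]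
  refine intervalIntegral.integral_eq_sub_of_hasDerivAt
    (f := fun x : ℝ => Complex.log (c * (v₀ + x * v₁))) (fun x hx => ?_) ?_
  · have h1 : HasDerivAt (fun x : ℝ => c * (v₀ + x * v₁)) (c * (1 * v₁)) x :=
      (((Complex.ofRealCLM.hasDerivAt (x := x)).mul_const v₁).const_add v₀).const_mul c
    have h2 := h1.clog_real (Or.inl (h x hx))
    rwa [one_mul, mul_div_mul_left _ _ hc, div_eq_mul_inv] at h2
  · refine ContinuousOn.intervalIntegrable ?_
    refine continuousOn_const.mul (ContinuousOn.inv₀ (by fun_prop) hne)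

/-- Each side lies in an open half-plane with its own branch of the logarithm, `log (c * (s - p))`
with `c` equal to `I`, `-I`, `1` or `-1`. At each of the four corners the adjacent branches differ
by `π / 2 * I`, and the four jumps add up to `2π * I`. -/
theorem rectIntegral_inv {p : ℂ} {x₁ x₂ y₁ y₂ : ℝ} (hx₁ : x₁ < p.re) (hx₂ : p.re < x₂)
    (hy₁ : y₁ < p.im) (hy₂ : p.im < y₂) :
    rectIntegral (fun s => (s - p)⁻¹) x₁ x₂ y₁ y₂ = 2 * Real.pi * Complex.I := by
  have e1 := integral_inv_segment (c := Complex.I) (v₀ := y₁ * Complex.I - p) (v₁ := 1) (a := x₁)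
    (b := x₂) Complex.I_ne_zero (fun x _ => by simpa using hy₁)
  have e2 := integral_inv_segment (c := -Complex.I) (v₀ := y₂ * Complex.I - p) (v₁ := 1) (a := x₁)
    (b := x₂) (neg_ne_zero.2 Complex.I_ne_zero) (fun x _ => by simpa using hy₂)
  have e3 := integral_inv_segment (c := 1) (v₀ := x₂ - p) (v₁ := Complex.I) (a := y₁)
    (b := y₂) one_ne_zero (fun x _ => by simpa using hx₂)
  have e4 := integral_inv_segment (c := -1) (v₀ := x₁ - p) (v₁ := Complex.I) (a := y₁)
    (b := y₂) (neg_ne_zero.2 one_ne_zero) (fun x _ => by simpa using hx₁)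
  have c1 := log_I_mul (v := x₂ + y₁ * Complex.I - p) (by simpa using hx₂)
  have c2 := log_neg_I_mul (v := x₂ + y₂ * Complex.I - p) (by simpa using hx₂)
  have c3 := log_I_mul (v := -(x₁ + y₂ * Complex.I - p)) (by simpa using hx₁)
  have c4 := log_neg_I_mul (v := -(x₁ + y₁ * Complex.I - p)) (by simpa using hx₁)
  rw [one_mul] at e1 e2
  unfold rectIntegral
  have r1 : ∀ x y : ℝ, (x : ℂ) + y * Complex.I - p = y * Complex.I - p + x * 1 := fun x y => by ring
  have r2 : ∀ x y : ℝ, (x : ℂ) + y * Complex.I - p = x - p + y * Complex.I := fun x y => by ring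
  have i1 : ∀ y : ℝ, ∫ x in x₁..x₂, ((x : ℂ) + y * Complex.I - p)⁻¹ =
      ∫ x in x₁..x₂, ((y : ℂ) * Complex.I - p + x * 1)⁻¹ := fun y => by simp only [r1]
  have i2 : ∀ x : ℝ, ∫ y in y₁..y₂, ((x : ℂ) + y * Complex.I - p)⁻¹ =
      ∫ y in y₁..y₂, ((x : ℂ) - p + y * Complex.I)⁻¹ := fun x => by simp only [r2]
  rw [i1, i1, i2, i2, e1, e2, e3, e4]
  have n3 : Complex.I * -(x₁ + y₂ * Complex.I - p) = -Complex.I * (x₁ + y₂ * Complex.I - p) := by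
    ring
  have n4 : -Complex.I * -(x₁ + y₁ * Complex.I - p) = Complex.I * (x₁ + y₁ * Complex.I - p) := by
    ring
  rw [n3] at c3
  rw [n4] at c4
  simp only [← r1, ← r2, one_mul, neg_mul] at c1 c2 c3 c4 ⊢
  rw [c1, c2, c3, c4]
  ring

theorem rectIntegral_congr {f g : ℂ → ℂ} {x₁ x₂ y₁ y₂ : ℝ}
    (h : ∀ s : ℂ, (s.re = x₁ ∨ s.re = x₂ ∨ s.im = y₁ ∨ s.im = y₂) → f s = g s) :
    rectIntegral f x₁ x₂ y₁ y₂ = rectIntegral g x₁ x₂ y₁ y₂ := by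
  unfold rectIntegral
  congr 1
  · congr 1
    · congr 1 <;> refine intervalIntegral.integral_congr fun x _ => h _ (by simp)
    · congr 1; exact intervalIntegral.integral_congr fun x _ => h _ (by simp)
  · congr 1; exact intervalIntegral.integral_congr fun x _ => h _ (by simp)

theorem rectIntegral_add_const_mul {f g : ℂ → ℂ} {x₁ x₂ y₁ y₂ : ℝ} (r : ℂ)
    (hf : ∀ s : ℂ, s.re ∈ Set.uIcc x₁ x₂ → s.im ∈ Set.uIcc y₁ y₂ →
      (s.re = x₁ ∨ s.re = x₂ ∨ s.im = y₁ ∨ s.im = y₂) → ContinuousAt f s)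
    (hg : ∀ s : ℂ, s.re ∈ Set.uIcc x₁ x₂ → s.im ∈ Set.uIcc y₁ y₂ →
      (s.re = x₁ ∨ s.re = x₂ ∨ s.im = y₁ ∨ s.im = y₂) → ContinuousAt g s) :
    rectIntegral (fun s => f s + r * g s) x₁ x₂ y₁ y₂ =
      rectIntegral f x₁ x₂ y₁ y₂ + r * rectIntegral g x₁ x₂ y₁ y₂ := by
  have key : ∀ (k : ℂ → ℂ), (∀ s : ℂ, s.re ∈ Set.uIcc x₁ x₂ → s.im ∈ Set.uIcc y₁ y₂ →
      (s.re = x₁ ∨ s.re = x₂ ∨ s.im = y₁ ∨ s.im = y₂) → ContinuousAt k s) →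
      (∀ y : ℝ, y = y₁ ∨ y = y₂ →
        IntervalIntegrable (fun x : ℝ => k (x + y * Complex.I)) volume x₁ x₂) ∧
      (∀ x : ℝ, x = x₁ ∨ x = x₂ →
        IntervalIntegrable (fun y : ℝ => k (x + y * Complex.I)) volume y₁ y₂) := by
    intro k hk
    constructor
    · intro y hy
      refine ContinuousOn.intervalIntegrable fun x hx => ContinuousAt.continuousWithinAt ?_
      refine ContinuousAt.comp (g := k) (hk _ (by simpa using hx) ?_ ?_) (by fun_prop)
      · rcases hy with rfl | rfl <;> simp
      · rcases hy with rfl | rfl <;> simp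
    · intro x hx
      refine ContinuousOn.intervalIntegrable fun y hy => ContinuousAt.continuousWithinAt ?_
      refine ContinuousAt.comp (g := k) (hk _ ?_ (by simpa using hy) ?_) (by fun_prop)
      · rcases hx with rfl | rfl <;> simp
      · rcases hx with rfl | rfl <;> simp
  obtain ⟨f1, f2⟩ := key f hf
  obtain ⟨g1, g2⟩ := key g hg
  unfold rectIntegral
  rw [intervalIntegral.integral_add (f1 _ (Or.inl rfl)) ((g1 _ (Or.inl rfl)).const_mul r),
    intervalIntegral.integral_add (f1 _ (Or.inr rfl)) ((g1 _ (Or.inr rfl)).const_mul r),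
    intervalIntegral.integral_add (f2 _ (Or.inl rfl)) ((g2 _ (Or.inl rfl)).const_mul r),
    intervalIntegral.integral_add (f2 _ (Or.inr rfl)) ((g2 _ (Or.inr rfl)).const_mul r)]
  simp only [intervalIntegral.integral_const_mul]
  ring

/-- The residue theorem for a rectangle and a function with finitely many simple poles. -/
theorem rectIntegral_eq_sum_residues {x₁ x₂ y₁ y₂ : ℝ} (hx : x₁ ≤ x₂) (hy : y₁ ≤ y₂)
    (r : ℂ → ℂ) (P : Finset ℂ)
    (hP : ∀ p ∈ P, p.re ∈ Set.Ioo x₁ x₂ ∧ p.im ∈ Set.Ioo y₁ y₂) (f : ℂ → ℂ)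
    (hd : ∀ s : ℂ, s.re ∈ Set.Icc x₁ x₂ → s.im ∈ Set.Icc y₁ y₂ → s ∉ P → DifferentiableAt ℂ f s)
    (hr : ∀ p ∈ P, Tendsto (fun s => (s - p) * f s) (𝓝[≠] p) (𝓝 (r p))) :
    rectIntegral f x₁ x₂ y₁ y₂ = 2 * Real.pi * Complex.I * ∑ p ∈ P, r p := by
  classical
  induction P using Finset.induction_on generalizing f with
  | empty =>
    simp only [Finset.sum_empty, mul_zero]
    exact rectIntegral_eq_zero hx hy fun s h1 h2 => hd s h1 h2 (by simp)
  | insert p P hpP ih =>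
    obtain ⟨hpx, hpy⟩ := hP p (Finset.mem_insert_self _ _)
    -- One principal part is subtracted. The singularity of `g` at `p` is removable, and `G` is `g`
    -- with the limit filled in, so the induction hypothesis applies to `G` with one pole fewer.
    set g : ℂ → ℂ := fun s => f s - r p * (s - p)⁻¹ with hg
    set G : ℂ → ℂ := Function.update g p (limUnder (𝓝[≠] p) g) with hG
    have hGg : ∀ s, s ≠ p → G =ᶠ[𝓝 s] g := fun s hs => by
      filter_upwards [isOpen_ne.mem_nhds hs] with x hx
      exact Function.update_of_ne hx _ _
    have hgd : ∀ s, s ≠ p → DifferentiableAt ℂ f s → DifferentiableAt ℂ g s := fun s hs h =>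
      h.sub ((differentiableAt_inv (sub_ne_zero.2 hs)).comp s (by fun_prop) |>.const_mul _)
    have hlim : Tendsto (fun s => (s - p) * g s) (𝓝[≠] p) (𝓝 0) := by
      have := (hr p (Finset.mem_insert_self _ _)).sub_const (r p)
      rw [sub_self] at this
      refine this.congr' ?_
      filter_upwards [self_mem_nhdsWithin] with s hs
      have : s - p ≠ 0 := sub_ne_zero.2 hs
      simp only [hg]; field_simp
    have hev : ∀ᶠ s in 𝓝[≠] p, s ∉ insert p P ∧ s.re ∈ Set.Icc x₁ x₂ ∧ s.im ∈ Set.Icc y₁ y₂ := by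
      have h1 : ∀ᶠ s in 𝓝[≠] p, s ∉ P := by
        refine nhdsWithin_le_nhds ?_
        exact (P.finite_toSet.isClosed.isOpen_compl).mem_nhds (by simpa using hpP)
      have h2 : ∀ᶠ s in 𝓝[≠] p, s.re ∈ Set.Icc x₁ x₂ := nhdsWithin_le_nhds
        (Complex.continuous_re.continuousAt.preimage_mem_nhds (Icc_mem_nhds hpx.1 hpx.2))
      have h3 : ∀ᶠ s in 𝓝[≠] p, s.im ∈ Set.Icc y₁ y₂ := nhdsWithin_le_nhds
        (Complex.continuous_im.continuousAt.preimage_mem_nhds (Icc_mem_nhds hpy.1 hpy.2))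
      filter_upwards [h1, h2, h3, self_mem_nhdsWithin] with s a1 a2 a3 a4
      exact ⟨by simpa using ⟨a4, a1⟩, a2, a3⟩
    have hGp : DifferentiableAt ℂ G p := by
      obtain ⟨U, hU, hUo⟩ := mem_nhdsWithin_iff_exists_mem_nhds_inter.1 hev
      have hdU : DifferentiableOn ℂ g (U \ {p}) := fun s hs => by
        obtain ⟨b1, b2, b3⟩ := hUo ⟨hs.1, hs.2⟩
        exact (hgd s hs.2 (hd s b2 b3 b1)).differentiableWithinAt
      have hdiff := Complex.differentiableOn_update_limUnder_of_isLittleO hU hdU (by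
        have h0 : Tendsto (fun s => (s - p) * (g s - g p)) (𝓝[≠] p) (𝓝 0) := by
          have : Tendsto (fun s => (s - p) * g p) (𝓝[≠] p) (𝓝 0) := by
            have hc : ContinuousAt (fun s => (s - p) * g p) p := by fun_prop
            simpa using hc.tendsto.mono_left nhdsWithin_le_nhds
          simpa [mul_sub] using hlim.sub this
        rw [Asymptotics.isLittleO_iff_tendsto']
        · refine h0.congr fun s => ?_
          rw [div_inv_eq_mul, mul_comm]
        · filter_upwards [self_mem_nhdsWithin] with s hs h
          exact absurd (inv_eq_zero.1 h) (sub_ne_zero.2 hs))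
      exact hdiff.differentiableAt hU
    have hmain := ih (fun q hq => hP q (Finset.mem_insert_of_mem hq)) G (fun s h1 h2 h3 => by
        rcases eq_or_ne s p with rfl | hs
        · exact hGp
        · exact (hGg s hs).differentiableAt_iff.2 (hgd s hs (hd s h1 h2 (by simp [hs, h3]))))
      (fun q hq => by
        have hqp : q ≠ p := fun h => hpP (h ▸ hq)
        have h1 : Tendsto (fun s => (s - q) * f s - (s - q) * (r p * (s - p)⁻¹)) (𝓝[≠] q)
            (𝓝 (r q - (q - q) * (r p * (q - p)⁻¹))) := by
          refine (hr q (Finset.mem_insert_of_mem hq)).sub ?_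
          have hc : ContinuousAt (fun s => (s - q) * (r p * (s - p)⁻¹)) q := by
            have := sub_ne_zero.2 hqp
            fun_prop (disch := assumption)
          exact hc.tendsto.mono_left nhdsWithin_le_nhds
        rw [sub_self, zero_mul, sub_zero] at h1
        refine h1.congr' ?_
        filter_upwards [(hGg q hqp).filter_mono nhdsWithin_le_nhds] with s hs
        rw [hs]; simp only [hg]; ring)
    have hbd : ∀ s : ℂ, (s.re = x₁ ∨ s.re = x₂ ∨ s.im = y₁ ∨ s.im = y₂) → s ∉ insert p P := by
      intro s hs hmem
      obtain ⟨h1, h2⟩ := hP s hmem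
      rcases hs with h | h | h | h
      · exact h1.1.ne' h
      · exact h1.2.ne h
      · exact h2.1.ne' h
      · exact h2.2.ne h
    have hfe : rectIntegral f x₁ x₂ y₁ y₂ =
        rectIntegral (fun s => G s + r p * (s - p)⁻¹) x₁ x₂ y₁ y₂ := by
      refine rectIntegral_congr fun s hs => ?_
      have hsp : s ≠ p := fun h => hbd s hs (by simp [h])
      rw [(hGg s hsp).eq_of_nhds]; simp only [hg]; ring
    rw [hfe, rectIntegral_add_const_mul (f := G) (g := fun s => (s - p)⁻¹), hmain,
      rectIntegral_inv hpx.1 hpx.2 hpy.1 hpy.2, Finset.sum_insert hpP]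
    · ring
    · intro s h1 h2 hs
      rw [Set.uIcc_of_le hx] at h1
      rw [Set.uIcc_of_le hy] at h2
      have hsP := hbd s hs
      have hsp : s ≠ p := fun h => hsP (by simp [h])
      exact ((hGg s hsp).differentiableAt_iff.2 (hgd s hsp (hd s h1 h2 hsP))).continuousAt
    · intro s _ _ hs
      have hsp : s - p ≠ 0 := sub_ne_zero.2 fun h => hbd s hs (by simp [h])
      fun_prop (disch := assumption)

/-- Moving a vertical line of integration across finitely many simple poles. -/
theorem integral_vertical_sub_eq_sum_residues {σ₁ σ₂ : ℝ} (hσ : σ₁ ≤ σ₂)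
    (r : ℂ → ℂ) (P : Finset ℂ) (hP : ∀ p ∈ P, p.re ∈ Set.Ioo σ₁ σ₂) (f : ℂ → ℂ)
    (hd : ∀ s : ℂ, s.re ∈ Set.Icc σ₁ σ₂ → s ∉ P → DifferentiableAt ℂ f s)
    (hr : ∀ p ∈ P, Tendsto (fun s => (s - p) * f s) (𝓝[≠] p) (𝓝 (r p)))
    (h₁ : Integrable fun y : ℝ => f (σ₁ + y * Complex.I))
    (h₂ : Integrable fun y : ℝ => f (σ₂ + y * Complex.I))
    (hdecay : ∀ η : ℝ, 0 < η → ∃ T : ℝ, ∀ s : ℂ, s.re ∈ Set.Icc σ₁ σ₂ → T ≤ |s.im| → ‖f s‖ ≤ η) :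
    (∫ y : ℝ, f (σ₂ + y * Complex.I)) - (∫ y : ℝ, f (σ₁ + y * Complex.I)) =
      2 * Real.pi * ∑ p ∈ P, r p := by
  have hneg : Tendsto (fun T : ℝ => -T) atTop atBot := tendsto_neg_atTop_atBot
  have t1 := intervalIntegral_tendsto_integral h₁ hneg tendsto_id
  have t2 := intervalIntegral_tendsto_integral h₂ hneg tendsto_id
  have hor : ∀ ε : ℝ, ε = 1 ∨ ε = -1 →
      Tendsto (fun T : ℝ => ∫ x in σ₁..σ₂, f (x + (ε * T : ℝ) * Complex.I)) atTop (𝓝 0) := by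
    intro ε hε
    rw [Metric.tendsto_nhds]
    intro η hη
    obtain ⟨T, hT⟩ := hdecay (η / (2 * (|σ₂ - σ₁| + 1))) (by positivity)
    filter_upwards [eventually_ge_atTop T, eventually_ge_atTop 0] with X hX hX0
    rw [dist_zero_right]
    have := intervalIntegral.norm_integral_le_of_norm_le_const (a := σ₁) (b := σ₂)
      (f := fun x : ℝ => f (x + (ε * X : ℝ) * Complex.I)) (C := η / (2 * (|σ₂ - σ₁| + 1)))
      (fun x hx => by
        rw [Set.uIoc_of_le hσ] at hx
        refine hT _ (by simpa using ⟨hx.1.le, hx.2⟩) ?_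
        rcases hε with rfl | rfl <;> simpa [abs_of_nonneg hX0] using hX)
    refine this.trans_lt ?_
    rw [div_mul_eq_mul_div, div_lt_iff₀ (by positivity)]
    nlinarith [abs_nonneg (σ₂ - σ₁)]
  have t3 := hor 1 (Or.inl rfl)
  have t4 := hor (-1) (Or.inr rfl)
  have tt : Tendsto (fun T : ℝ => rectIntegral f σ₁ σ₂ (-T) T) atTop
      (𝓝 (((0 - 0) + Complex.I * ∫ y : ℝ, f (σ₂ + y * Complex.I)) -
        Complex.I * ∫ y : ℝ, f (σ₁ + y * Complex.I))) := by
    refine (((t4.sub t3).add (t2.const_mul Complex.I)).sub (t1.const_mul Complex.I)).congr ?_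
    intro T
    simp [rectIntegral]
  obtain ⟨B, hB⟩ : ∃ B : ℝ, ∀ p ∈ P, |p.im| ≤ B := by
    refine ⟨∑ p ∈ P, |p.im|, fun p hp => ?_⟩
    exact Finset.single_le_sum (f := fun p : ℂ => |p.im|) (fun _ _ => abs_nonneg _) hp
  have hc : Tendsto (fun T : ℝ => rectIntegral f σ₁ σ₂ (-T) T) atTop
      (𝓝 (2 * Real.pi * Complex.I * ∑ p ∈ P, r p)) := by
    refine tendsto_const_nhds.congr' ?_
    filter_upwards [eventually_gt_atTop B, eventually_ge_atTop 0] with T hT hT0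
    refine (rectIntegral_eq_sum_residues hσ (by linarith) r P (fun p hp => ⟨hP p hp, ?_⟩) f
      (fun s h1 _ h3 => hd s h1 h3) hr).symm
    have := abs_le.1 (hB p hp)
    constructor <;> linarith [this.1, this.2]
  have := tendsto_nhds_unique tt hc
  have hI := Complex.I_ne_zero
  apply mul_left_cancel₀ hI
  linear_combination this

/-! ### Exponential decay and integrability -/

/-- Polynomial losses from Gamma bounds are paid for by giving up part of the exponential rate. -/
theorem exists_one_add_pow_mul_exp_le (M : ℕ) {η η' : ℝ} (h : η' < η) : ∃ C : ℝ, 0 < C ∧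
    ∀ x : ℝ, 0 ≤ x → (1 + x) ^ M * Real.exp (-(η * x)) ≤ C * Real.exp (-(η' * x)) := by
  have hδ : 0 < η - η' := sub_pos.2 h
  refine ⟨M.factorial / (η - η') ^ M * Real.exp (η - η'), by positivity, fun x hx => ?_⟩
  have h1 := Real.pow_div_factorial_le_exp ((η - η') * (1 + x)) (by positivity) M
  rw [div_le_iff₀ (by positivity), mul_pow] at h1
  have h2 : (1 + x) ^ M ≤ M.factorial / (η - η') ^ M * Real.exp ((η - η') * (1 + x)) := by
    rw [div_mul_eq_mul_div, le_div_iff₀ (by positivity)]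
    linarith
  calc _ ≤ M.factorial / (η - η') ^ M * Real.exp ((η - η') * (1 + x)) * Real.exp (-(η * x)) := by
        gcongr
    _ = _ := by
      rw [mul_assoc, mul_assoc, ← Real.exp_add, ← Real.exp_add]
      congr 2; ring

theorem integrable_exp_neg_mul_abs {η : ℝ} (hη : 0 < η) :
    Integrable fun y : ℝ => Real.exp (-(η * |y|)) := by
  have h1 : IntegrableOn (fun y : ℝ => Real.exp (-(η * |y|))) (Set.Ioi 0) := by
    refine (integrableOn_exp_mul_Ioi (neg_lt_zero.2 hη) 0).congr_fun (fun y hy => ?_)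
      measurableSet_Ioi
    simp only [abs_of_pos (Set.mem_Ioi.1 hy), neg_mul]
  have h2 : IntegrableOn (fun y : ℝ => Real.exp (-(η * |y|))) (Set.Iic 0) := by
    refine (integrableOn_exp_mul_Iic hη 0).congr_fun (fun y hy => ?_) measurableSet_Iic
    simp only [abs_of_nonpos (Set.mem_Iic.1 hy), mul_neg, neg_neg]
  have := h2.union h1
  rwa [Set.Iic_union_Ioi, integrableOn_univ] at this

/-- A bound valid for large `|y|` extends to all `y`, by continuity. -/
theorem exists_bound_of_bound_large {f : ℝ → ℂ} (hf : Continuous f) {g : ℝ → ℝ} (hg : Continuous g)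
    (hg0 : ∀ y, 0 < g y) {C T : ℝ} (h : ∀ y, T ≤ |y| → ‖f y‖ ≤ C * g y) :
    ∃ C' : ℝ, 0 < C' ∧ ∀ y, ‖f y‖ ≤ C' * g y := by
  obtain ⟨B, hB⟩ := (isCompact_Icc (a := -|T|) (b := |T|)).exists_bound_of_continuousOn
    (f := fun y => ‖f y‖ / g y) ((hf.norm.div hg fun y => (hg0 y).ne').continuousOn)
  refine ⟨|B| + |C| + 1, by positivity, fun y => ?_⟩
  rcases le_or_gt T |y| with hy | hy
  · refine (h y hy).trans ?_
    gcongr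
    · exact (hg0 y).le
    · linarith [le_abs_self C, abs_nonneg B]
  · have := hB y (abs_le.1 (hy.le.trans (le_abs_self T)))
    rw [← div_le_iff₀ (hg0 y)]
    linarith [Real.le_norm_self (‖f y‖ / g y), le_abs_self B, abs_nonneg C]

theorem integrable_of_norm_le_exp_neg {f : ℝ → ℂ} (hf : Continuous f) {η C T : ℝ} (hη : 0 < η)
    (h : ∀ y, T ≤ |y| → ‖f y‖ ≤ C * Real.exp (-(η * |y|))) : Integrable f := by
  obtain ⟨C', -, hC'⟩ := exists_bound_of_bound_large hf (by fun_prop) (fun y => Real.exp_pos _) h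
  exact ((integrable_exp_neg_mul_abs hη).const_mul C').mono' hf.aestronglyMeasurable
    (Eventually.of_forall hC')

/-! ### The Mellin–Barnes integrand, its residues and its decay -/

/-- The residue of `Γ` at `-k`. -/
theorem tendsto_add_nat_mul_Gamma (k : ℕ) :
    Tendsto (fun u : ℂ => (u + k) * Complex.Gamma u) (𝓝[≠] (-k : ℂ))
      (𝓝 ((-1) ^ k / (k.factorial : ℂ))) := by
  induction k with
  | zero => simpa using Complex.tendsto_self_mul_Gamma_nhds_zero
  | succ k ih =>
    have hk : (-((k + 1 : ℕ) : ℂ)) ≠ 0 := neg_ne_zero.2 (by exact_mod_cast k.succ_ne_zero)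
    have hsh : Tendsto (fun u : ℂ => u + 1) (𝓝[≠] (-((k + 1 : ℕ) : ℂ))) (𝓝[≠] (-k : ℂ)) := by
      refine tendsto_nhdsWithin_iff.2 ⟨?_, ?_⟩
      · have : ContinuousAt (fun u : ℂ => u + 1) (-((k + 1 : ℕ) : ℂ)) := by fun_prop
        have h := this.tendsto
        rw [show -((k + 1 : ℕ) : ℂ) + 1 = -k by push_cast; ring] at h
        exact h.mono_left nhdsWithin_le_nhds
      · filter_upwards [self_mem_nhdsWithin] with u hu h
        exact hu (by
          have h' : u + 1 = -k := h
          simp only [Set.mem_singleton_iff]; push_cast; linear_combination h')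
    have hinv : Tendsto (fun u : ℂ => u) (𝓝[≠] (-((k + 1 : ℕ) : ℂ))) (𝓝 (-((k + 1 : ℕ) : ℂ))) :=
      tendsto_id.mono_left nhdsWithin_le_nhds
    have h := (ih.comp hsh).div hinv hk
    have hval : (-1) ^ k / (k.factorial : ℂ) / -((k + 1 : ℕ) : ℂ) =
        (-1) ^ (k + 1) / ((k + 1).factorial : ℂ) := by
      rw [Nat.factorial_succ, pow_succ]
      push_cast
      field_simp
    rw [hval] at h
    refine h.congr' ?_
    filter_upwards [eventually_nhdsWithin_of_eventually_nhds (isOpen_ne.mem_nhds hk)] with u hu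
    have hu : u ≠ 0 := hu
    simp only [Function.comp_apply, Pi.div_apply, Complex.Gamma_add_one u hu]
    push_cast
    field_simp
    ring

/-- The meromorphic coefficient function of the `₂F₂` series. -/
def mbCoeff (a b c d s : ℂ) : ℂ :=
  Complex.Gamma (a + s) * Complex.Gamma (b + s) / (Complex.Gamma (c + s) * Complex.Gamma (d + s))

/-- The Mellin–Barnes integrand. -/
def mbIntegrand (a b c d z s : ℂ) : ℂ :=
  Complex.Gamma (-s) * mbCoeff a b c d s * z ^ s

theorem mbCoeff_comm (a b c d s : ℂ) : mbCoeff a b c d s = mbCoeff b a c d s := by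
  rw [mbCoeff, mbCoeff, mul_comm (Complex.Gamma (a + s))]

theorem differentiableAt_Gamma_add {a s : ℂ} (h : ∀ m : ℕ, a + s ≠ -m) :
    DifferentiableAt ℂ (fun s => Complex.Gamma (a + s)) s :=
  (Complex.differentiableAt_Gamma (a + s) h).comp s (by fun_prop)

theorem differentiable_inv_Gamma_add (c : ℂ) :
    Differentiable ℂ (fun s => (Complex.Gamma (c + s))⁻¹) :=
  Complex.differentiable_one_div_Gamma.comp (by fun_prop : Differentiable ℂ fun s => c + s)

theorem mbCoeff_eq (a b c d s : ℂ) : mbCoeff a b c d s = Complex.Gamma (a + s) *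
    (Complex.Gamma (b + s) * ((Complex.Gamma (c + s))⁻¹ * (Complex.Gamma (d + s))⁻¹)) := by
  rw [mbCoeff, div_eq_mul_inv, mul_inv, mul_assoc]

theorem differentiableAt_mbIntegrand {a b c d z s : ℂ} (hz : z ≠ 0) (hs : ∀ m : ℕ, s ≠ m)
    (ha : ∀ m : ℕ, a + s ≠ -m) (hb : ∀ m : ℕ, b + s ≠ -m) :
    DifferentiableAt ℂ (mbIntegrand a b c d z) s := by
  have h1 : DifferentiableAt ℂ (fun s => Complex.Gamma (-s)) s :=
    (Complex.differentiableAt_Gamma (-s) fun m h => hs m (neg_injective h)).comp s (by fun_prop)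
  have h2 := differentiableAt_Gamma_add ha
  have h3 := differentiableAt_Gamma_add hb
  have h4 := differentiable_inv_Gamma_add c s
  have h5 := differentiable_inv_Gamma_add d s
  have h6 : DifferentiableAt ℂ (fun s => z ^ s) s := differentiableAt_id.const_cpow (Or.inl hz)
  have := (h1.mul (h2.mul (h3.mul (h4.mul h5)))).mul h6
  refine this.congr_of_eventuallyEq (Eventually.of_forall fun s => ?_)
  simp only [mbIntegrand, mbCoeff_eq, Pi.mul_apply]

/-- These poles come from `Γ(-s)`. The sign is that of the substitution `s ↦ -s`, so the residues
are minus the terms of the power series. -/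
theorem tendsto_residue_mbIntegrand_nat {a b c d z : ℂ} (hz : z ≠ 0) (k : ℕ)
    (ha : ∀ m : ℕ, a ≠ -m) (hb : ∀ m : ℕ, b ≠ -m) :
    Tendsto (fun s => (s - k) * mbIntegrand a b c d z s) (𝓝[≠] (k : ℂ))
      (𝓝 (-(mbCoeff a b c d k * ((-z) ^ k / (k.factorial : ℂ))))) := by
  have hneg : Tendsto (fun s : ℂ => -s) (𝓝[≠] (k : ℂ)) (𝓝[≠] (-k : ℂ)) := by
    refine tendsto_nhdsWithin_iff.2 ⟨?_, ?_⟩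
    · exact (continuous_neg.tendsto _).mono_left nhdsWithin_le_nhds
    · filter_upwards [self_mem_nhdsWithin] with u hu h
      exact hu (neg_injective h)
  have h1 := (tendsto_add_nat_mul_Gamma k).comp hneg
  have ha' : ∀ m : ℕ, a + k ≠ -m := fun m h => ha (m + k) (by push_cast; linear_combination h)
  have hb' : ∀ m : ℕ, b + k ≠ -m := fun m h => hb (m + k) (by push_cast; linear_combination h)
  have hd := (differentiableAt_Gamma_add ha').mul ((differentiableAt_Gamma_add hb').mul
    ((differentiable_inv_Gamma_add c k).mul (differentiable_inv_Gamma_add d k)))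
  have h6 : DifferentiableAt ℂ (fun s => z ^ s) (k : ℂ) := differentiableAt_id.const_cpow (Or.inl hz)
  have h7 := (hd.mul h6).continuousAt.tendsto.mono_left
    (nhdsWithin_le_nhds : 𝓝[≠] (k : ℂ) ≤ 𝓝 (k : ℂ))
  have h8 := (h1.mul h7).neg
  refine (h8.congr fun s => ?_).trans (le_of_eq ?_)
  · simp only [mbIntegrand, mbCoeff_eq, Pi.mul_apply, Function.comp_apply]; ring
  · congr 1
    simp only [mbCoeff_eq, Pi.mul_apply, Complex.cpow_natCast]
    rw [neg_pow]; ring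

/-- The pole is due to `Γ(a + s)` alone: `a - b ∉ ℤ` keeps `Γ(b + s)` regular there, and `a ∉ ℤ_{≤
0}` keeps `Γ(-s)` regular. Exchanging `a` and `b` gives the other family. -/
theorem tendsto_residue_mbIntegrand_left {a b c d z : ℂ} (hz : z ≠ 0) (k : ℕ)
    (ha : ∀ m : ℕ, a ≠ -m) (hab : ∀ m : ℤ, a - b ≠ m) :
    Tendsto (fun s => (s - (-a - k)) * mbIntegrand a b c d z s) (𝓝[≠] (-a - k))
      (𝓝 (Complex.Gamma (a + k) * Complex.Gamma (b - a - k) /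
        (Complex.Gamma (c - a - k) * Complex.Gamma (d - a - k)) *
        ((-1) ^ k / (k.factorial : ℂ)) * z ^ (-a - (k : ℂ)))) := by
  set p : ℂ := -a - k with hp
  have hsh : Tendsto (fun s : ℂ => a + s) (𝓝[≠] p) (𝓝[≠] (-k : ℂ)) := by
    refine tendsto_nhdsWithin_iff.2 ⟨?_, ?_⟩
    · have : ContinuousAt (fun s : ℂ => a + s) p := by fun_prop
      have h := this.tendsto
      rw [show a + p = -k by rw [hp]; ring] at h
      exact h.mono_left nhdsWithin_le_nhds
    · filter_upwards [self_mem_nhdsWithin] with u hu h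
      exact hu (by
        have h' : a + u = -k := h
        simp only [Set.mem_singleton_iff, hp]; linear_combination h')
  have h1 := (tendsto_add_nat_mul_Gamma k).comp hsh
  have hs : ∀ m : ℕ, -p ≠ -m := fun m h => ha (m + k) (by
    rw [hp] at h; push_cast; linear_combination h)
  have hb' : ∀ m : ℕ, b + p ≠ -m := fun m h => hab (m - k) (by
    rw [hp] at h; push_cast; linear_combination -h)
  have h0 : DifferentiableAt ℂ (fun s => Complex.Gamma (-s)) p :=
    (Complex.differentiableAt_Gamma (-p) hs).comp p (by fun_prop)
  have hd := h0.mul ((differentiableAt_Gamma_add hb').mul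
    ((differentiable_inv_Gamma_add c p).mul (differentiable_inv_Gamma_add d p)))
  have h6 : DifferentiableAt ℂ (fun s => z ^ s) p := differentiableAt_id.const_cpow (Or.inl hz)
  have h7 := (hd.mul h6).continuousAt.tendsto.mono_left (nhdsWithin_le_nhds : 𝓝[≠] p ≤ 𝓝 p)
  refine ((h1.mul h7).congr fun s => ?_).trans (le_of_eq ?_)
  · simp only [mbIntegrand, mbCoeff_eq, Pi.mul_apply, Function.comp_apply, hp]; ring
  · congr 1
    simp only [Pi.mul_apply]
    rw [show -p = a + k by rw [hp]; ring, show b + p = b - a - k by rw [hp]; ring,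
      show c + p = c - a - k by rw [hp]; ring, show d + p = d - a - k by rw [hp]; ring]
    simp only [div_eq_mul_inv, mul_inv]
    ring

theorem norm_cpow_le {z : ℂ} (hz : z ≠ 0) {φ : ℝ} (hφ : |z.arg| ≤ φ) (s : ℂ) :
    ‖z ^ s‖ ≤ ‖z‖ ^ s.re * Real.exp (φ * |s.im|) := by
  rw [Complex.norm_cpow_of_ne_zero hz, div_eq_mul_inv, ← Real.exp_neg]
  gcongr
  calc -(z.arg * s.im) ≤ |z.arg * s.im| := neg_le_abs _
    _ ≤ _ := by rw [abs_mul]; gcongr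

/-- Exponential decay of the Mellin–Barnes integrand in vertical strips. -/
theorem exists_norm_mbIntegrand_le {a b c d z : ℂ} (hz : z ≠ 0) (hz' : |z.arg| < Real.pi / 2)
    (σ₁ σ₂ : ℝ) : ∃ C T η : ℝ, 0 < C ∧ 0 < T ∧ 0 < η ∧ ∀ s : ℂ, s.re ∈ Set.Icc σ₁ σ₂ → T ≤ |s.im| →
      ‖mbIntegrand a b c d z s‖ ≤ C * Real.exp (-(η * |s.im|)) := by
  obtain ⟨C₀, T₀, M₀, hC₀, hT₀, h₀⟩ := exists_norm_Gamma_strip 0 (-σ₂) (-σ₁)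
  obtain ⟨C₁, T₁, M₁, hC₁, hT₁, h₁⟩ := exists_norm_Gamma_strip a σ₁ σ₂
  obtain ⟨C₂, T₂, M₂, hC₂, hT₂, h₂⟩ := exists_norm_Gamma_strip b σ₁ σ₂
  obtain ⟨C₃, T₃, M₃, hC₃, hT₃, h₃⟩ := exists_norm_Gamma_strip c σ₁ σ₂
  obtain ⟨C₄, T₄, M₄, hC₄, hT₄, h₄⟩ := exists_norm_Gamma_strip d σ₁ σ₂
  set φ := |z.arg| with hφ
  -- The three Gammas upstairs and two downstairs leave a net factor `exp(-π / 2 * |Im s|)`, against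
  -- growth `exp(|arg z| * |Im s|)` of `z ^ s`. Half of the gap is kept as the final rate; the other
  -- half pays for the powers of `1 + |Im s|`.
  obtain ⟨C₅, hC₅, h₅⟩ := exists_one_add_pow_mul_exp_le (M₀ + M₁ + M₂ + M₃ + M₄)
    (η := Real.pi / 2 - φ) (η' := (Real.pi / 2 - φ) / 2) (by linarith)
  have hzn : 0 < ‖z‖ := norm_pos_iff.2 hz
  set Z := ‖z‖ ^ σ₁ + ‖z‖ ^ σ₂ with hZ
  have hZ0 : 0 < Z := by positivity
  refine ⟨C₀ * C₁ * C₂ * C₃ * C₄ * Z * C₅, T₀ + T₁ + T₂ + T₃ + T₄, (Real.pi / 2 - φ) / 2,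
    by positivity, by positivity, by linarith, fun s hs hT => ?_⟩
  set t := |s.im| with ht
  set e := Real.exp (-(Real.pi / 2 * t)) with he
  have he0 : 0 < e := Real.exp_pos _
  have u0 := (h₀ (-s) (by simpa using hs.2) (by simpa using hs.1) (by simp; linarith)).1
  simp only [zero_add, Complex.neg_im, abs_neg] at u0
  have u1 := (h₁ s hs.1 hs.2 (by linarith)).1
  have u2 := (h₂ s hs.1 hs.2 (by linarith)).1
  have inv : ∀ (x : ℂ) (C : ℝ) (M : ℕ), e ≤ C * ((1 + t) ^ M * ‖x‖) →
      ‖x⁻¹‖ ≤ C * ((1 + t) ^ M * e⁻¹) := by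
    intro x C M h
    have hx : 0 < ‖x‖ := by
      rcases (norm_nonneg x).eq_or_lt with h0 | h0
      · rw [← h0] at h; simp at h; linarith
      · exact h0
    rw [norm_inv, inv_le_iff_one_le_mul₀ hx]
    calc (1 : ℝ) = e * e⁻¹ := (mul_inv_cancel₀ he0.ne').symm
      _ ≤ (C * ((1 + t) ^ M * ‖x‖)) * e⁻¹ := by gcongr
      _ = _ := by ring
  have u3 := inv _ _ _ (h₃ s hs.1 hs.2 (by linarith)).2
  have u4 := inv _ _ _ (h₄ s hs.1 hs.2 (by linarith)).2
  have u5 := norm_cpow_le hz le_rfl s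
  have hZs : ‖z‖ ^ s.re ≤ Z := by
    rcases le_total 1 ‖z‖ with h | h
    · have := Real.rpow_le_rpow_of_exponent_le h hs.2
      have : 0 < ‖z‖ ^ σ₁ := by positivity
      linarith
    · have := Real.rpow_le_rpow_of_exponent_ge hzn h hs.1
      have : 0 < ‖z‖ ^ σ₂ := by positivity
      linarith
  rw [mbIntegrand, mbCoeff_eq, norm_mul, norm_mul, norm_mul, norm_mul, norm_mul]
  calc _ ≤ (C₀ * ((1 + t) ^ M₀ * e)) * ((C₁ * ((1 + t) ^ M₁ * e)) * ((C₂ * ((1 + t) ^ M₂ * e)) *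
        ((C₃ * ((1 + t) ^ M₃ * e⁻¹)) * (C₄ * ((1 + t) ^ M₄ * e⁻¹))))) *
        (Z * Real.exp (φ * t)) := by
        gcongr
        exact u5.trans (by gcongr)
    _ = C₀ * C₁ * C₂ * C₃ * C₄ * Z * ((1 + t) ^ (M₀ + M₁ + M₂ + M₃ + M₄) *
          (e * Real.exp (φ * t)) * (e * e⁻¹) ^ 2) := by ring
    _ = C₀ * C₁ * C₂ * C₃ * C₄ * Z * ((1 + t) ^ (M₀ + M₁ + M₂ + M₃ + M₄) *
          Real.exp (-((Real.pi / 2 - φ) * t))) := by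
        rw [mul_inv_cancel₀ he0.ne', he, ← Real.exp_add]
        ring_nf
    _ ≤ C₀ * C₁ * C₂ * C₃ * C₄ * Z * (C₅ * Real.exp (-((Real.pi / 2 - φ) / 2 * t))) :=
        mul_le_mul_of_nonneg_left (h₅ t (abs_nonneg _)) (by positivity)
    _ = _ := by ring

theorem integrable_mbIntegrand {a b c d z : ℂ} (hz : z ≠ 0) (hz' : |z.arg| < Real.pi / 2)
    {σ : ℝ} (hs : ∀ s : ℂ, s.re = σ → (∀ m : ℕ, s ≠ m) ∧ (∀ m : ℕ, a + s ≠ -m) ∧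
      (∀ m : ℕ, b + s ≠ -m)) :
    Integrable fun y : ℝ => mbIntegrand a b c d z (σ + y * Complex.I) := by
  obtain ⟨C, T, η, -, -, hη, h⟩ := exists_norm_mbIntegrand_le (a := a) (b := b) (c := c) (d := d)
    hz hz' σ σ
  refine integrable_of_norm_le_exp_neg (continuous_iff_continuousAt.2 fun y => ?_) hη (C := C)
    (T := T) fun y hy => ?_
  · obtain ⟨h1, h2, h3⟩ := hs (σ + y * Complex.I) (by simp)
    exact ContinuousAt.comp (g := mbIntegrand a b c d z)
      (differentiableAt_mbIntegrand hz h1 h2 h3).continuousAt (by fun_prop)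
  · simpa using h (σ + y * Complex.I) (by simp) (by simpa using hy)

theorem exists_norm_Gamma_line {x : ℝ} (hx : ∀ m : ℕ, x ≠ -m) : ∃ C : ℝ, ∃ M : ℕ, 0 < C ∧
    ∀ y : ℝ, ‖Complex.Gamma (x + y * Complex.I)‖ ≤
      C * ((1 + |y|) ^ M * Real.exp (-(Real.pi / 2 * |y|))) := by
  obtain ⟨C, T, M, -, -, h⟩ := exists_norm_Gamma_strip 0 x x
  have hc : Continuous fun y : ℝ => Complex.Gamma (x + y * Complex.I) := by
    refine continuous_iff_continuousAt.2 fun y => ?_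
    have h1 : ∀ m : ℕ, (x + y * Complex.I : ℂ) ≠ -m := fun m hm =>
      hx m (by simpa using congrArg Complex.re hm)
    exact ContinuousAt.comp (g := Complex.Gamma)
      (Complex.differentiableAt_Gamma _ h1).continuousAt (by fun_prop)
  obtain ⟨C', h1, h2⟩ := exists_bound_of_bound_large hc
    (g := fun y => (1 + |y|) ^ M * Real.exp (-(Real.pi / 2 * |y|))) (by fun_prop)
    (fun y => by positivity) (fun y hy => by
      simpa using (h (x + y * Complex.I) (by simp) (by simp) (by simpa using hy)).1)
  exact ⟨C', M, h1, h2⟩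

theorem half_factorial_le_prod (N : ℕ) :
    (N.factorial : ℝ) / 2 ≤ ∏ j ∈ Finset.range (N + 1), ((j : ℝ) + 1 / 2) := by
  induction N with
  | zero => simp
  | succ N ih =>
    rw [Finset.prod_range_succ, Nat.factorial_succ]
    have h : (0 : ℝ) ≤ ∏ j ∈ Finset.range (N + 1), ((j : ℝ) + 1 / 2) :=
      Finset.prod_nonneg fun _ _ => by positivity
    push_cast
    nlinarith [(N.cast_nonneg : (0 : ℝ) ≤ N)]

/-- Moving to the line `Re = 1 / 2` by `N + 1` steps divides by factors whose real parts have
absolute values `1 / 2, 3 / 2, ..., N + 1 / 2`, and their product is at least `N! / 2`. -/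
theorem norm_Gamma_neg_half_le (N : ℕ) (y : ℝ) :
    ‖Complex.Gamma (-(((N + 1 / 2 : ℝ) : ℂ) + y * Complex.I))‖ ≤
      2 / N.factorial * ‖Complex.Gamma (((1 / 2 : ℝ) : ℂ) + (-y : ℝ) * Complex.I)‖ := by
  set v : ℂ := -(((N + 1 / 2 : ℝ) : ℂ) + y * Complex.I) with hv
  have hre : ∀ j : ℕ, (v + j).re = j - (N + 1 / 2) := fun j => by simp [hv]; ring
  have hne : ∀ j : ℕ, v + j ≠ 0 := fun j h => by
    have h1 := hre j
    rw [h, Complex.zero_re] at h1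
    have h2 : ((2 * j : ℕ) : ℝ) = ((2 * N + 1 : ℕ) : ℝ) := by push_cast; linarith
    have h3 : 2 * j = 2 * N + 1 := by exact_mod_cast h2
    omega
  have hprod := Gamma_add_nat_eq_prod hne (N + 1)
  have hv1 : v + (N + 1 : ℕ) = ((1 / 2 : ℝ) : ℂ) + (-y : ℝ) * Complex.I := by
    rw [hv]; push_cast; ring
  rw [hv1] at hprod
  have hP : (N.factorial : ℝ) / 2 ≤ ‖∏ j ∈ Finset.range (N + 1), (v + j)‖ := by
    rw [norm_prod, ← Finset.prod_range_reflect]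
    refine (half_factorial_le_prod N).trans ?_
    refine Finset.prod_le_prod (fun j _ => by positivity) fun j hj => ?_
    have hjN : j ≤ N := by have := Finset.mem_range.1 hj; omega
    refine le_trans ?_ (Complex.abs_re_le_norm _)
    rw [hre, show N + 1 - 1 - j = N - j by omega, Nat.cast_sub hjN, ← abs_neg]
    refine le_trans (le_of_eq ?_) (le_abs_self _)
    ring
  rw [hprod, norm_mul]
  have hf : (0 : ℝ) < N.factorial := by exact_mod_cast N.factorial_pos
  calc ‖Complex.Gamma v‖ = 2 / N.factorial * (‖Complex.Gamma v‖ * (N.factorial / 2)) := by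
        field_simp
    _ ≤ _ := by gcongr

theorem exists_norm_mbCoeff_le (a b c d : ℂ) : ∃ C M : ℝ, ∃ L : ℕ, 0 < C ∧ ∀ s : ℂ, M ≤ s.re →
    ‖mbCoeff a b c d s‖ ≤ C * ‖s‖ ^ L := by
  obtain ⟨C₁, M₁, hC₁, h₁⟩ := exists_norm_Gamma_div_Gamma_le a c
  obtain ⟨C₂, M₂, hC₂, h₂⟩ := exists_norm_Gamma_div_Gamma_le b d
  obtain ⟨L, hL⟩ := exists_nat_ge ((a - c).re + (b - d).re)
  refine ⟨C₁ * C₂, max (max M₁ M₂) 1, L, by positivity, fun s hs => ?_⟩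
  have b1 := h₁ s (le_trans (by simp) hs)
  have b2 := h₂ s (le_trans (by simp) hs)
  have h1s : 1 ≤ ‖s‖ := (le_trans (by simp) hs).trans (Complex.re_le_norm s)
  have e : mbCoeff a b c d s = (Complex.Gamma (s + a) / Complex.Gamma (s + c)) *
      (Complex.Gamma (s + b) / Complex.Gamma (s + d)) := by
    rw [mbCoeff, div_mul_div_comm, add_comm s, add_comm s, add_comm s, add_comm s]
  rw [e, norm_mul]
  calc _ ≤ (C₁ * ‖s‖ ^ (a - c).re) * (C₂ * ‖s‖ ^ (b - d).re) := by gcongr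
    _ = C₁ * C₂ * ‖s‖ ^ ((a - c).re + (b - d).re) := by
      rw [Real.rpow_add (by linarith)]; ring
    _ ≤ C₁ * C₂ * ‖s‖ ^ (L : ℝ) := by gcongr
    _ = _ := by rw [Real.rpow_natCast]

/-- On `Re s = N + 1 / 2` the factor `Γ(-s)` supplies `1 / N!`, while the coefficient grows
polynomially and the power of `z` geometrically; the integral is `O((e * ‖z‖) ^ N / N!)`. -/
theorem tendsto_integral_mbIntegrand_half {a b c d z : ℂ} (hz : z ≠ 0)
    (hz' : |z.arg| < Real.pi / 2) :
    Tendsto (fun N : ℕ => ∫ y : ℝ, mbIntegrand a b c d z (((N + 1 / 2 : ℝ) : ℂ) + y * Complex.I))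
      atTop (𝓝 0) := by
  obtain ⟨C₁, M₁, hC₁, h₁⟩ := exists_norm_Gamma_line (x := 1 / 2) (fun m => by
    have : (0 : ℝ) ≤ m := m.cast_nonneg
    linarith)
  obtain ⟨C₂, M₂, L, hC₂, h₂⟩ := exists_norm_mbCoeff_le a b c d
  set φ := |z.arg| with hφ
  obtain ⟨C₃, hC₃, h₃⟩ := exists_one_add_pow_mul_exp_le (M₁ + L)
    (η := Real.pi / 2 - φ) (η' := (Real.pi / 2 - φ) / 2) (by linarith)
  have hη : 0 < (Real.pi / 2 - φ) / 2 := by linarith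
  have hzn : 0 < ‖z‖ := norm_pos_iff.2 hz
  set Q := ∫ y : ℝ, Real.exp (-((Real.pi / 2 - φ) / 2 * |y|)) with hQ
  set D := 2 * C₁ * C₂ * C₃ * ‖z‖ ^ (1 / 2 : ℝ) * L.factorial * Real.exp 1 with hD
  have hbound : ∀ N : ℕ, M₂ ≤ N → ∀ y : ℝ,
      ‖mbIntegrand a b c d z (((N + 1 / 2 : ℝ) : ℂ) + y * Complex.I)‖ ≤
      D * ((Real.exp 1 * ‖z‖) ^ N / N.factorial) *
        Real.exp (-((Real.pi / 2 - φ) / 2 * |y|)) := by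
    intro N hN y
    set s : ℂ := ((N + 1 / 2 : ℝ) : ℂ) + y * Complex.I with hs
    have hsre : s.re = N + 1 / 2 := by simp [hs]
    have hsim : s.im = y := by simp [hs]
    have u1 := (norm_Gamma_neg_half_le N y).trans (mul_le_mul_of_nonneg_left (h₁ (-y)) (by positivity))
    have u2 := h₂ s (by rw [hsre]; linarith)
    have u3 := norm_cpow_le hz le_rfl s
    rw [hsre, hsim, Real.rpow_add hzn, Real.rpow_natCast] at u3
    have hN0 : (0 : ℝ) ≤ N := N.cast_nonneg
    have hsn : ‖s‖ ≤ (N + 1) * (1 + |y|) := by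
      refine (Complex.norm_le_abs_re_add_abs_im s).trans ?_
      rw [hsre, hsim, abs_of_nonneg (by positivity)]
      nlinarith [abs_nonneg y]
    -- The polynomial in `N` is traded for a further geometric factor `e ^ (N + 1)`, harmless
    -- against `N!`.
    have hNL : ((N : ℝ) + 1) ^ L ≤ L.factorial * (Real.exp 1 * Real.exp 1 ^ N) := by
      have := Real.pow_div_factorial_le_exp ((N : ℝ) + 1) (by positivity) L
      rw [div_le_iff₀ (by positivity)] at this
      refine this.trans (le_of_eq ?_)
      rw [← Real.exp_nat_mul, ← Real.exp_add, mul_comm, add_comm (N : ℝ) 1, mul_one]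
    rw [abs_neg] at u1
    rw [mbIntegrand, norm_mul, norm_mul]
    calc _ ≤ (2 / N.factorial * (C₁ * ((1 + |y|) ^ M₁ * Real.exp (-(Real.pi / 2 * |y|))))) *
          (C₂ * ((N + 1) * (1 + |y|)) ^ L) *
          (‖z‖ ^ N * ‖z‖ ^ (1 / 2 : ℝ) * Real.exp (φ * |y|)) := by
          gcongr
          exact u2.trans (by gcongr)
      _ = 2 / N.factorial * C₁ * C₂ * (N + 1) ^ L * (‖z‖ ^ N * ‖z‖ ^ (1 / 2 : ℝ)) *
          ((1 + |y|) ^ (M₁ + L) * (Real.exp (-(Real.pi / 2 * |y|)) * Real.exp (φ * |y|))) := by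
          rw [mul_pow]; ring
      _ = 2 / N.factorial * C₁ * C₂ * (N + 1) ^ L * (‖z‖ ^ N * ‖z‖ ^ (1 / 2 : ℝ)) *
          ((1 + |y|) ^ (M₁ + L) * Real.exp (-((Real.pi / 2 - φ) * |y|))) := by
          rw [← Real.exp_add]; ring_nf
      _ ≤ 2 / N.factorial * C₁ * C₂ * (L.factorial * (Real.exp 1 * Real.exp 1 ^ N)) *
          (‖z‖ ^ N * ‖z‖ ^ (1 / 2 : ℝ)) *
          (C₃ * Real.exp (-((Real.pi / 2 - φ) / 2 * |y|))) := by
          refine mul_le_mul (by gcongr) (h₃ |y| (abs_nonneg y)) (by positivity) (by positivity)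
      _ = _ := by rw [hD, mul_pow]; ring
  have hint : ∀ᶠ N : ℕ in atTop,
      ‖∫ y : ℝ, mbIntegrand a b c d z (((N + 1 / 2 : ℝ) : ℂ) + y * Complex.I)‖ ≤
      D * ((Real.exp 1 * ‖z‖) ^ N / N.factorial) * Q := by
    filter_upwards [tendsto_natCast_atTop_atTop.eventually_ge_atTop M₂] with N hN
    rw [hQ, ← integral_const_mul]
    exact norm_integral_le_of_norm_le ((integrable_exp_neg_mul_abs hη).const_mul _)
      (Eventually.of_forall (hbound N hN))
  refine squeeze_zero_norm' hint ?_
  have := ((FloorSemiring.tendsto_pow_div_factorial_atTop (Real.exp 1 * ‖z‖)).const_mul D).mul_const Q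
  simpa using this

/-- The algebraic part of the asymptotic expansion coming from the poles of `Γ(a + s)` to the right
of the line `re s = -w`. -/
def algSum (a b c d : ℂ) (w : ℝ) (z : ℂ) : ℂ :=
  ∑ k ∈ Finset.range (⌊w - a.re⌋₊ + 1),
    Complex.Gamma (a + k) * Complex.Gamma (b - a - k) /
      (Complex.Gamma (c - a - k) * Complex.Gamma (d - a - k)) *
      ((-1) ^ k / (k.factorial : ℂ)) * z ^ (-a - (k : ℂ))

theorem neg_w_lt_re_pole {a : ℂ} {w : ℝ} (hwa : a.re < w) (hfa : ∀ k : ℕ, w - a.re ≠ k) {k : ℕ}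
    (hk : k ∈ Finset.range (⌊w - a.re⌋₊ + 1)) : -w < (-a - (k : ℂ)).re := by
  have h1 : k ≤ ⌊w - a.re⌋₊ := Nat.lt_succ_iff.1 (Finset.mem_range.1 hk)
  have h2 : (k : ℝ) ≤ w - a.re := (Nat.le_floor_iff (by linarith)).1 h1
  have h3 := lt_of_le_of_ne h2 (hfa k).symm
  simp; linarith

/-- **Mellin–Barnes representation**, in terms of partial sums of the power series. -/
theorem tendsto_sum_sub_algSum {a b c d z : ℂ} {w : ℝ} (hz : z ≠ 0) (hz' : |z.arg| < Real.pi / 2)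
    (ha : ∀ m : ℕ, a ≠ -m) (hb : ∀ m : ℕ, b ≠ -m) (hab : ∀ m : ℤ, a - b ≠ m) (hw : 0 < w)
    (hwa : a.re < w) (hwb : b.re < w) (hfa : ∀ k : ℕ, w - a.re ≠ k) (hfb : ∀ k : ℕ, w - b.re ≠ k) :
    Tendsto (fun N : ℕ => ∑ k ∈ Finset.range (N + 1),
        mbCoeff a b c d k * ((-z) ^ k / (k.factorial : ℂ))) atTop
      (𝓝 (algSum a b c d w z + algSum b a c d w z +
        (2 * Real.pi : ℂ)⁻¹ * ∫ y : ℝ, mbIntegrand a b c d z (((-w : ℝ) : ℂ) + y * Complex.I))) := by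
  classical
  have hba : ∀ m : ℤ, b - a ≠ m := fun m h => hab (-m) (by push_cast; linear_combination -h)
  set f := mbIntegrand a b c d z with hf
  have hfcomm : f = mbIntegrand b a c d z := by
    funext s; rw [hf, mbIntegrand, mbIntegrand, mbCoeff_comm]
  -- Defining the residue as a limit gives one function for the union of the three families of
  -- poles; the explicit values are recovered from `Tendsto.limUnder_eq`.
  set r : ℂ → ℂ := fun p => limUnder (𝓝[≠] p) fun s => (s - p) * f s with hr
  have res0 : ∀ k : ℕ, Tendsto (fun s => (s - k) * f s) (𝓝[≠] (k : ℂ))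
      (𝓝 (-(mbCoeff a b c d k * ((-z) ^ k / (k.factorial : ℂ))))) := fun k =>
    tendsto_residue_mbIntegrand_nat hz k ha hb
  have resa := fun k : ℕ => tendsto_residue_mbIntegrand_left (c := c) (d := d) hz k ha hab
  have resb := fun k : ℕ => tendsto_residue_mbIntegrand_left (c := c) (d := d) hz k hb hba
  rw [← hf] at resa
  rw [← hfcomm] at resb
  set P0 : ℕ → Finset ℂ := fun N => (Finset.range (N + 1)).image fun k : ℕ => (k : ℂ)
  set Pa : Finset ℂ := (Finset.range (⌊w - a.re⌋₊ + 1)).image fun k : ℕ => -a - (k : ℂ)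
  set Pb : Finset ℂ := (Finset.range (⌊w - b.re⌋₊ + 1)).image fun k : ℕ => -b - (k : ℂ)
  have hsum : ∀ N : ℕ, ∑ p ∈ P0 N ∪ Pa ∪ Pb, r p =
      -(∑ k ∈ Finset.range (N + 1), mbCoeff a b c d k * ((-z) ^ k / (k.factorial : ℂ))) +
        algSum a b c d w z + algSum b a c d w z := by
    intro N
    rw [Finset.sum_union, Finset.sum_union, Finset.sum_image, Finset.sum_image, Finset.sum_image,
      algSum, algSum, ← Finset.sum_neg_distrib]
    · congr 1
      · congr 1
        · exact Finset.sum_congr rfl fun k _ => (res0 k).limUnder_eq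
        · exact Finset.sum_congr rfl fun k _ => (resa k).limUnder_eq
      · exact Finset.sum_congr rfl fun k _ => (resb k).limUnder_eq
    · intro i _ j _ h
      exact_mod_cast sub_right_injective h
    · intro i _ j _ h
      exact_mod_cast sub_right_injective h
    · intro i _ j _ h
      exact Nat.cast_injective h
    · rw [Finset.disjoint_left]
      intro p hp hp'
      obtain ⟨i, -, rfl⟩ := Finset.mem_image.1 hp
      obtain ⟨j, -, h⟩ := Finset.mem_image.1 hp'
      exact ha (i + j) (by push_cast; linear_combination -h)
    · rw [Finset.disjoint_left]
      intro p hp hp'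
      obtain ⟨j, -, rfl⟩ := Finset.mem_image.1 hp'
      rcases Finset.mem_union.1 hp with hp | hp
      · obtain ⟨i, -, h⟩ := Finset.mem_image.1 hp
        exact hb (i + j) (by push_cast; linear_combination h)
      · obtain ⟨i, -, h⟩ := Finset.mem_image.1 hp
        exact hab (j - i) (by push_cast; linear_combination -h)
  have hlim := tendsto_integral_mbIntegrand_half (a := a) (b := b) (c := c) (d := d) hz hz'
  have key : ∀ᶠ N : ℕ in atTop, (∫ y : ℝ, f (((N + 1 / 2 : ℝ) : ℂ) + y * Complex.I)) -
      (∫ y : ℝ, f (((-w : ℝ) : ℂ) + y * Complex.I)) = 2 * Real.pi * ∑ p ∈ P0 N ∪ Pa ∪ Pb, r p := by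
    -- For such `N` the line `Re s = N + 1 / 2` lies to the right of both families of left poles, so
    -- it can meet no pole except those at integers, which it misses.
    filter_upwards [tendsto_natCast_atTop_atTop.eventually_ge_atTop (|a.re| + |b.re|)] with N hN
    have hN0 : (0 : ℝ) ≤ N := N.cast_nonneg
    have haN : -a.re ≤ N := by linarith [neg_le_abs a.re, abs_nonneg b.re]
    have hbN : -b.re ≤ N := by linarith [neg_le_abs b.re, abs_nonneg a.re]
    have hhalf : ∀ k m : ℕ, (N : ℝ) + 1 / 2 + 0 * k ≠ m := fun k m h => by
      have h2 : ((2 * N + 1 : ℕ) : ℝ) = ((2 * m : ℕ) : ℝ) := by push_cast; linarith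
      have h3 : 2 * N + 1 = 2 * m := by exact_mod_cast h2
      omega
    refine integral_vertical_sub_eq_sum_residues (by linarith) r _ ?_ f ?_ ?_ ?_ ?_ ?_
    · intro p hp
      rcases Finset.mem_union.1 hp with hp | hp
      · rcases Finset.mem_union.1 hp with hp | hp
        · obtain ⟨k, hk, rfl⟩ := Finset.mem_image.1 hp
          have : (k : ℝ) ≤ N := by exact_mod_cast Nat.lt_succ_iff.1 (Finset.mem_range.1 hk)
          have : (0 : ℝ) ≤ k := k.cast_nonneg
          constructor <;> simp <;> linarith
        · obtain ⟨k, hk, rfl⟩ := Finset.mem_image.1 hp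
          refine ⟨neg_w_lt_re_pole hwa hfa hk, ?_⟩
          have : (0 : ℝ) ≤ k := k.cast_nonneg
          simp; linarith
      · obtain ⟨k, hk, rfl⟩ := Finset.mem_image.1 hp
        refine ⟨neg_w_lt_re_pole hwb hfb hk, ?_⟩
        have : (0 : ℝ) ≤ k := k.cast_nonneg
        simp; linarith
    · intro s hs hsP
      simp only [Finset.mem_union, not_or] at hsP
      refine differentiableAt_mbIntegrand hz (fun m hm => hsP.1.1 ?_) (fun m hm => hsP.1.2 ?_)
        (fun m hm => hsP.2 ?_)
      · refine Finset.mem_image.2 ⟨m, Finset.mem_range.2 (Nat.lt_succ_of_le ?_), hm.symm⟩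
        have h1 := hs.2
        rw [hm, Complex.natCast_re] at h1
        have h2 : (m : ℝ) < (N + 1 : ℕ) := by push_cast; linarith
        exact Nat.lt_succ_iff.1 (by exact_mod_cast h2)
      · have hse : s = -a - m := by linear_combination hm
        refine Finset.mem_image.2 ⟨m, Finset.mem_range.2 (Nat.lt_succ_of_le ?_), hse.symm⟩
        have h1 := hs.1
        rw [hse] at h1
        simp at h1
        exact Nat.le_floor (by linarith)
      · have hse : s = -b - m := by linear_combination hm
        refine Finset.mem_image.2 ⟨m, Finset.mem_range.2 (Nat.lt_succ_of_le ?_), hse.symm⟩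
        have h1 := hs.1
        rw [hse] at h1
        simp at h1
        exact Nat.le_floor (by linarith)
    · intro p hp
      rcases Finset.mem_union.1 hp with hp | hp
      · rcases Finset.mem_union.1 hp with hp | hp
        · obtain ⟨k, hk, rfl⟩ := Finset.mem_image.1 hp
          simp only [hr]; rw [(res0 k).limUnder_eq]; exact res0 k
        · obtain ⟨k, hk, rfl⟩ := Finset.mem_image.1 hp
          simp only [hr]; rw [(resa k).limUnder_eq]; exact resa k
      · obtain ⟨k, hk, rfl⟩ := Finset.mem_image.1 hp
        simp only [hr]; rw [(resb k).limUnder_eq]; exact resb k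
    · refine integrable_mbIntegrand hz hz' fun s hs => ⟨fun m hm => ?_, fun m hm => ?_, fun m hm => ?_⟩
      · rw [hm, Complex.natCast_re] at hs
        have : (0 : ℝ) ≤ m := m.cast_nonneg
        linarith
      · have := congrArg Complex.re hm
        simp [hs] at this
        exact hfa m (by linarith)
      · have := congrArg Complex.re hm
        simp [hs] at this
        exact hfb m (by linarith)
    · refine integrable_mbIntegrand hz hz' fun s hs => ⟨fun m hm => ?_, fun m hm => ?_, fun m hm => ?_⟩
      · rw [hm, Complex.natCast_re] at hs
        exact hhalf 0 m (by linarith)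
      · have := congrArg Complex.re hm
        simp [hs] at this
        have : (0 : ℝ) ≤ m := m.cast_nonneg
        linarith
      · have := congrArg Complex.re hm
        simp [hs] at this
        have : (0 : ℝ) ≤ m := m.cast_nonneg
        linarith
    · intro η hη
      obtain ⟨C, T, η', hC, hT, hη', h⟩ := exists_norm_mbIntegrand_le (a := a) (b := b) (c := c)
        (d := d) hz hz' (-w) (N + 1 / 2)
      have ht : Tendsto (fun t : ℝ => C * Real.exp (-(η' * t))) atTop (𝓝 0) := by
        have h1 : Tendsto (fun t : ℝ => -(η' * t)) atTop atBot :=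
          tendsto_neg_atTop_atBot.comp (tendsto_id.const_mul_atTop hη')
        simpa using (Real.tendsto_exp_atBot.comp h1).const_mul C
      obtain ⟨T', hT'⟩ := eventually_atTop.1 (ht.eventually_le_const hη)
      exact ⟨max T T', fun s hs hsT => (h s hs ((le_max_left _ _).trans hsT)).trans
        (hT' _ ((le_max_right _ _).trans hsT))⟩
  have hπ : (Real.pi : ℂ) ≠ 0 := by exact_mod_cast Real.pi_ne_zero
  have hfin := ((hlim.sub_const (∫ y : ℝ, f (((-w : ℝ) : ℂ) + y * Complex.I))).const_mul
    (-(2 * Real.pi : ℂ)⁻¹)).add_const (algSum a b c d w z + algSum b a c d w z)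
  rw [zero_sub, neg_mul_neg, add_comm (_ * _)] at hfin
  refine hfin.congr' ?_
  filter_upwards [key] with N hN
  rw [hN, hsum]
  field_simp
  ring

/-! ### Reflection of the coefficient and bounds uniform in the shift -/

/-- The factor of the Mellin–Barnes coefficient whose poles all lie to the left. -/
def dualCoeff (a b c d : ℂ) (n : ℕ) (u : ℂ) : ℂ :=
  Complex.Gamma (1 - c + u) * Complex.Gamma (1 - d + n + u) /
    (Complex.Gamma (1 - a + u) * Complex.Gamma (1 - b + n + u))

/-- The periodic factor of the Mellin–Barnes coefficient. -/
def trigRatio (a b c d u : ℂ) : ℂ :=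
  Complex.sin (Real.pi * (c - u)) * Complex.sin (Real.pi * (d - u)) /
    (Complex.sin (Real.pi * (a - u)) * Complex.sin (Real.pi * (b - u)))

/-- The limit of `trigRatio` as `im u → ∞`. -/
def trigLimit (a b c d : ℂ) : ℂ := Complex.exp (Real.pi * Complex.I * (c + d - a - b))

/-- Reflection is applied to all four Gammas. The shift by `n` in the second numerator and the
second denominator parameter changes two sines by `(-1) ^ n` each, and these signs cancel: the
trigonometric factor is free of `n`. This is what makes the estimates uniform. -/
theorem mbCoeff_neg_eq {a b c d u : ℂ} (n : ℕ) (ha : 0 < (1 - a + u).re) (hb : 0 < (1 - b + u).re)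
    (hc : 0 < (1 - c + u).re) (hd : 0 < (1 - d + u).re) :
    mbCoeff a (b - n) c (d - n) (-u) = dualCoeff a b c d n u * trigRatio a b c d u := by
  have hn : (0 : ℝ) ≤ n := n.cast_nonneg
  have hπ : (Real.pi : ℂ) ≠ 0 := by exact_mod_cast Real.pi_ne_zero
  have key : ∀ x : ℂ, 0 < (1 - x + u).re → (Complex.Gamma (x + -u))⁻¹ =
      Complex.sin (Real.pi * (x - u)) * Complex.Gamma (1 - x + u) / Real.pi := by
    intro x hx
    have h := inv_Gamma_eq (z := x + -u) (by
      rw [show 1 - (x + -u) = 1 - x + u by ring]; exact Complex.Gamma_ne_zero_of_re_pos hx)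
    rwa [show 1 - (x + -u) = 1 - x + u by ring, ← sub_eq_add_neg] at h
  have hsin : ∀ x : ℂ, Complex.sin (Real.pi * (x - n - u)) =
      (-1) ^ n * Complex.sin (Real.pi * (x - u)) := by
    intro x
    rw [← Complex.sin_antiperiodic.sub_nat_mul_eq n]
    congr 1; ring
  have ka := key a ha
  have kb := key (b - n) (by simp at hb ⊢; linarith)
  have kc := key c hc
  have kd := key (d - n) (by simp at hd ⊢; linarith)
  have e : mbCoeff a (b - n) c (d - n) (-u) = ((Complex.Gamma (a + -u))⁻¹)⁻¹ *
      ((Complex.Gamma (b - n + -u))⁻¹)⁻¹ * ((Complex.Gamma (c + -u))⁻¹ *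
        (Complex.Gamma (d - n + -u))⁻¹) := by
    rw [mbCoeff, inv_inv, inv_inv, div_eq_mul_inv, mul_inv]
  rw [e, ka, kb, kc, kd, hsin, hsin, dualCoeff, trigRatio,
    show 1 - (b - n) + u = 1 - b + n + u by ring, show 1 - (d - n) + u = 1 - d + n + u by ring]
  have h1 : ((-1 : ℂ) ^ n) * (-1) ^ n = 1 := by rw [← mul_pow]; simp
  simp only [div_eq_mul_inv, mul_inv, inv_inv]
  have h2 : ((-1 : ℂ) ^ n)⁻¹ = (-1) ^ n := by
    exact inv_eq_of_mul_eq_one_left h1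
  rw [h2]
  have h3 : (Real.pi : ℂ) * (Real.pi : ℂ)⁻¹ = 1 := mul_inv_cancel₀ hπ
  generalize ((-1 : ℂ) ^ n) = σ at h1
  generalize (Real.pi : ℂ)⁻¹ = p at h3
  generalize Complex.Gamma (1 - a + u) = G₁
  generalize Complex.Gamma (1 - b + n + u) = G₂
  generalize Complex.Gamma (1 - c + u) = G₃
  generalize Complex.Gamma (1 - d + n + u) = G₄
  generalize Complex.sin (Real.pi * (a - u)) = s₁
  generalize Complex.sin (Real.pi * (b - u)) = s₂
  generalize Complex.sin (Real.pi * (c - u)) = s₃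
  generalize Complex.sin (Real.pi * (d - u)) = s₄
  linear_combination (G₁⁻¹ * G₂⁻¹ * G₃ * G₄ * s₁⁻¹ * s₂⁻¹ * s₃ * s₄) * ((Real.pi * p) ^ 2 * h1 +
    (Real.pi * p + 1) * h3)

/-- For `p ≥ 0` one uses `‖n + u‖ ≤ (n + 1) * ‖u‖`, for `p < 0` that adding `n` increases the
modulus when `Re u > 0`. This is the origin of the exponent `max 0 (b - d).re`. -/
theorem rpow_norm_nat_add_le {u : ℂ} (hu : 1 ≤ u.re) (n : ℕ) (p : ℝ) :
    ‖n + u‖ ^ p ≤ ((n : ℝ) + 1) ^ max 0 p * ‖u‖ ^ p := by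
  have hn : (0 : ℝ) ≤ n := n.cast_nonneg
  have hu1 : 1 ≤ ‖u‖ := hu.trans (Complex.re_le_norm u)
  rcases le_or_gt 0 p with hp | hp
  · rw [max_eq_right hp, ← Real.mul_rpow (by positivity) (by positivity)]
    refine Real.rpow_le_rpow (norm_nonneg _) ?_ hp
    refine (norm_add_le _ _).trans ?_
    rw [Complex.norm_natCast]; nlinarith
  · rw [max_eq_left hp.le, Real.rpow_zero, one_mul]
    refine Real.rpow_le_rpow_of_nonpos (by linarith) ?_ hp.le
    rw [Complex.norm_def, Complex.norm_def]
    apply Real.sqrt_le_sqrt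
    simp only [Complex.normSq_apply, Complex.add_re, Complex.natCast_re, Complex.add_im,
      Complex.natCast_im, zero_add]
    nlinarith

/-- The quotient containing `n` is evaluated at `n + u`, which stays in the same right half-plane,
so a single Stirling bound serves all `n`. -/
theorem exists_norm_dualCoeff_le (a b c d : ℂ) : ∃ C M : ℝ, 0 < C ∧ ∀ (n : ℕ) (u : ℂ), M ≤ u.re →
    ‖dualCoeff a b c d n u‖ ≤
      C * (((n : ℝ) + 1) ^ max 0 (b - d).re * ‖u‖ ^ (a + b - c - d).re) := by
  obtain ⟨C₁, M₁, hC₁, h₁⟩ := exists_norm_Gamma_div_Gamma_le (1 - c) (1 - a)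
  obtain ⟨C₂, M₂, hC₂, h₂⟩ := exists_norm_Gamma_div_Gamma_le (1 - d) (1 - b)
  refine ⟨C₁ * C₂, max (max M₁ M₂) 1, by positivity, fun n u hu => ?_⟩
  have hn : (0 : ℝ) ≤ n := n.cast_nonneg
  have hu1 : 1 ≤ u.re := le_trans (by simp) hu
  have hun : 0 < ‖u‖ := by linarith [Complex.re_le_norm u]
  have b1 := h₁ u (le_trans (by simp) hu)
  have b2 := h₂ (n + u) (by
    have : M₂ ≤ u.re := le_trans (by simp) hu
    simp; linarith)
  rw [show 1 - c - (1 - a) = a - c by ring] at b1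
  rw [show 1 - d - (1 - b) = b - d by ring] at b2
  have e : dualCoeff a b c d n u = (Complex.Gamma (u + (1 - c)) / Complex.Gamma (u + (1 - a))) *
      (Complex.Gamma (n + u + (1 - d)) / Complex.Gamma (n + u + (1 - b))) := by
    rw [dualCoeff, div_mul_div_comm]
    congr 3 <;> ring
  rw [e, norm_mul]
  calc _ ≤ (C₁ * ‖u‖ ^ (a - c).re) *
        (C₂ * (((n : ℝ) + 1) ^ max 0 (b - d).re * ‖u‖ ^ (b - d).re)) := by
        gcongr
        exact b2.trans (mul_le_mul_of_nonneg_left (rpow_norm_nat_add_le hu1 n _) hC₂.le)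
    _ = C₁ * C₂ * (((n : ℝ) + 1) ^ max 0 (b - d).re * (‖u‖ ^ (a - c).re * ‖u‖ ^ (b - d).re)) := by
        ring
    _ = _ := by
        rw [← Real.rpow_add hun]
        congr 3
        simp only [Complex.sub_re, Complex.add_re]; ring

/-- With `r = exp (Re v)` and `S = sin (Im v / 2)`, one has `‖1 - exp v‖ ^ 2 = (1 - r) ^ 2 + 4 * r *
S ^ 2`, while `S ^ 2 * (1 + r) ^ 2 = S ^ 2 * (1 - r) ^ 2 + 4 * r * S ^ 2`; compare using `S ^ 2 ≤
1`. -/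
theorem norm_one_sub_exp_ge (v : ℂ) :
    |Real.sin (v.im / 2)| * (1 + Real.exp v.re) ≤ ‖1 - Complex.exp v‖ := by
  rw [← abs_of_pos (by positivity : 0 < 1 + Real.exp v.re), ← abs_mul, Complex.norm_def]
  refine Real.abs_le_sqrt ?_
  rw [Complex.normSq_apply]
  simp only [Complex.sub_re, Complex.one_re, Complex.sub_im, Complex.one_im, Complex.exp_re,
    Complex.exp_im]
  have h1 : Real.cos v.im = 1 - 2 * Real.sin (v.im / 2) ^ 2 := by
    have := Real.cos_two_mul (v.im / 2)
    rw [show 2 * (v.im / 2) = v.im by ring] at this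
    rw [this]; have := Real.sin_sq_add_cos_sq (v.im / 2); linarith
  have h2 := Real.sin_sq_add_cos_sq v.im
  have h3 := Real.sin_sq_add_cos_sq (v.im / 2)
  set e := Real.exp v.re
  set S := Real.sin (v.im / 2)
  have h4 : S ^ 2 ≤ 1 := by nlinarith [sq_nonneg (Real.cos (v.im / 2))]
  have h5 : (1 - e * Real.cos v.im) * (1 - e * Real.cos v.im) +
      (0 - e * Real.sin v.im) * (0 - e * Real.sin v.im) = 1 - 2 * e * Real.cos v.im + e ^ 2 := by
    linear_combination e ^ 2 * h2
  rw [h5, h1]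
  nlinarith [mul_nonneg (sub_nonneg.2 h4) (sq_nonneg (1 - e))]

/-- Factors out the exponential that dominates as `Im u → +∞`. The quotient of the four dominant
exponentials is `trigLimit`. -/
theorem sin_pi_mul_sub_eq (x u : ℂ) : Complex.sin (Real.pi * (x - u)) =
    Complex.exp (Real.pi * Complex.I * (x - u)) *
      (1 - Complex.exp (2 * Real.pi * Complex.I * (u - x))) * (-Complex.I / 2) := by
  rw [mul_sub (Complex.exp _), mul_one, ← Complex.exp_add, Complex.sin]
  rw [show (Real.pi : ℂ) * Complex.I * (x - u) + 2 * Real.pi * Complex.I * (u - x) =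
    -(Real.pi * (x - u)) * Complex.I by ring,
    show (Real.pi : ℂ) * Complex.I * (x - u) = Real.pi * (x - u) * Complex.I by ring]
  ring

theorem trigRatio_eq (a b c d u : ℂ) : trigRatio a b c d u = trigLimit a b c d *
    ((1 - Complex.exp (2 * Real.pi * Complex.I * (u - c))) *
      (1 - Complex.exp (2 * Real.pi * Complex.I * (u - d))) /
    ((1 - Complex.exp (2 * Real.pi * Complex.I * (u - a))) *
      (1 - Complex.exp (2 * Real.pi * Complex.I * (u - b))))) := by
  have h : trigLimit a b c d = Complex.exp (Real.pi * Complex.I * (c - u)) *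
      Complex.exp (Real.pi * Complex.I * (d - u)) / (Complex.exp (Real.pi * Complex.I * (a - u)) *
      Complex.exp (Real.pi * Complex.I * (b - u))) := by
    rw [← Complex.exp_add, ← Complex.exp_add, ← Complex.exp_sub, trigLimit]
    congr 1; ring
  rw [trigRatio, sin_pi_mul_sub_eq, sin_pi_mul_sub_eq, sin_pi_mul_sub_eq, sin_pi_mul_sub_eq, h]
  have hI : (-Complex.I / 2) ≠ 0 := div_ne_zero (neg_ne_zero.2 Complex.I_ne_zero) two_ne_zero
  rw [div_mul_div_comm, ← mul_div_mul_right _ (Complex.exp (Real.pi * Complex.I * (a - u)) *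
      Complex.exp (Real.pi * Complex.I * (b - u)) * _) (mul_ne_zero hI hI)]
  congr 1 <;> ring

theorem one_sub_exp_ne_zero {a : ℂ} {w : ℝ} (ha : ∀ m : ℤ, w - a.re ≠ m) {u : ℂ} (hu : u.re = w) :
    0 < |Real.sin (Real.pi * (w - a.re))| ∧
    |Real.sin (Real.pi * (w - a.re))| *
      (1 + Real.exp (2 * Real.pi * a.im) * Real.exp (-(2 * Real.pi * u.im))) ≤
      ‖1 - Complex.exp (2 * Real.pi * Complex.I * (u - a))‖ := by
  constructor
  · rw [abs_pos]
    intro h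
    obtain ⟨m, hm⟩ := Real.sin_eq_zero_iff.1 h
    refine ha m ?_
    have := Real.pi_ne_zero
    field_simp at hm
    linarith
  · have := norm_one_sub_exp_ge (2 * Real.pi * Complex.I * (u - a))
    have h1 : (2 * Real.pi * Complex.I * (u - a) : ℂ).re = 2 * Real.pi * a.im + -(2 * Real.pi * u.im) := by
      simp; ring
    have h2 : (2 * Real.pi * Complex.I * (u - a) : ℂ).im / 2 = Real.pi * (w - a.re) := by
      simp [hu]; ring
    rwa [h1, h2, Real.exp_add] at this

/-- With `E = exp (2πi u)` of modulus `ρ`, the difference is `E` times a polynomial of degree one in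
`E`, over a product of two factors of size at least a constant times `1 + ρ`. Hence it is `O(ρ / (1
+ ρ))`. The lower bounds hold on the whole line because `w - Re a` and `w - Re b` are not integers.
-/
theorem exists_norm_trigRatio_sub_le {a b : ℂ} (c d : ℂ) {w : ℝ} (ha : ∀ m : ℤ, w - a.re ≠ m)
    (hb : ∀ m : ℤ, w - b.re ≠ m) : ∃ C : ℝ, 0 < C ∧ ∀ u : ℂ, u.re = w →
      ‖trigRatio a b c d u - trigLimit a b c d‖ ≤ C * min 1 (Real.exp (-(2 * Real.pi * u.im))) := by
  set sa := |Real.sin (Real.pi * (w - a.re))| with hsa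
  set sb := |Real.sin (Real.pi * (w - b.re))| with hsb
  have hsa0 : 0 < sa := (one_sub_exp_ne_zero ha (u := w) (by simp)).1
  have hsb0 : 0 < sb := (one_sub_exp_ne_zero hb (u := w) (by simp)).1
  set ra := Real.exp (2 * Real.pi * a.im) with hra
  set rb := Real.exp (2 * Real.pi * b.im) with hrb
  have hra0 : 0 < ra := Real.exp_pos _
  have hrb0 : 0 < rb := Real.exp_pos _
  set e : ℂ → ℂ := fun x => Complex.exp (-(2 * Real.pi * Complex.I * x)) with he
  set K := ‖trigLimit a b c d‖ with hK
  set B := ‖e a + e b - e c - e d‖ + ‖e c * e d - e a * e b‖ with hB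
  refine ⟨K * B / (sa * min 1 ra * (sb * min 1 rb)) + 1, by positivity, fun u hu => ?_⟩
  obtain ⟨-, ha2⟩ := one_sub_exp_ne_zero ha hu
  obtain ⟨-, hb2⟩ := one_sub_exp_ne_zero hb hu
  rw [← hsa, ← hra] at ha2
  rw [← hsb, ← hrb] at hb2
  set E := Complex.exp (2 * Real.pi * Complex.I * u) with hE
  set ρ := Real.exp (-(2 * Real.pi * u.im)) with hρ
  have hρ0 : 0 < ρ := Real.exp_pos _
  have hEρ : ‖E‖ = ρ := by
    rw [hE, Complex.norm_exp, hρ]; congr 1; simp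
  have hex : ∀ x : ℂ, Complex.exp (2 * Real.pi * Complex.I * (u - x)) = e x * E := fun x => by
    rw [he, hE, ← Complex.exp_add]; congr 1; ring
  rw [hex] at ha2 hb2
  have hm : ∀ r : ℝ, 0 < r → min 1 r * (1 + ρ) ≤ 1 + r * ρ := fun r hr => by
    have h1 := min_le_left 1 r
    have h2 := min_le_right 1 r
    nlinarith
  have ha3 : sa * min 1 ra * (1 + ρ) ≤ ‖1 - e a * E‖ := by
    refine le_trans ?_ ha2
    rw [mul_assoc]
    exact mul_le_mul_of_nonneg_left (hm ra hra0) hsa0.le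
  have hb3 : sb * min 1 rb * (1 + ρ) ≤ ‖1 - e b * E‖ := by
    refine le_trans ?_ hb2
    rw [mul_assoc]
    exact mul_le_mul_of_nonneg_left (hm rb hrb0) hsb0.le
  have hpa : 0 < sa * min 1 ra * (1 + ρ) := by positivity
  have hpb : 0 < sb * min 1 rb * (1 + ρ) := by positivity
  have hna : 1 - e a * E ≠ 0 := norm_pos_iff.1 (hpa.trans_le ha3)
  have hnb : 1 - e b * E ≠ 0 := norm_pos_iff.1 (hpb.trans_le hb3)
  rw [trigRatio_eq, hex, hex, hex, hex]
  have hdiff : trigLimit a b c d * ((1 - e c * E) * (1 - e d * E) / ((1 - e a * E) * (1 - e b * E))) -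
      trigLimit a b c d = trigLimit a b c d * (E * ((e a + e b - e c - e d) +
        E * (e c * e d - e a * e b))) / ((1 - e a * E) * (1 - e b * E)) := by
    rw [eq_div_iff (mul_ne_zero hna hnb), sub_mul, mul_assoc (trigLimit a b c d),
      div_mul_cancel₀ _ (mul_ne_zero hna hnb)]
    ring
  rw [hdiff, norm_div, norm_mul, norm_mul, norm_mul, ← hK, hEρ]
  have hnum : ‖(e a + e b - e c - e d) + E * (e c * e d - e a * e b)‖ ≤ B * (1 + ρ) := by
    refine (norm_add_le _ _).trans ?_
    rw [norm_mul, hEρ, hB]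
    have := norm_nonneg (e a + e b - e c - e d)
    have := norm_nonneg (e c * e d - e a * e b)
    nlinarith
  have hden : (sa * min 1 ra * (1 + ρ)) * (sb * min 1 rb * (1 + ρ)) ≤
      ‖1 - e a * E‖ * ‖1 - e b * E‖ := by gcongr
  have hB0 : 0 ≤ B := by positivity
  have hK0 : 0 ≤ K := norm_nonneg _
  calc _ ≤ K * (ρ * (B * (1 + ρ))) / ((sa * min 1 ra * (1 + ρ)) * (sb * min 1 rb * (1 + ρ))) := by
        gcongr
    _ = K * B / (sa * min 1 ra * (sb * min 1 rb)) * (ρ / (1 + ρ)) := by field_simp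
    _ ≤ (K * B / (sa * min 1 ra * (sb * min 1 rb)) + 1) * min 1 ρ := by
        gcongr
        · linarith
        · refine le_min ?_ ?_
          · rw [div_le_one (by positivity)]; linarith
          · exact div_le_self hρ0.le (by linarith)

theorem continuous_Gamma_line {x : ℂ} {w : ℝ} (h : 0 < x.re + w) :
    Continuous fun y : ℝ => Complex.Gamma (x + (w + y * Complex.I)) := by
  refine continuous_iff_continuousAt.2 fun y => ?_
  have h1 : ∀ m : ℕ, x + (w + y * Complex.I) ≠ -m := fun m hm => by
    have := congrArg Complex.re hm
    simp at this
    have : (0 : ℝ) ≤ m := m.cast_nonneg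
    linarith
  exact ContinuousAt.comp (g := Complex.Gamma)
    (Complex.differentiableAt_Gamma _ h1).continuousAt (by fun_prop)

theorem one_sub_re_add_pos {x : ℂ} {w : ℝ} (h : ‖x‖ ≤ w) : 0 < (1 - x : ℂ).re + w := by
  have := Complex.re_le_norm x
  simp; linarith

theorem continuous_dualCoeff_line {a b c d : ℂ} {w : ℝ} (hw : ‖a‖ + ‖b‖ + ‖c‖ + ‖d‖ ≤ w) (n : ℕ) :
    Continuous fun y : ℝ => dualCoeff a b c d n (w + y * Complex.I) := by
  have ha := norm_nonneg a
  have hb := norm_nonneg b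
  have hc := norm_nonneg c
  have hd := norm_nonneg d
  have hn : (0 : ℝ) ≤ n := n.cast_nonneg
  have pb := one_sub_re_add_pos (x := b) (w := w) (by linarith)
  have pd := one_sub_re_add_pos (x := d) (w := w) (by linarith)
  have pa := one_sub_re_add_pos (x := a) (w := w) (by linarith)
  unfold dualCoeff
  refine ((continuous_Gamma_line (one_sub_re_add_pos (by linarith))).mul
    (continuous_Gamma_line (x := 1 - d + n) (by simp at pd ⊢; linarith))).div
    ((continuous_Gamma_line pa).mul
    (continuous_Gamma_line (x := 1 - b + n) (by simp at pb ⊢; linarith))) fun y => ?_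
  refine mul_ne_zero (Complex.Gamma_ne_zero_of_re_pos ?_) (Complex.Gamma_ne_zero_of_re_pos ?_)
  · simpa using pa
  · simp at pb ⊢; linarith

theorem continuous_trigRatio_line {a b : ℂ} (c d : ℂ) {w : ℝ} (ha : ∀ m : ℤ, w - a.re ≠ m)
    (hb : ∀ m : ℤ, w - b.re ≠ m) :
    Continuous fun y : ℝ => trigRatio a b c d (w + y * Complex.I) := by
  simp only [trigRatio_eq]
  have hne : ∀ {x : ℂ}, (∀ m : ℤ, w - x.re ≠ m) → ∀ y : ℝ,
      1 - Complex.exp (2 * Real.pi * Complex.I * ((w + y * Complex.I) - x)) ≠ 0 := by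
    intro x hx y
    obtain ⟨h1, h2⟩ := one_sub_exp_ne_zero hx (u := w + y * Complex.I) (by simp)
    exact norm_pos_iff.1 (lt_of_lt_of_le (by positivity) h2)
  refine continuous_const.mul (Continuous.div (by fun_prop) (by fun_prop) fun y =>
    mul_ne_zero (hne ha y) (hne hb y))

/-- Uniform exponential decay on vertical strips. -/
theorem exists_norm_Gamma_mul_dualCoeff_le (a b c d : ℂ) : ∃ M : ℝ, ∀ V : ℝ,
    ∃ C : ℝ, 0 < C ∧ ∀ (n : ℕ) (u : ℂ), M ≤ u.re → u.re ≤ V →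
      ‖Complex.Gamma u * dualCoeff a b c d n u‖ ≤
        C * ((n : ℝ) + 1) ^ max 0 (b - d).re * Real.exp (-(3 * Real.pi / 8 * |u.im|)) := by
  obtain ⟨C, M, hC, h⟩ := exists_norm_dualCoeff_le a b c d
  refine ⟨max M 2, fun V => ?_⟩
  obtain ⟨L, hL⟩ := exists_nat_ge (a + b - c - d).re
  obtain ⟨C₁, M₁, hC₁, h₁⟩ := exists_norm_Gamma_strip_right V
  -- The rate `3π / 8` is below the `π / 2` of Gamma, so that powers are absorbed, and exceeds by `π
  -- / 8` the growth rate of `z ^ (-u)` for `|arg z| ≤ π / 4`.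
  obtain ⟨C₂, hC₂, h₂⟩ := exists_one_add_pow_mul_exp_le (M₁ + L)
    (η := Real.pi / 2) (η' := 3 * Real.pi / 8) (by linarith [Real.pi_pos])
  refine ⟨C₁ * C * (|V| + 1) ^ L * C₂, by positivity, fun n u hM hV => ?_⟩
  have hu2 : 2 ≤ u.re := le_trans (by simp) hM
  have u1 := h n u (le_trans (by simp) hM)
  have hun : 1 ≤ ‖u‖ := by have := Complex.re_le_norm u; linarith
  have hun2 : ‖u‖ ≤ (|V| + 1) * (1 + |u.im|) := by
    refine (Complex.norm_le_abs_re_add_abs_im u).trans ?_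
    rw [abs_of_nonneg (by linarith : 0 ≤ u.re)]
    nlinarith [abs_nonneg u.im, le_abs_self V, abs_nonneg V]
  have hp : ‖u‖ ^ (a + b - c - d).re ≤ ((|V| + 1) * (1 + |u.im|)) ^ L := by
    calc _ ≤ ‖u‖ ^ (L : ℝ) := Real.rpow_le_rpow_of_exponent_le hun hL
      _ = ‖u‖ ^ L := Real.rpow_natCast _ _
      _ ≤ _ := by gcongr
  rw [norm_mul]
  calc _ ≤ (C₁ * ((1 + |u.im|) ^ M₁ * Real.exp (-(Real.pi / 2 * |u.im|)))) *
        (C * (((n : ℝ) + 1) ^ max 0 (b - d).re * ((|V| + 1) * (1 + |u.im|)) ^ L)) := by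
        gcongr
        · exact (h₁ u hu2 hV).1
        · exact u1.trans (by gcongr)
    _ = C₁ * C * (|V| + 1) ^ L * ((n : ℝ) + 1) ^ max 0 (b - d).re *
        ((1 + |u.im|) ^ (M₁ + L) * Real.exp (-(Real.pi / 2 * |u.im|))) := by rw [mul_pow]; ring
    _ ≤ C₁ * C * (|V| + 1) ^ L * ((n : ℝ) + 1) ^ max 0 (b - d).re *
        (C₂ * Real.exp (-(3 * Real.pi / 8 * |u.im|))) :=
        mul_le_mul_of_nonneg_left (h₂ _ (abs_nonneg _)) (by positivity)
    _ = _ := by ring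

/-! ### Integrals along vertical lines as functions of `z` -/

/-- A Mellin-type integral along the line `re u = w`. -/
def lineIntegral (φ : ℝ → ℂ) (w : ℝ) (z : ℂ) : ℂ :=
  (2 * Real.pi : ℂ)⁻¹ * ∫ y : ℝ, φ y * z ^ (-(w + y * Complex.I : ℂ))

theorem norm_cpow_neg_line {z : ℂ} (hz : z ≠ 0) (w y : ℝ) :
    ‖z ^ (-(w + y * Complex.I : ℂ))‖ = ‖z‖ ^ (-w) * Real.exp (z.arg * y) := by
  rw [Complex.norm_cpow_of_ne_zero hz, div_eq_mul_inv, ← Real.exp_neg]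
  simp

theorem continuous_cpow_neg_line {z : ℂ} (hz : z ≠ 0) (w : ℝ) :
    Continuous fun y : ℝ => z ^ (-(w + y * Complex.I : ℂ)) :=
  (by fun_prop : Continuous fun y : ℝ => (-(w + y * Complex.I : ℂ))).const_cpow (Or.inl hz)

theorem norm_mul_cpow_neg_line_le {φ : ℝ → ℂ} {z : ℂ} (hz : z ≠ 0) (w : ℝ) {D η y : ℝ}
    (h : ‖φ y‖ * Real.exp (z.arg * y) ≤ D * Real.exp (-(η * |y|))) :
    ‖φ y * z ^ (-(w + y * Complex.I : ℂ))‖ ≤ ‖z‖ ^ (-w) * D * Real.exp (-(η * |y|)) := by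
  rw [norm_mul, norm_cpow_neg_line hz]
  calc _ = ‖z‖ ^ (-w) * (‖φ y‖ * Real.exp (z.arg * y)) := by ring
    _ ≤ ‖z‖ ^ (-w) * (D * Real.exp (-(η * |y|))) := by gcongr
    _ = _ := by ring

theorem integrable_lineIntegral {φ : ℝ → ℂ} (hφ : Continuous φ) {z : ℂ} (hz : z ≠ 0) (w : ℝ)
    {D η : ℝ} (hη : 0 < η)
    (h : ∀ y, ‖φ y‖ * Real.exp (z.arg * y) ≤ D * Real.exp (-(η * |y|))) :
    Integrable fun y : ℝ => φ y * z ^ (-(w + y * Complex.I : ℂ)) :=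
  ((integrable_exp_neg_mul_abs hη).const_mul _).mono'
    (hφ.mul (continuous_cpow_neg_line hz w)).aestronglyMeasurable
    (Eventually.of_forall fun y => norm_mul_cpow_neg_line_le hz w (h y))

theorem norm_lineIntegral_le {φ : ℝ → ℂ} {z : ℂ} (hz : z ≠ 0) (w : ℝ) {D η : ℝ} (hη : 0 < η)
    (h : ∀ y, ‖φ y‖ * Real.exp (z.arg * y) ≤ D * Real.exp (-(η * |y|))) :
    ‖lineIntegral φ w z‖ ≤ (∫ y : ℝ, Real.exp (-(η * |y|))) * D * ‖z‖ ^ (-w) := by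
  have h1 := norm_integral_le_of_norm_le
    ((integrable_exp_neg_mul_abs hη).const_mul (‖z‖ ^ (-w) * D))
    (Eventually.of_forall fun y => norm_mul_cpow_neg_line_le hz w (h y))
  rw [integral_const_mul] at h1
  have h2 : ‖(2 * Real.pi : ℂ)⁻¹‖ ≤ 1 := by
    rw [norm_inv, norm_mul, Complex.norm_real, Real.norm_of_nonneg Real.pi_pos.le]
    refine inv_le_one_of_one_le₀ ?_
    simp; linarith [Real.pi_gt_three]
  rw [lineIntegral, norm_mul]
  calc _ ≤ 1 * _ := mul_le_mul h2 h1 (norm_nonneg _) zero_le_one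
    _ = _ := by ring

/-- Differentiation under the integral sign on a disc inside the upper half plane. The hypothesis is
uniform over `[0, π]`, so one majorant serves every argument in the disc; the factor `u` brought
down by the derivative is paid for by halving `η`. -/
theorem differentiableAt_lineIntegral {φ : ℝ → ℂ} (hφ : Continuous φ) (w : ℝ) {D η : ℝ}
    (hη : 0 < η) (h : ∀ θ ∈ Set.Icc 0 Real.pi, ∀ y,
      ‖φ y‖ * Real.exp (θ * y) ≤ D * Real.exp (-(η * |y|))) {z₀ : ℂ} (hz₀ : 0 < z₀.im) :
    DifferentiableAt ℂ (lineIntegral φ w) z₀ := by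
  obtain ⟨C₁, hC₁, h₁⟩ := exists_one_add_pow_mul_exp_le 1 (η := η) (η' := η / 2) (by linarith)
  set ρ := z₀.im / 2 with hρ
  have hρ0 : 0 < ρ := by positivity
  have him : ∀ z ∈ Metric.ball z₀ ρ, ρ < z.im := by
    intro z hz
    have h1 : ‖z - z₀‖ < ρ := mem_ball_iff_norm.1 hz
    have h2 := (abs_le.1 (Complex.abs_im_le_norm (z - z₀))).1
    rw [Complex.sub_im] at h2
    linarith
  have hD : 0 ≤ D := by
    have := h 0 ⟨le_rfl, Real.pi_pos.le⟩ 0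
    simp at this
    exact (norm_nonneg _).trans this
  obtain ⟨Q, hQ⟩ : ∃ Q : ℝ, ∀ z ∈ Metric.ball z₀ ρ, ‖z‖ ^ (-w - 1) ≤ Q := by
    refine ⟨ρ ^ (-w - 1) + (‖z₀‖ + ρ) ^ (-w - 1), fun z hz => ?_⟩
    have hz1 : ρ ≤ ‖z‖ := (him z hz).le.trans ((le_abs_self _).trans (Complex.abs_im_le_norm z))
    have hz2 : ‖z‖ ≤ ‖z₀‖ + ρ := by
      have h1 : ‖z - z₀‖ < ρ := mem_ball_iff_norm.1 hz
      have h2 := norm_le_norm_add_norm_sub z₀ z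
      rw [norm_sub_rev] at h2
      linarith
    have p1 : 0 < ρ ^ (-w - 1) := by positivity
    have p2 : 0 < (‖z₀‖ + ρ) ^ (-w - 1) := by positivity
    rcases le_total (-w - 1) 0 with hw | hw
    · have := Real.rpow_le_rpow_of_nonpos hρ0 hz1 hw
      linarith
    · have := Real.rpow_le_rpow (norm_nonneg z) hz2 hw
      linarith
  have hne : ∀ z ∈ Metric.ball z₀ ρ, z ∈ Complex.slitPlane := fun z hz =>
    Or.inr (by have := him z hz; linarith)
  have hmem : z₀ ∈ Metric.ball z₀ ρ := Metric.mem_ball_self hρ0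
  have hz₀0 : z₀ ≠ 0 := Complex.slitPlane_ne_zero (hne z₀ hmem)
  have hcont : ∀ z : ℂ, z ≠ 0 → Continuous fun y : ℝ =>
      φ y * (-(w + y * Complex.I : ℂ) * z ^ (-(w + y * Complex.I : ℂ) - 1)) := fun z hz =>
    hφ.mul (Continuous.mul (by fun_prop) ((by fun_prop : Continuous fun y : ℝ =>
      (-(w + y * Complex.I : ℂ) - 1)).const_cpow (Or.inl hz)))
  have main := hasDerivAt_integral_of_dominated_loc_of_deriv_le (𝕜 := ℂ) (μ := volume)
    (F := fun z (y : ℝ) => φ y * z ^ (-(w + y * Complex.I : ℂ)))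
    (F' := fun z (y : ℝ) => φ y * (-(w + y * Complex.I : ℂ) * z ^ (-(w + y * Complex.I : ℂ) - 1)))
    (x₀ := z₀) (s := Metric.ball z₀ ρ) (bound := fun y => (|w| + 1) * Q * D * C₁ * Real.exp (-(η / 2 * |y|)))
    (Metric.ball_mem_nhds z₀ hρ0) ?_ ?_ ?_ ?_ ?_ ?_
  · exact (main.2.differentiableAt).const_mul _
  · filter_upwards [Metric.ball_mem_nhds z₀ hρ0] with z hz
    exact (hφ.mul (continuous_cpow_neg_line (Complex.slitPlane_ne_zero (hne z hz)) w)).aestronglyMeasurable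
  · exact integrable_lineIntegral hφ hz₀0 w hη fun y =>
      h _ ⟨Complex.arg_nonneg_iff.2 hz₀.le, Complex.arg_le_pi _⟩ y
  · exact (hcont z₀ hz₀0).aestronglyMeasurable
  · refine Eventually.of_forall fun y z hz => ?_
    have hz0 := Complex.slitPlane_ne_zero (hne z hz)
    have hpos : 0 < z.im := hρ0.trans (him z hz)
    have hθ := h z.arg ⟨Complex.arg_nonneg_iff.2 hpos.le, Complex.arg_le_pi _⟩ y
    have hnorm : ‖z ^ (-(w + y * Complex.I : ℂ) - 1)‖ = ‖z‖ ^ (-w - 1) * Real.exp (z.arg * y) := by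
      rw [Complex.norm_cpow_of_ne_zero hz0, div_eq_mul_inv, ← Real.exp_neg]
      simp
    have hu : ‖-(w + y * Complex.I : ℂ)‖ ≤ (|w| + 1) * (1 + |y|) ^ 1 := by
      rw [norm_neg]
      refine (norm_add_le _ _).trans ?_
      simp
      nlinarith [abs_nonneg w, abs_nonneg y]
    rw [norm_mul, norm_mul, hnorm]
    have hQ0 : 0 ≤ Q := le_trans (by positivity) (hQ z hz)
    calc _ = ‖-(w + y * Complex.I : ℂ)‖ * ‖z‖ ^ (-w - 1) * (‖φ y‖ * Real.exp (z.arg * y)) := by ring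
      _ ≤ ((|w| + 1) * (1 + |y|) ^ 1) * Q * (D * Real.exp (-(η * |y|))) := by
          gcongr
          exact hQ z hz
      _ = (|w| + 1) * Q * D * ((1 + |y|) ^ 1 * Real.exp (-(η * |y|))) := by ring
      _ ≤ (|w| + 1) * Q * D * (C₁ * Real.exp (-(η / 2 * |y|))) :=
          mul_le_mul_of_nonneg_left (h₁ _ (abs_nonneg _)) (by positivity)
      _ = _ := by ring
  · exact (integrable_exp_neg_mul_abs (by positivity)).const_mul _
  · refine Eventually.of_forall fun y z hz => ?_
    have := (hasDerivAt_id z).cpow_const (c := -(w + y * Complex.I : ℂ)) (hne z hz)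
    rw [mul_one] at this
    exact this.const_mul (φ y)

theorem lineIntegral_add {φ ψ : ℝ → ℂ} {w : ℝ} {z : ℂ}
    (h₁ : Integrable fun y : ℝ => φ y * z ^ (-(w + y * Complex.I : ℂ)))
    (h₂ : Integrable fun y : ℝ => ψ y * z ^ (-(w + y * Complex.I : ℂ))) (κ : ℂ) :
    lineIntegral (fun y => φ y + κ * ψ y) w z = lineIntegral φ w z + κ * lineIntegral ψ w z := by
  have e : (fun y : ℝ => (φ y + κ * ψ y) * z ^ (-(w + y * Complex.I : ℂ))) = fun y : ℝ =>
      φ y * z ^ (-(w + y * Complex.I : ℂ)) + κ * (ψ y * z ^ (-(w + y * Complex.I : ℂ))) := by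
    funext y; ring
  rw [lineIntegral, e, integral_add h₁ (h₂.const_mul κ), integral_const_mul, lineIntegral,
    lineIntegral]
  ring

/-! ### The remainder and its integral representation -/

/-- The regularized `₂F₂` series. -/
def mbSeries (a b c d z : ℂ) : ℂ :=
  ∑' k : ℕ, mbCoeff a b c d k * ((-z) ^ k / (k.factorial : ℂ))

/-- The remainder after subtracting the algebraic sums. -/
def hypRemainder (a b c d : ℂ) (w : ℝ) (n : ℕ) (z : ℂ) : ℂ :=
  mbSeries a (b - n) c (d - n) z - algSumS a b c d w n z - algSumT a b c d w n z

theorem mbCoeff_natCast_eq {a b c d : ℂ} (ha : ∀ m : ℕ, a ≠ -m) (hb : ∀ m : ℕ, b ≠ -m)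
    (hc : ∀ m : ℕ, c ≠ -m) (hd : ∀ m : ℕ, d ≠ -m) (k : ℕ) :
    mbCoeff a b c d k = Complex.Gamma a * Complex.Gamma b / (Complex.Gamma c * Complex.Gamma d) *
      ((ascPochhammer ℂ k).eval a * (ascPochhammer ℂ k).eval b /
        ((ascPochhammer ℂ k).eval c * (ascPochhammer ℂ k).eval d)) := by
  rw [← Complex.Gamma_add_nat_div_Gamma_eq a ha, ← Complex.Gamma_add_nat_div_Gamma_eq b hb,
    ← Complex.Gamma_add_nat_div_Gamma_eq c hc, ← Complex.Gamma_add_nat_div_Gamma_eq d hd, mbCoeff]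
  have := Complex.Gamma_ne_zero ha
  have := Complex.Gamma_ne_zero hb
  have := Complex.Gamma_ne_zero hc
  have := Complex.Gamma_ne_zero hd
  have h3 : Complex.Gamma (c + k) ≠ 0 := Complex.Gamma_ne_zero fun m h =>
    hc (m + k) (by push_cast; linear_combination h)
  have h4 : Complex.Gamma (d + k) ≠ 0 := Complex.Gamma_ne_zero fun m h =>
    hd (m + k) (by push_cast; linear_combination h)
  field_simp

theorem mbSeries_eq {a b c d : ℂ} (ha : ∀ m : ℕ, a ≠ -m) (hb : ∀ m : ℕ, b ≠ -m)
    (hc : ∀ m : ℕ, c ≠ -m) (hd : ∀ m : ℕ, d ≠ -m) (z : ℂ) :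
    mbSeries a b c d z = Complex.Gamma a * Complex.Gamma b /
      (Complex.Gamma c * Complex.Gamma d) * hyp2F2 a b c d (-z) ∧
    Summable fun k : ℕ => mbCoeff a b c d k * ((-z) ^ k / (k.factorial : ℂ)) := by
  simp only [mbSeries, mbCoeff_natCast_eq ha hb hc hd, mul_assoc]
  constructor
  · rw [tsum_mul_left, hyp2F2]
  · exact (hyp2F2_summable hc hd (-z)).mul_left _

theorem algSumS_eq (a b c d : ℂ) (w : ℝ) (n : ℕ) (z : ℂ) :
    algSumS a b c d w n z = algSum a (b - n) c (d - n) w z := by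
  rw [algSumS, algSum]
  refine Finset.sum_congr rfl fun k _ => ?_
  rw [show b - a - n - k = b - n - a - k by ring, show d - a - n - k = d - n - a - k by ring]

/-- The second sum is the first with `a` and `b - n` exchanged; the extra `n` in its upper limit is
the shift of the floor of `w - Re (b - n)`. -/
theorem algSumT_eq {a b c d : ℂ} {w : ℝ} (hwb : b.re < w) (n : ℕ) (z : ℂ) :
    algSumT a b c d w n z = algSum (b - n) a c (d - n) w z := by
  rw [algSumT, algSum]
  have e : ⌊w - (b - n : ℂ).re⌋₊ = ⌊w - b.re⌋₊ + n := by
    rw [← Nat.floor_add_natCast (by linarith)]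
    congr 1; simp; ring
  rw [e]
  refine Finset.sum_congr rfl fun k _ => ?_
  rw [show a - b + n - k = a - (b - n) - k by ring, show c - b + n - k = c - (b - n) - k by ring,
    show (n : ℂ) - b - k = -(b - n) - k by ring, show d - n - (b - n) - k = d - b - k by ring,
    mul_comm (Complex.Gamma (d - b - k))]

/-- Mellin–Barnes representation of the remainder. -/
theorem hypRemainder_eq_lineIntegral {a b c d z : ℂ} {w : ℝ} (n : ℕ) (hz : z ≠ 0)
    (hz' : |z.arg| < Real.pi / 2) (ha : ∀ m : ℕ, a ≠ -m) (hb : ∀ m : ℕ, b - n ≠ -m)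
    (hc : ∀ m : ℕ, c ≠ -m) (hd : ∀ m : ℤ, d ≠ m) (hab : ∀ m : ℤ, a - b ≠ m) (hw : 0 < w)
    (hw' : ‖a‖ + ‖b‖ + ‖c‖ + ‖d‖ + 1 ≤ w) (hfa : ∀ m : ℤ, w - a.re ≠ m)
    (hfb : ∀ m : ℤ, w - b.re ≠ m) :
    hypRemainder a b c d w n z = lineIntegral (fun y => Complex.Gamma (w + y * Complex.I) *
      dualCoeff a b c d n (w + y * Complex.I) * trigRatio a b c d (w + y * Complex.I)) w z := by
  have na := norm_nonneg a
  have nb := norm_nonneg b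
  have nc := norm_nonneg c
  have nd := norm_nonneg d
  have hn : (0 : ℝ) ≤ n := n.cast_nonneg
  have hwa : a.re < w := by linarith [Complex.re_le_norm a]
  have hwb : b.re < w := by linarith [Complex.re_le_norm b]
  have hd' : ∀ m : ℕ, d - n ≠ -m := fun m h => hd (n - m) (by push_cast; linear_combination h)
  have h1 := tendsto_sum_sub_algSum (a := a) (b := b - n) (c := c) (d := d - n) (w := w) hz hz' ha hb
    (fun m h => hab (m - n) (by push_cast; linear_combination h)) hw hwa (by simp; linarith)
    (fun k h => hfa k (by exact_mod_cast h))
    (fun k h => hfb (k - n) (by simp at h; push_cast; linarith))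
  have h2 := ((mbSeries_eq ha hb hc hd' z).2.hasSum.tendsto_sum_nat).comp (tendsto_add_atTop_nat 1)
  have h3 := tendsto_nhds_unique h2 h1
  -- Reversing `y` together with `s = -u` carries the line `Re s = -w` to `Re u = w`.
  rw [hypRemainder, mbSeries, h3, algSumS_eq, algSumT_eq hwb, sub_sub, add_sub_cancel_left,
    lineIntegral, ← integral_neg_eq_self]
  congr 2
  funext y
  have hs : ((-w : ℝ) : ℂ) + (-y : ℝ) * Complex.I = -(w + y * Complex.I) := by push_cast; ring
  have hpos : ∀ x : ℂ, ‖x‖ ≤ w → 0 < (1 - x + (w + y * Complex.I)).re := fun x hx => by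
    simpa using one_sub_re_add_pos hx
  rw [hs, mbIntegrand, neg_neg, mbCoeff_neg_eq n (hpos a (by linarith)) (hpos b (by linarith))
    (hpos c (by linarith)) (hpos d (by linarith))]
  ring

/-! ### Saddle point estimate on the ray `arg z = π / 4` -/

/-- The decay exponent along the vertical line through the saddle point, for `arg z = π / 4`. -/
def saddleDecay (τ : ℝ) : ℝ :=
  τ * (Real.arctan τ - Real.pi / 4) - 1 / 2 * Real.log (1 + τ ^ 2) + 1 / 2 * Real.log 2

/-- The comparison function is quadratic near the saddle `τ = 1` and linear far from it, as the
decay itself is. The difference `H` vanishes at `1` and has derivative `k τ - k 1` with `k`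
increasing, because `1 + t ^ 2 ≤ 3 * (1 + (t - 1) ^ 2)`; so `1` is its minimum. -/
theorem le_saddleDecay (τ : ℝ) : (√(1 + (τ - 1) ^ 2) - 1) / 3 ≤ saddleDecay τ := by
  set k : ℝ → ℝ := fun t => Real.arctan t - 1 / 3 * ((t - 1) / √(1 + (t - 1) ^ 2)) with hk
  set H : ℝ → ℝ := fun t => saddleDecay t - 1 / 3 * (√(1 + (t - 1) ^ 2) - 1) with hH
  have hpos : ∀ t : ℝ, 0 < 1 + (t - 1) ^ 2 := fun t => by positivity
  have hsq : ∀ t : ℝ, HasDerivAt (fun t : ℝ => √(1 + (t - 1) ^ 2)) ((t - 1) / √(1 + (t - 1) ^ 2)) t := by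
    intro t
    have h1 : HasDerivAt (fun t : ℝ => 1 + (t - 1) ^ 2) (2 * (t - 1)) t := by
      have := (((hasDerivAt_id t).sub_const 1).pow 2).const_add 1
      simpa using this
    have := h1.sqrt (hpos t).ne'
    convert this using 1
    field_simp
  have hkd : ∀ t : ℝ, HasDerivAt k (1 / (1 + t ^ 2) - 1 / 3 * (1 / (√(1 + (t - 1) ^ 2)) ^ 3)) t := by
    intro t
    have hs := Real.sqrt_pos.2 (hpos t)
    have h2 := ((hasDerivAt_id t).sub_const 1).div (hsq t) hs.ne'
    have h3 := (Real.hasDerivAt_arctan t).sub (h2.const_mul (1 / 3))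
    refine h3.congr_deriv ?_
    have e := Real.sq_sqrt (hpos t).le
    congr 2
    simp only [id]
    set S := √(1 + (t - 1) ^ 2)
    field_simp
    linear_combination e
  have hkm : Monotone k := by
    refine monotone_of_deriv_nonneg (fun t => (hkd t).differentiableAt) fun t => ?_
    rw [(hkd t).deriv]
    have hs : 1 ≤ √(1 + (t - 1) ^ 2) := Real.one_le_sqrt.2 (by nlinarith [sq_nonneg (t - 1)])
    have e := Real.sq_sqrt (hpos t).le
    set S := √(1 + (t - 1) ^ 2)
    have h1 : 1 / S ^ 3 ≤ 1 / S ^ 2 :=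
      one_div_le_one_div_of_le (by positivity) (pow_le_pow_right₀ hs (by norm_num))
    have h2 : 1 / 3 * (1 / S ^ 2) ≤ 1 / (1 + t ^ 2) := by
      rw [e, one_div_mul_one_div]
      exact one_div_le_one_div_of_le (by positivity) (by nlinarith [sq_nonneg (t - 2), sq_nonneg t])
    linarith
  have hHd : ∀ t : ℝ, HasDerivAt H (k t - k 1) t := by
    intro t
    have h1 : HasDerivAt (fun t : ℝ => 1 + t ^ 2) (2 * t) t := by
      simpa using ((hasDerivAt_id t).pow 2).const_add 1
    have h2 := h1.log (by positivity)
    have h3 := (hasDerivAt_id t).mul ((Real.hasDerivAt_arctan t).sub_const (Real.pi / 4))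
    have h4 := ((h3.sub (h2.const_mul (1 / 2))).add_const (1 / 2 * Real.log 2)).sub
      (((hsq t).sub_const 1).const_mul (1 / 3))
    refine h4.congr_deriv ?_
    simp only [hk, id, Real.arctan_one, sub_self, zero_div, mul_zero]
    field_simp
    ring
  have hH1 : H 1 = 0 := by
    simp only [hH, saddleDecay, Real.arctan_one]; norm_num
  have hHdiff : Differentiable ℝ H := fun t => (hHd t).differentiableAt
  have : 0 ≤ H τ := by
    rw [← hH1]
    rcases le_total 1 τ with h | h
    · refine monotoneOn_of_deriv_nonneg (convex_Ici 1) hHdiff.continuous.continuousOn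
        hHdiff.differentiableOn (fun t ht => ?_) (Set.self_mem_Ici) h h
      rw [interior_Ici] at ht
      rw [(hHd t).deriv]
      exact sub_nonneg.2 (hkm (Set.mem_Ioi.1 ht).le)
    · refine antitoneOn_of_deriv_nonpos (convex_Iic 1) hHdiff.continuous.continuousOn
        hHdiff.differentiableOn (fun t ht => ?_) h (Set.self_mem_Iic) h
      rw [interior_Iic] at ht
      rw [(hHd t).deriv]
      exact sub_nonpos.2 (hkm (Set.mem_Iio.1 ht).le)
  simp only [hH] at this
  linarith

theorem min_sq_abs_le_saddleDecay (τ : ℝ) :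
    min ((τ - 1) ^ 2) |τ - 1| / 9 ≤ saddleDecay τ := by
  refine le_trans ?_ (le_saddleDecay τ)
  set δ := τ - 1
  have h0 : 0 ≤ 1 + δ ^ 2 := by positivity
  have h1 : 1 + min (δ ^ 2) |δ| / 3 ≤ √(1 + δ ^ 2) := by
    apply Real.le_sqrt_of_sq_le
    have a1 := min_le_left (δ ^ 2) |δ|
    have a2 := min_le_right (δ ^ 2) |δ|
    have a3 : 0 ≤ min (δ ^ 2) |δ| := le_min (sq_nonneg _) (abs_nonneg _)
    have a4 : |δ| ^ 2 = δ ^ 2 := sq_abs δ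
    nlinarith
  linarith

theorem arg_eq_arctan {u : ℂ} (hu : 0 < u.re) : u.arg = Real.arctan (u.im / u.re) := by
  have h := abs_lt.1 ((Complex.abs_arg_lt_pi_div_two_iff (z := u)).2 (Or.inl hu))
  rw [← Complex.tan_arg, Real.arctan_tan h.1 h.2]

theorem norm_eq_mul_sqrt {u : ℂ} (hu : 0 < u.re) : ‖u‖ = u.re * √(1 + (u.im / u.re) ^ 2) := by
  rw [Complex.norm_def, Complex.normSq_apply]
  have : u.re * u.re + u.im * u.im = u.re ^ 2 * (1 + (u.im / u.re) ^ 2) := by field_simp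
  rw [this, Real.sqrt_mul (by positivity), Real.sqrt_sq hu.le]

/-- Bound for the integrand on the vertical line through the saddle point `u = z`, where
`z = x + x i`. -/
theorem exists_saddle_integrand_le (p : ℝ) : ∃ C : ℝ, 0 < C ∧ ∀ x y : ℝ, 1 ≤ x →
    Real.exp (stirlingExponent (x + y * Complex.I)) * ‖(x + y * Complex.I : ℂ)‖ ^ p *
      (‖(x + x * Complex.I : ℂ)‖ ^ (-x) * Real.exp (Real.pi / 4 * y)) ≤
    C * Real.exp (-x) * x ^ (p - 1 / 2) *
      (Real.exp (-(1 / (18 * x)) * (y - x) ^ 2) + Real.exp (-(1 / 18 * |y - x|))) := by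
  obtain ⟨P, hP⟩ := exists_nat_ge |p - 1 / 2|
  obtain ⟨C₁, hC₁, h₁⟩ := exists_one_add_pow_mul_exp_le P (η := 1 / 18) (η' := 0) (by norm_num)
  refine ⟨2 ^ P * (C₁ * Real.exp 1), by positivity, fun x y hx => ?_⟩
  have hx0 : 0 < x := by linarith
  set u : ℂ := x + y * Complex.I with hu
  have hre : u.re = x := by simp [hu]
  have him : u.im = y := by simp [hu]
  set τ := y / x with hτ
  have hy : y = x * τ := by rw [hτ]; field_simp
  set S := √(1 + τ ^ 2) with hS
  have hS1 : 1 ≤ S := Real.one_le_sqrt.2 (by nlinarith [sq_nonneg τ])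
  have hS2 : S ≤ 1 + |τ| := by
    apply Real.sqrt_le_iff.2
    refine ⟨by positivity, ?_⟩
    have := sq_abs τ
    nlinarith [abs_nonneg τ]
  have hun : ‖u‖ = x * S := by rw [norm_eq_mul_sqrt (by rw [hre]; exact hx0), hre, him]
  have harg : u.arg = Real.arctan τ := by rw [arg_eq_arctan (by rw [hre]; exact hx0), hre, him]
  have hzn : ‖(x + x * Complex.I : ℂ)‖ = x * √2 := by
    rw [norm_eq_mul_sqrt (by simpa using hx0)]
    simp [hx0.ne']; norm_num
  have hlogS : Real.log S = 1 / 2 * Real.log (1 + τ ^ 2) := by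
    rw [hS, Real.log_sqrt (by positivity)]; ring
  have hlog2 : Real.log √2 = 1 / 2 * Real.log 2 := by
    rw [Real.log_sqrt (by norm_num)]; ring
  have hS0 : 0 < S := by linarith
  -- An exact identity: with `y = x * τ`, all powers of `x` and all factors of `√2` combine, and the
  -- remaining exponent is `-x - x * saddleDecay τ`.
  have e1 : Real.exp (stirlingExponent u) * ‖u‖ ^ p *
      (‖(x + x * Complex.I : ℂ)‖ ^ (-x) * Real.exp (Real.pi / 4 * y)) =
      Real.exp (-x) * (x ^ (p - 1 / 2) * S ^ (p - 1 / 2)) * Real.exp (-(x * saddleDecay τ)) := by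
    rw [hzn, hun, Real.rpow_def_of_pos (by positivity), Real.rpow_def_of_pos (by positivity),
      Real.rpow_def_of_pos hx0, Real.rpow_def_of_pos hS0, stirlingExponent, hre, him, harg, hun,
      Real.log_mul hx0.ne' hS0.ne', Real.log_mul hx0.ne' (by positivity), hlog2]
    simp only [← Real.exp_add]
    congr 1
    rw [saddleDecay, hlogS, hy]
    ring
  have hδ : |τ| ≤ 1 + |τ - 1| := by
    have := abs_sub_abs_le_abs_sub τ 1
    rw [abs_one] at this; linarith
  have hSP : S ^ (p - 1 / 2) ≤ 2 ^ P * (1 + |τ - 1|) ^ P := by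
    calc S ^ (p - 1 / 2) ≤ S ^ (P : ℝ) :=
          Real.rpow_le_rpow_of_exponent_le hS1 ((le_abs_self _).trans hP)
      _ = S ^ P := Real.rpow_natCast _ _
      _ ≤ (2 * (1 + |τ - 1|)) ^ P := by
          gcongr
          linarith [abs_nonneg (τ - 1)]
      _ = _ := mul_pow _ _ _
  have hD := min_sq_abs_le_saddleDecay τ
  set δ := τ - 1 with hδd
  have hmin : |δ| - 1 ≤ min (δ ^ 2) |δ| := by
    refine le_min ?_ (by linarith)
    nlinarith [sq_abs δ, abs_nonneg δ, sq_nonneg (|δ| - 1)]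
  have hmin0 : 0 ≤ min (δ ^ 2) |δ| := le_min (sq_nonneg _) (abs_nonneg _)
  have hhalf : (1 + |δ|) ^ P * Real.exp (-(1 / 18 * min (δ ^ 2) |δ|)) ≤ C₁ * Real.exp 1 := by
    have := h₁ |δ| (abs_nonneg _)
    rw [zero_mul, neg_zero, Real.exp_zero, mul_one] at this
    calc _ ≤ (1 + |δ|) ^ P * (Real.exp (-(1 / 18 * |δ|)) * Real.exp 1) := by
          rw [← Real.exp_add]
          gcongr
          linarith
      _ = (1 + |δ|) ^ P * Real.exp (-(1 / 18 * |δ|)) * Real.exp 1 := by ring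
      _ ≤ _ := by gcongr
  have hxδ : y - x = x * δ := by rw [hy, hδd]; ring
  have hother : Real.exp (-(x * (1 / 18 * min (δ ^ 2) |δ|))) ≤
      Real.exp (-(1 / (18 * x)) * (y - x) ^ 2) + Real.exp (-(1 / 18 * |y - x|)) := by
    have g1 : -(1 / (18 * x)) * (y - x) ^ 2 = -(x * (1 / 18 * δ ^ 2)) := by
      rw [hxδ]; field_simp
    have g2 : -(1 / 18 * |y - x|) = -(x * (1 / 18 * |δ|)) := by
      rw [hxδ, abs_mul, abs_of_pos hx0]; ring
    rw [g1, g2]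
    rcases min_choice (δ ^ 2) |δ| with h | h <;> rw [h] <;>
      linarith [Real.exp_pos (-(x * (1 / 18 * δ ^ 2))), Real.exp_pos (-(x * (1 / 18 * |δ|)))]
  -- The rate `1 / 9` is halved. One half, used without the factor `x ≥ 1`, absorbs the growth of `S
  -- ^ (p - 1 / 2)`; the other half keeps `x` and gives the Gaussian or the exponential in `y - x`.
  have hsplit : Real.exp (-(x * saddleDecay τ)) ≤ Real.exp (-(1 / 18 * min (δ ^ 2) |δ|)) *
      Real.exp (-(x * (1 / 18 * min (δ ^ 2) |δ|))) := by
    rw [← Real.exp_add]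
    gcongr
    nlinarith
  rw [e1]
  calc _ ≤ Real.exp (-x) * (x ^ (p - 1 / 2) * (2 ^ P * (1 + |δ|) ^ P)) *
        (Real.exp (-(1 / 18 * min (δ ^ 2) |δ|)) *
          Real.exp (-(x * (1 / 18 * min (δ ^ 2) |δ|)))) := by gcongr
    _ = 2 ^ P * ((1 + |δ|) ^ P * Real.exp (-(1 / 18 * min (δ ^ 2) |δ|))) * Real.exp (-x) *
        x ^ (p - 1 / 2) * Real.exp (-(x * (1 / 18 * min (δ ^ 2) |δ|))) := by ring
    _ ≤ 2 ^ P * (C₁ * Real.exp 1) * Real.exp (-x) * x ^ (p - 1 / 2) *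
        (Real.exp (-(1 / (18 * x)) * (y - x) ^ 2) + Real.exp (-(1 / 18 * |y - x|))) := by gcongr

/-- The integrand `Γ(u) * dualCoeff u` along the line `re u = w`. -/
def gammaDual (a b c d : ℂ) (n : ℕ) (w y : ℝ) : ℂ :=
  Complex.Gamma (w + y * Complex.I) * dualCoeff a b c d n (w + y * Complex.I)

theorem continuous_gammaDual {a b c d : ℂ} {w : ℝ} (hw0 : 0 < w)
    (hw : ‖a‖ + ‖b‖ + ‖c‖ + ‖d‖ ≤ w) (n : ℕ) : Continuous (gammaDual a b c d n w) := by
  have := continuous_Gamma_line (x := 0) (w := w) (by simpa)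
  simp only [zero_add] at this
  exact this.mul (continuous_dualCoeff_line hw n)

theorem differentiableAt_Gamma_of_re_pos {x u : ℂ} (h : 0 < (x + u).re) :
    DifferentiableAt ℂ (fun s => Complex.Gamma (x + s)) u :=
  differentiableAt_Gamma_add fun m hm => by
    have h1 := congrArg Complex.re hm
    have : (0 : ℝ) ≤ m := m.cast_nonneg
    simp at h1 h
    linarith

theorem differentiableAt_dualCoeff {a b c d u : ℂ} (hu : ‖a‖ + ‖b‖ + ‖c‖ + ‖d‖ ≤ u.re) (n : ℕ) :
    DifferentiableAt ℂ (dualCoeff a b c d n) u := by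
  have ha := norm_nonneg a
  have hb := norm_nonneg b
  have hc := norm_nonneg c
  have hd := norm_nonneg d
  have hn : (0 : ℝ) ≤ n := n.cast_nonneg
  have pa := Complex.re_le_norm a
  have pb := Complex.re_le_norm b
  have pc := Complex.re_le_norm c
  have pd := Complex.re_le_norm d
  have qa : 0 < (1 - a + u).re := by simp; linarith
  have qb : 0 < (1 - b + n + u).re := by simp; linarith
  unfold dualCoeff
  exact ((differentiableAt_Gamma_of_re_pos (by simp; linarith)).mul
    (differentiableAt_Gamma_of_re_pos (by simp; linarith))).div
    ((differentiableAt_Gamma_of_re_pos qa).mul (differentiableAt_Gamma_of_re_pos qb))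
    (mul_ne_zero (Complex.Gamma_ne_zero_of_re_pos qa) (Complex.Gamma_ne_zero_of_re_pos qb))

theorem exp_arg_mul_le {z : ℂ} {θ : ℝ} (h : |z.arg| ≤ θ) (y : ℝ) :
    Real.exp (z.arg * y) ≤ Real.exp (θ * |y|) := by
  refine Real.exp_le_exp.2 ((le_abs_self _).trans ?_)
  rw [abs_mul]
  gcongr

theorem mul_exp_arg_mul_le {D r : ℝ} {z : ℂ} (hz : |z.arg| ≤ Real.pi / 4) {y : ℝ} (hD : 0 ≤ D)
    (h : r ≤ D * Real.exp (-(3 * Real.pi / 8 * |y|))) :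
    r * Real.exp (z.arg * y) ≤ D * Real.exp (-(Real.pi / 8 * |y|)) := by
  calc _ ≤ D * Real.exp (-(3 * Real.pi / 8 * |y|)) * Real.exp (Real.pi / 4 * |y|) :=
        mul_le_mul h (exp_arg_mul_le hz y) (Real.exp_pos _).le (by positivity)
    _ = _ := by rw [mul_assoc, ← Real.exp_add]; congr 2; ring

/-- The line of integration may be moved to the right. -/
theorem exists_lineIntegral_gammaDual_eq (a b c d : ℂ) : ∃ M : ℝ, ∀ w x : ℝ, M ≤ w → w ≤ x →
    ∀ (n : ℕ) (z : ℂ), z ≠ 0 → |z.arg| ≤ Real.pi / 4 →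
      lineIntegral (gammaDual a b c d n w) w z = lineIntegral (gammaDual a b c d n x) x z := by
  obtain ⟨M, hM⟩ := exists_norm_Gamma_mul_dualCoeff_le a b c d
  refine ⟨max M (‖a‖ + ‖b‖ + ‖c‖ + ‖d‖ + 1), fun w x hw hx n z hz hθ => ?_⟩
  have ha := norm_nonneg a
  have hb := norm_nonneg b
  have hc := norm_nonneg c
  have hd := norm_nonneg d
  have hwM : M ≤ w := le_trans (le_max_left _ _) hw
  have hwn : ‖a‖ + ‖b‖ + ‖c‖ + ‖d‖ + 1 ≤ w := le_trans (le_max_right _ _) hw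
  obtain ⟨C, hC, h⟩ := hM x
  set D := C * ((n : ℝ) + 1) ^ max 0 (b - d).re with hD
  have hD0 : 0 < D := by positivity
  set f : ℂ → ℂ := fun u => Complex.Gamma u * dualCoeff a b c d n u * z ^ (-u) with hf
  have hint : ∀ v : ℝ, w ≤ v → v ≤ x → Integrable fun y : ℝ => f (v + y * Complex.I) := by
    intro v hv hv'
    refine integrable_lineIntegral (φ := gammaDual a b c d n v) (D := D) (η := Real.pi / 8)
      (continuous_gammaDual (by linarith) (by linarith) n) hz v (by positivity) fun y => ?_
    refine mul_exp_arg_mul_le hθ hD0.le ?_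
    have := h n (v + y * Complex.I) (by simp; linarith) (by simp; linarith)
    rwa [show (v + y * Complex.I : ℂ).im = y by simp] at this
  -- The set of poles is empty: without `trigRatio` the integrand is holomorphic on the whole strip.
  have key := integral_vertical_sub_eq_sum_residues hx (fun _ => 0) ∅ (by simp) f ?_ (by simp)
    (hint w le_rfl hx) (hint x hx le_rfl) ?_
  · simp only [Finset.sum_empty, mul_zero, sub_eq_zero] at key
    rw [lineIntegral, lineIntegral]
    congr 1
    exact key.symm
  · intro s hs _
    have h1 := differentiableAt_Gamma_of_re_pos (x := 0) (u := s) (by simp; linarith [hs.1])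
    simp only [zero_add] at h1
    exact (h1.mul (differentiableAt_dualCoeff (by linarith [hs.1]) n)).mul
      (differentiableAt_id.neg.const_cpow (Or.inl hz))
  · intro η hη
    set Q := ‖z‖ ^ (-w) + ‖z‖ ^ (-x) with hQ
    have hz0 : 0 < ‖z‖ := norm_pos_iff.2 hz
    have hQ0 : 0 < Q := by positivity
    have hlim : Tendsto (fun T : ℝ => D * Q * Real.exp (-(Real.pi / 8 * T))) atTop (𝓝 0) := by
      have h1 : Tendsto (fun T : ℝ => Real.pi / 8 * T) atTop atTop :=
        tendsto_id.const_mul_atTop (by positivity)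
      simpa using (Real.tendsto_exp_neg_atTop_nhds_zero.comp h1).const_mul (D * Q)
    obtain ⟨T, hT⟩ := (hlim.eventually (ge_mem_nhds hη)).exists
    refine ⟨T, fun s hs hsT => ?_⟩
    have h1 := h n s (by linarith [hs.1]) hs.2
    have h2 := norm_cpow_le hz hθ (-s)
    simp only [Complex.neg_re, Complex.neg_im, abs_neg] at h2
    have h3 : ‖z‖ ^ (-s.re) ≤ Q := by
      have p1 : 0 < ‖z‖ ^ (-w) := by positivity
      have p2 : 0 < ‖z‖ ^ (-x) := by positivity
      rcases le_total 1 ‖z‖ with h1 | h1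
      · have := Real.rpow_le_rpow_of_exponent_le h1 (by linarith [hs.1] : -s.re ≤ -w)
        linarith
      · have := Real.rpow_le_rpow_of_exponent_ge hz0 h1 (by linarith [hs.2] : -x ≤ -s.re)
        linarith
    refine le_trans ?_ hT
    rw [hf, norm_mul]
    calc _ ≤ D * Real.exp (-(3 * Real.pi / 8 * |s.im|)) *
          (Q * Real.exp (Real.pi / 4 * |s.im|)) := by
          gcongr
          exact h2.trans (by gcongr)
      _ = D * Q * Real.exp (-(Real.pi / 8 * |s.im|)) := by
          rw [mul_mul_mul_comm, ← Real.exp_add]; congr 2; ring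
      _ ≤ _ := by gcongr

/-- The Gaussian has width of order `√x`. This factor `x ^ (1 / 2)` compensates the `x ^ (-1 / 2)`
of Stirling's formula, so no power of `x` is lost in the final bound. -/
theorem integral_gaussian_add_exp_le : ∃ J : ℝ, 0 < J ∧ ∀ x : ℝ, 1 ≤ x →
    Integrable (fun y : ℝ => Real.exp (-(1 / (18 * x)) * (y - x) ^ 2) +
      Real.exp (-(1 / 18 * |y - x|))) ∧
    ∫ y : ℝ, (Real.exp (-(1 / (18 * x)) * (y - x) ^ 2) + Real.exp (-(1 / 18 * |y - x|))) ≤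
      J * x ^ (1 / 2 : ℝ) := by
  set J := ∫ y : ℝ, Real.exp (-(1 / 18 * |y|)) with hJ
  have hJ0 : 0 ≤ J := integral_nonneg fun y => (Real.exp_pos _).le
  refine ⟨√(Real.pi * 18) + J, by positivity, fun x hx => ?_⟩
  have i1 := (integrable_exp_neg_mul_sq (b := 1 / (18 * x)) (by positivity)).comp_sub_right x
  have i2 := (integrable_exp_neg_mul_abs (η := 1 / 18) (by norm_num)).comp_sub_right x
  refine ⟨i1.add i2, ?_⟩
  rw [integral_add i1 i2, integral_sub_right_eq_self (fun y => Real.exp (-(1 / (18 * x)) * y ^ 2)),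
    integral_sub_right_eq_self (fun y => Real.exp (-(1 / 18 * |y|))), integral_gaussian, ← hJ,
    ← Real.sqrt_eq_rpow]
  have hs : 1 ≤ √x := Real.one_le_sqrt.2 hx
  rw [show Real.pi / (1 / (18 * x)) = Real.pi * 18 * x by field_simp,
    Real.sqrt_mul (by positivity)]
  nlinarith

theorem arg_add_mul_I {x : ℝ} (hx : 0 < x) : (x + x * Complex.I : ℂ).arg = Real.pi / 4 := by
  rw [arg_eq_arctan (by simpa using hx)]
  simp [hx.ne']

/-- Saddle point estimate on the ray `arg z = π / 4`. -/
theorem exists_norm_lineIntegral_gammaDual_le (a b c d : ℂ) : ∃ M : ℝ, ∃ C : ℝ, 0 < C ∧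
    ∀ (n : ℕ) (x : ℝ), M ≤ x →
      ‖lineIntegral (gammaDual a b c d n x) x (x + x * Complex.I)‖ ≤
        C * (((n : ℝ) + 1) ^ max 0 (b - d).re * (x ^ (a + b - c - d).re * Real.exp (-x))) := by
  obtain ⟨C₁, hC₁, h₁⟩ := exists_norm_Gamma_stirling
  obtain ⟨C₂, M, hC₂, h₂⟩ := exists_norm_dualCoeff_le a b c d
  obtain ⟨C₃, hC₃, h₃⟩ := exists_saddle_integrand_le (a + b - c - d).re
  obtain ⟨J, hJ, hJint⟩ := integral_gaussian_add_exp_le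
  refine ⟨max M 2, C₁ * C₂ * C₃ * J, by positivity, fun n x hx => ?_⟩
  have hx2 : 2 ≤ x := le_trans (le_max_right _ _) hx
  have hxM : M ≤ x := le_trans (le_max_left _ _) hx
  have hx0 : 0 < x := by linarith
  set p := (a + b - c - d).re with hp
  set z : ℂ := x + x * Complex.I with hz
  have hz0 : z ≠ 0 := fun h => by
    have := congrArg Complex.re h
    simp [hz] at this; linarith
  obtain ⟨i1, i2⟩ := hJint x (by linarith)
  set E := ((n : ℝ) + 1) ^ max 0 (b - d).re with hE
  have hb : ∀ y : ℝ, ‖gammaDual a b c d n x y * z ^ (-(x + y * Complex.I : ℂ))‖ ≤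
      (C₁ * C₂ * C₃ * E * (Real.exp (-x) * x ^ (p - 1 / 2))) *
        (Real.exp (-(1 / (18 * x)) * (y - x) ^ 2) + Real.exp (-(1 / 18 * |y - x|))) := by
    intro y
    have s1 := (h₁ (x + y * Complex.I) (by simpa using hx2)).1
    have s2 := h₂ n (x + y * Complex.I) (by simpa using hxM)
    have s3 := h₃ x y (by linarith)
    rw [norm_mul, gammaDual, norm_mul, norm_cpow_neg_line hz0, hz, arg_add_mul_I hx0]
    calc _ ≤ (C₁ * Real.exp (stirlingExponent (x + y * Complex.I))) *
          (C₂ * (E * ‖(x + y * Complex.I : ℂ)‖ ^ p)) *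
          (‖(x + x * Complex.I : ℂ)‖ ^ (-x) * Real.exp (Real.pi / 4 * y)) := by gcongr
      _ = C₁ * C₂ * E * (Real.exp (stirlingExponent (x + y * Complex.I)) *
          ‖(x + y * Complex.I : ℂ)‖ ^ p *
          (‖(x + x * Complex.I : ℂ)‖ ^ (-x) * Real.exp (Real.pi / 4 * y))) := by ring
      _ ≤ C₁ * C₂ * E * (C₃ * Real.exp (-x) * x ^ (p - 1 / 2) *
          (Real.exp (-(1 / (18 * x)) * (y - x) ^ 2) + Real.exp (-(1 / 18 * |y - x|)))) := by
          gcongr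
      _ = _ := by ring
  have h4 := norm_integral_le_of_norm_le (i1.const_mul _) (Eventually.of_forall hb)
  rw [integral_const_mul] at h4
  have h5 : ‖(2 * Real.pi : ℂ)⁻¹‖ ≤ 1 := by
    rw [norm_inv, norm_mul, Complex.norm_real, Real.norm_of_nonneg Real.pi_pos.le]
    refine inv_le_one_of_one_le₀ ?_
    simp; linarith [Real.pi_gt_three]
  have h6 : x ^ (p - 1 / 2) * x ^ (1 / 2 : ℝ) = x ^ p := by
    rw [← Real.rpow_add hx0]; congr 1; ring
  rw [lineIntegral, norm_mul]
  calc _ ≤ 1 * ‖∫ y : ℝ, gammaDual a b c d n x y * z ^ (-(x + y * Complex.I : ℂ))‖ := by gcongr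
    _ ≤ 1 * ((C₁ * C₂ * C₃ * E * (Real.exp (-x) * x ^ (p - 1 / 2))) * (J * x ^ (1 / 2 : ℝ))) := by
        refine mul_le_mul_of_nonneg_left (h4.trans ?_) zero_le_one
        gcongr
    _ = C₁ * C₂ * C₃ * J * (E * (x ^ (p - 1 / 2) * x ^ (1 / 2 : ℝ) * Real.exp (-x))) := by ring
    _ = _ := by rw [h6]

/-! ### Splitting the remainder into an algebraic and an exponentially small part -/

/-- The part of the remainder integral which is bounded by `‖z‖ ^ (-w)` in the whole upper half
plane. -/
def algRemainder (a b c d : ℂ) (w : ℝ) (n : ℕ) : ℂ → ℂ :=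
  lineIntegral (fun y => gammaDual a b c d n w y *
    (trigRatio a b c d (w + y * Complex.I) - trigLimit a b c d)) w

/-- For `y ≥ 0` the growth of `z ^ (-u)` is at most `exp (π * y)`, which the error `exp (-2π * y)`
of `trigRatio` defeats; for `y ≤ 0` there is no growth. The decay of Gamma is therefore untouched up
to and including `arg z = π`. -/
theorem min_one_exp_mul_exp_le {θ : ℝ} (hθ : θ ∈ Set.Icc 0 Real.pi) (y : ℝ) :
    min 1 (Real.exp (-(2 * Real.pi * y))) * Real.exp (θ * y) ≤ 1 := by
  rcases le_total y 0 with hy | hy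
  · calc _ ≤ 1 * 1 := mul_le_mul (min_le_left _ _)
          (Real.exp_le_one_iff.2 (mul_nonpos_of_nonneg_of_nonpos hθ.1 hy)) (Real.exp_pos _).le
          zero_le_one
      _ = 1 := one_mul 1
  · calc _ ≤ Real.exp (-(2 * Real.pi * y)) * Real.exp (θ * y) := by
          gcongr
          exact min_le_right _ _
      _ ≤ 1 := by
          rw [← Real.exp_add, Real.exp_le_one_iff]
          nlinarith [hθ.2, Real.pi_pos]

theorem exists_algRemainder_integrand_le (a b c d : ℂ) : ∃ M : ℝ, ∀ w : ℝ, M ≤ w →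
    (∀ m : ℤ, w - a.re ≠ m) → (∀ m : ℤ, w - b.re ≠ m) → ∃ C : ℝ, 0 < C ∧
      ∀ n : ℕ, ∀ θ ∈ Set.Icc 0 Real.pi, ∀ y : ℝ,
        ‖gammaDual a b c d n w y *
          (trigRatio a b c d (w + y * Complex.I) - trigLimit a b c d)‖ * Real.exp (θ * y) ≤
        C * ((n : ℝ) + 1) ^ max 0 (b - d).re * Real.exp (-(3 * Real.pi / 8 * |y|)) := by
  obtain ⟨M, hM⟩ := exists_norm_Gamma_mul_dualCoeff_le a b c d
  refine ⟨M, fun w hw ha hb => ?_⟩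
  obtain ⟨C, hC, h⟩ := hM w
  obtain ⟨C', hC', h'⟩ := exists_norm_trigRatio_sub_le c d ha hb
  refine ⟨C * C', by positivity, fun n θ hθ y => ?_⟩
  have h1 := h n (w + y * Complex.I) (by simpa) (by simp)
  have h2 := h' (w + y * Complex.I) (by simp)
  have e : (w + y * Complex.I : ℂ).im = y := by simp
  rw [e] at h1 h2
  have h3 := min_one_exp_mul_exp_le hθ y
  rw [norm_mul, gammaDual]
  calc _ ≤ (C * ((n : ℝ) + 1) ^ max 0 (b - d).re * Real.exp (-(3 * Real.pi / 8 * |y|))) *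
        (C' * min 1 (Real.exp (-(2 * Real.pi * y)))) * Real.exp (θ * y) := by gcongr
    _ = C * C' * ((n : ℝ) + 1) ^ max 0 (b - d).re * Real.exp (-(3 * Real.pi / 8 * |y|)) *
        (min 1 (Real.exp (-(2 * Real.pi * y))) * Real.exp (θ * y)) := by ring
    _ ≤ _ := mul_le_of_le_one_right (by positivity) h3

theorem exists_algRemainder (a b c d : ℂ) : ∃ M : ℝ, ∀ w : ℝ, M ≤ w →
    (∀ m : ℤ, w - a.re ≠ m) → (∀ m : ℤ, w - b.re ≠ m) →
    (∃ C : ℝ, 0 < C ∧ ∀ (n : ℕ) (z : ℂ), z ≠ 0 → 0 ≤ z.im →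
      ‖algRemainder a b c d w n z‖ ≤ C * (((n : ℝ) + 1) ^ max 0 (b - d).re * ‖z‖ ^ (-w))) ∧
    ∀ (n : ℕ) (z : ℂ), 0 < z.im → DifferentiableAt ℂ (algRemainder a b c d w n) z := by
  obtain ⟨M, hM⟩ := exists_algRemainder_integrand_le a b c d
  refine ⟨max M (‖a‖ + ‖b‖ + ‖c‖ + ‖d‖ + 1), fun w hw ha hb => ?_⟩
  obtain ⟨C, hC, h⟩ := hM w (le_trans (le_max_left _ _) hw) ha hb
  have hw' : ‖a‖ + ‖b‖ + ‖c‖ + ‖d‖ + 1 ≤ w := le_trans (le_max_right _ _) hw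
  have hpi := Real.pi_pos
  refine ⟨⟨((∫ y : ℝ, Real.exp (-(3 * Real.pi / 8 * |y|))) + 1) * C, ?_, fun n z hz hi => ?_⟩,
    fun n z hz => ?_⟩
  · have : 0 ≤ ∫ y : ℝ, Real.exp (-(3 * Real.pi / 8 * |y|)) :=
      integral_nonneg fun y => (Real.exp_pos _).le
    positivity
  · have := norm_lineIntegral_le hz w (η := 3 * Real.pi / 8) (by positivity) fun y =>
      h n z.arg ⟨Complex.arg_nonneg_iff.2 hi, Complex.arg_le_pi _⟩ y
    refine this.trans ?_
    rw [add_mul, add_mul, one_mul]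
    refine le_add_of_le_of_nonneg (le_of_eq (by ring)) (by positivity)
  · have pa := norm_nonneg a
    have pb := norm_nonneg b
    have pc := norm_nonneg c
    have pd := norm_nonneg d
    exact differentiableAt_lineIntegral ((continuous_gammaDual (by linarith) (by linarith) n).mul
      ((continuous_trigRatio_line c d ha hb).sub continuous_const)) w
      (η := 3 * Real.pi / 8) (by positivity) (h n) hz

/-- On the ray `arg z = π / 4` the remainder is the sum of `algRemainder` and an exponentially
small term. -/
theorem exists_norm_hypRemainder_sub_algRemainder_le {a b c d : ℂ} (ha : ∀ m : ℕ, a ≠ -m)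
    (hc : ∀ m : ℕ, c ≠ -m) (hd : ∀ m : ℤ, d ≠ m) (hab : ∀ m : ℤ, a - b ≠ m) :
    ∃ M : ℝ, ∀ w : ℝ, M ≤ w → (∀ m : ℤ, w - a.re ≠ m) → (∀ m : ℤ, w - b.re ≠ m) →
    ∃ x₀ C : ℝ, 0 < C ∧ ∀ n : ℕ, (∀ m : ℕ, b - n ≠ -m) → ∀ x : ℝ, x₀ ≤ x →
      ‖hypRemainder a b c d w n (x + x * Complex.I) -
        algRemainder a b c d w n (x + x * Complex.I)‖ ≤
        C * (((n : ℝ) + 1) ^ max 0 (b - d).re * (x ^ (a + b - c - d).re * Real.exp (-x))) := by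
  obtain ⟨M₁, h₁⟩ := exists_norm_Gamma_mul_dualCoeff_le a b c d
  obtain ⟨M₂, h₂⟩ := exists_algRemainder_integrand_le a b c d
  obtain ⟨M₃, h₃⟩ := exists_lineIntegral_gammaDual_eq a b c d
  obtain ⟨M₄, C₄, hC₄, h₄⟩ := exists_norm_lineIntegral_gammaDual_le a b c d
  refine ⟨max (max M₁ M₂) (max M₃ (‖a‖ + ‖b‖ + ‖c‖ + ‖d‖ + 1)), fun w hw hwa hwb => ?_⟩
  simp only [max_le_iff] at hw
  obtain ⟨⟨hw1, hw2⟩, hw3, hw4⟩ := hw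
  have pa := norm_nonneg a
  have pb := norm_nonneg b
  have pc := norm_nonneg c
  have pd := norm_nonneg d
  obtain ⟨C₁, hC₁, h₁⟩ := h₁ w
  obtain ⟨C₂, hC₂, h₂⟩ := h₂ w hw2 hwa hwb
  refine ⟨max w M₄, ‖trigLimit a b c d‖ * C₄ + 1, by positivity, fun n hb x hx => ?_⟩
  simp only [max_le_iff] at hx
  have hx0 : 0 < x := by linarith
  set z : ℂ := x + x * Complex.I with hz
  have hz0 : z ≠ 0 := fun h => by
    have := congrArg Complex.re h
    simp [hz] at this; linarith
  have harg : z.arg = Real.pi / 4 := arg_add_mul_I hx0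
  have habs : |z.arg| ≤ Real.pi / 4 := by rw [harg, abs_of_pos (by positivity)]
  have hlt : |z.arg| < Real.pi / 2 := habs.trans_lt (by linarith [Real.pi_pos])
  have hφ := continuous_gammaDual (a := a) (b := b) (c := c) (d := d) (w := w) (by linarith)
    (by linarith) n
  have i1 : Integrable fun y : ℝ => (gammaDual a b c d n w y *
      (trigRatio a b c d (w + y * Complex.I) - trigLimit a b c d)) *
      z ^ (-(w + y * Complex.I : ℂ)) :=
    integrable_lineIntegral (hφ.mul ((continuous_trigRatio_line c d hwa hwb).sub continuous_const))
      hz0 w (η := 3 * Real.pi / 8) (by positivity) fun y =>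
        h₂ n z.arg ⟨by rw [harg]; positivity, Complex.arg_le_pi _⟩ y
  have i2 : Integrable fun y : ℝ => gammaDual a b c d n w y * z ^ (-(w + y * Complex.I : ℂ)) := by
    refine integrable_lineIntegral (D := C₁ * ((n : ℝ) + 1) ^ max 0 (b - d).re) hφ hz0 w
      (η := Real.pi / 8) (by positivity) fun y => ?_
    refine mul_exp_arg_mul_le habs (by positivity) ?_
    have := h₁ n (w + y * Complex.I) (by simpa) (by simp)
    rwa [show (w + y * Complex.I : ℂ).im = y by simp] at this
  have e : hypRemainder a b c d w n z - algRemainder a b c d w n z =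
      trigLimit a b c d * lineIntegral (gammaDual a b c d n w) w z := by
    have hsum := lineIntegral_add i1 i2 (trigLimit a b c d)
    rw [hypRemainder_eq_lineIntegral n hz0 hlt ha hb hc hd hab (by linarith) (by linarith) hwa hwb,
      sub_eq_iff_eq_add', algRemainder, ← hsum]
    congr 1
    funext y
    rw [gammaDual]; ring
  -- The contour is moved from `Re u = w` to `Re u = Re z`, the abscissa of the saddle.
  rw [e, norm_mul, h₃ w x hw3 hx.1 n z hz0 habs]
  refine (mul_le_mul_of_nonneg_left (h₄ n x hx.2) (norm_nonneg _)).trans ?_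
  rw [← mul_assoc]
  gcongr
  linarith

/-- For these directions the full integrand still decays at rate `π / 8`, with `trigRatio` merely
bounded, so no splitting is needed. -/
theorem exists_norm_hypRemainder_sector_le {a b c d : ℂ} (ha : ∀ m : ℕ, a ≠ -m)
    (hc : ∀ m : ℕ, c ≠ -m) (hd : ∀ m : ℤ, d ≠ m) (hab : ∀ m : ℤ, a - b ≠ m) :
    ∃ M : ℝ, ∀ w : ℝ, M ≤ w → (∀ m : ℤ, w - a.re ≠ m) → (∀ m : ℤ, w - b.re ≠ m) →
    ∃ C : ℝ, 0 < C ∧ ∀ n : ℕ, (∀ m : ℕ, b - n ≠ -m) → ∀ z : ℂ, z ≠ 0 → |z.arg| ≤ Real.pi / 4 →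
      ‖hypRemainder a b c d w n z‖ ≤ C * (((n : ℝ) + 1) ^ max 0 (b - d).re * ‖z‖ ^ (-w)) := by
  obtain ⟨M₁, h₁⟩ := exists_norm_Gamma_mul_dualCoeff_le a b c d
  refine ⟨max M₁ (‖a‖ + ‖b‖ + ‖c‖ + ‖d‖ + 1), fun w hw hwa hwb => ?_⟩
  simp only [max_le_iff] at hw
  have pa := norm_nonneg a
  have pb := norm_nonneg b
  have pc := norm_nonneg c
  have pd := norm_nonneg d
  obtain ⟨C₁, hC₁, h₁⟩ := h₁ w
  obtain ⟨C₂, hC₂, h₂⟩ := exists_norm_trigRatio_sub_le c d hwa hwb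
  set J := ∫ y : ℝ, Real.exp (-(Real.pi / 8 * |y|)) with hJ
  have hJ0 : 0 ≤ J := integral_nonneg fun y => (Real.exp_pos _).le
  set K := ‖trigLimit a b c d‖ with hK
  have hK0 : 0 ≤ K := norm_nonneg _
  refine ⟨(J + 1) * (C₁ * (C₂ + K)), by positivity, fun n hb z hz hθ => ?_⟩
  have hpi := Real.pi_pos
  set E := ((n : ℝ) + 1) ^ max 0 (b - d).re with hE
  rw [hypRemainder_eq_lineIntegral n hz (hθ.trans_lt (by linarith)) ha hb hc hd hab (by linarith)
    hw.2 hwa hwb]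
  refine (norm_lineIntegral_le hz w (η := Real.pi / 8) (D := (C₁ * (C₂ + K)) * E) (by positivity)
    fun y => ?_).trans ?_
  · refine mul_exp_arg_mul_le hθ (by positivity) ?_
    have h3 : ‖trigRatio a b c d (w + y * Complex.I)‖ ≤ C₂ + K := by
      have h4 := h₂ (w + y * Complex.I) (by simp)
      have h5 := norm_le_norm_add_norm_sub (trigLimit a b c d) (trigRatio a b c d (w + y * Complex.I))
      rw [norm_sub_rev] at h5
      have h6 : C₂ * min 1 (Real.exp (-(2 * Real.pi * (w + y * Complex.I : ℂ).im))) ≤ C₂ :=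
        mul_le_of_le_one_right hC₂.le (min_le_left _ _)
      linarith
    have h7 := h₁ n (w + y * Complex.I) (by simpa using hw.1) (by simp)
    have e : (w + y * Complex.I : ℂ).im = y := by simp
    rw [e] at h7
    rw [norm_mul]
    calc _ ≤ C₁ * E * Real.exp (-(3 * Real.pi / 8 * |y|)) * (C₂ + K) := by gcongr
      _ = _ := by ring
  · rw [add_mul, add_mul, one_mul]
    exact le_add_of_le_of_nonneg (le_of_eq (by ring)) (by positivity)

/-! ### A crude bound in all directions -/

theorem rpow_le_rpow_abs_mul_rpow {x y t : ℝ} (hx : 0 < x) (hy : 0 < y) (ht : 0 < t)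
    (h₁ : x ≤ t * y) (h₂ : y ≤ t * x) (p : ℝ) : x ^ p ≤ t ^ |p| * y ^ p := by
  rcases le_total 0 p with hp | hp
  · rw [abs_of_nonneg hp, ← Real.mul_rpow ht.le hy.le]
    exact Real.rpow_le_rpow hx.le h₁ hp
  · rw [abs_of_nonpos hp, Real.rpow_neg ht.le, ← Real.inv_rpow ht.le,
      ← Real.mul_rpow (by positivity) hy.le]
    refine Real.rpow_le_rpow_of_nonpos (by positivity) ?_ hp
    rw [inv_mul_le_iff₀ ht]
    exact h₂

theorem rpow_le_pow_add_inv_pow {r : ℝ} (hr : 0 < r) {μ : ℝ} {M : ℕ} (hM : |μ| ≤ M) :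
    r ^ μ ≤ r ^ M + (r ^ M)⁻¹ := by
  have h := abs_le.1 hM
  have hp : 0 < r ^ M := by positivity
  have hp' : 0 < (r ^ M)⁻¹ := by positivity
  rcases le_total 1 r with h1 | h1
  · have := Real.rpow_le_rpow_of_exponent_le h1 h.2
    rw [Real.rpow_natCast] at this
    linarith
  · have := Real.rpow_le_rpow_of_exponent_ge hr h1 h.1
    rw [Real.rpow_neg hr.le, Real.rpow_natCast] at this
    linarith

/-- From `((k + 1) / x) ^ M ≤ M! * exp ((k + 1) / x)` the series is dominated by an exponential
series at `q = x * exp (1 / x)`, and `q ≤ x + 2`. -/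
theorem summable_pow_mul_pow_div_factorial (M : ℕ) {x : ℝ} (hx : 1 ≤ x) :
    Summable (fun k : ℕ => ((k : ℝ) + 1) ^ M * (x ^ k / k.factorial)) ∧
    ∑' k : ℕ, ((k : ℝ) + 1) ^ M * (x ^ k / k.factorial) ≤
      M.factorial * Real.exp 3 * (x ^ M * Real.exp x) := by
  have hx0 : 0 < x := by linarith
  set q := x * Real.exp x⁻¹ with hq
  have hq2 : q ≤ x + 2 := by
    have h1 : x⁻¹ ≤ 1 := inv_le_one_of_one_le₀ hx
    have h0 : 0 < x⁻¹ := by positivity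
    have h2 := (abs_le.1 (Real.abs_exp_sub_one_sub_id_le (x := x⁻¹) (by rw [abs_of_pos h0]; exact h1))).2
    have h3 : x * x⁻¹ = 1 := mul_inv_cancel₀ hx0.ne'
    have h4 : q ≤ x * (1 + x⁻¹ + x⁻¹ ^ 2) := mul_le_mul_of_nonneg_left (by linarith) hx0.le
    have h5 : x * (1 + x⁻¹ + x⁻¹ ^ 2) = x + 1 + x⁻¹ := by field_simp
    linarith
  have hs : HasSum (fun k : ℕ => M.factorial * x ^ M * Real.exp x⁻¹ * (q ^ k / k.factorial))
      (M.factorial * x ^ M * Real.exp x⁻¹ * Real.exp q) := by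
    have := (NormedSpace.expSeries_div_hasSum_exp q).mul_left
      (M.factorial * x ^ M * Real.exp x⁻¹)
    rwa [← Real.exp_eq_exp_ℝ] at this
  have hle : ∀ k : ℕ, ((k : ℝ) + 1) ^ M * (x ^ k / k.factorial) ≤
      M.factorial * x ^ M * Real.exp x⁻¹ * (q ^ k / k.factorial) := by
    intro k
    have h1 := Real.pow_div_factorial_le_exp ((k + 1) * x⁻¹) (by positivity) M
    rw [div_le_iff₀ (by positivity), mul_pow, inv_pow, mul_inv_le_iff₀ (by positivity)] at h1
    have h2 : Real.exp ((k + 1) * x⁻¹) = Real.exp x⁻¹ ^ k * Real.exp x⁻¹ := by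
      rw [← Real.exp_nat_mul, ← Real.exp_add]; congr 1; ring
    rw [h2] at h1
    calc _ ≤ Real.exp x⁻¹ ^ k * Real.exp x⁻¹ * M.factorial * x ^ M * (x ^ k / k.factorial) := by
          gcongr
      _ = _ := by rw [hq, mul_pow]; ring
  have hsum : Summable (fun k : ℕ => ((k : ℝ) + 1) ^ M * (x ^ k / k.factorial)) :=
    Summable.of_nonneg_of_le (fun k => by positivity) hle hs.summable
  refine ⟨hsum, ((hsum.tsum_le_tsum hle hs.summable).trans_eq hs.tsum_eq).trans ?_⟩
  have h1 : Real.exp x⁻¹ * Real.exp q ≤ Real.exp 3 * Real.exp x := by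
    rw [← Real.exp_add, ← Real.exp_add]
    refine Real.exp_le_exp.2 ?_
    have : x⁻¹ ≤ 1 := inv_le_one_of_one_le₀ hx
    linarith
  calc _ = M.factorial * x ^ M * (Real.exp x⁻¹ * Real.exp q) := by ring
    _ ≤ M.factorial * x ^ M * (Real.exp 3 * Real.exp x) := by gcongr
    _ = _ := by ring

theorem factorial_add_le (k M : ℕ) : (k + M).factorial ≤ k.factorial * ((k + 1) ^ M * M.factorial) := by
  induction M with
  | zero => simp
  | succ M ih =>
    rw [← add_assoc, Nat.factorial_succ, Nat.factorial_succ, pow_succ]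
    calc _ ≤ ((k + 1) * (M + 1)) * (k.factorial * ((k + 1) ^ M * M.factorial)) :=
          Nat.mul_le_mul (by nlinarith) ih
      _ = _ := by ring

/-- Since `(k + M)! ≤ k! * (k + 1) ^ M * M!`, the series is dominated by the exponential series with
its index shifted by `M`. -/
theorem summable_inv_pow_mul_pow_div_factorial (M : ℕ) {x : ℝ} (hx : 1 ≤ x) :
    Summable (fun k : ℕ => (((k : ℝ) + 1) ^ M)⁻¹ * (x ^ k / k.factorial)) ∧
    ∑' k : ℕ, (((k : ℝ) + 1) ^ M)⁻¹ * (x ^ k / k.factorial) ≤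
      M.factorial * ((x ^ M)⁻¹ * Real.exp x) := by
  have hx0 : 0 < x := by linarith
  have hs : HasSum (fun k : ℕ => x ^ k / k.factorial) (Real.exp x) := by
    have := NormedSpace.expSeries_div_hasSum_exp x
    rwa [← Real.exp_eq_exp_ℝ] at this
  have hs2 : Summable fun k : ℕ => x ^ (k + M) / (k + M).factorial :=
    (summable_nat_add_iff M).2 hs.summable
  have h2 : ∑' k : ℕ, x ^ (k + M) / ((k + M).factorial : ℝ) ≤ Real.exp x := by
    rw [← hs.tsum_eq, ← hs.summable.sum_add_tsum_nat_add M]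
    exact le_add_of_nonneg_left (Finset.sum_nonneg fun k _ => by positivity)
  have hle : ∀ k : ℕ, (((k : ℝ) + 1) ^ M)⁻¹ * (x ^ k / k.factorial) ≤
      M.factorial * (x ^ M)⁻¹ * (x ^ (k + M) / (k + M).factorial) := by
    intro k
    have h := factorial_add_le k M
    have h' : ((k + M).factorial : ℝ) ≤ k.factorial * ((k + 1) ^ M * M.factorial) := by
      exact_mod_cast h
    have e1 : (((k : ℝ) + 1) ^ M)⁻¹ * (x ^ k / k.factorial) =
        M.factorial * x ^ k * (1 / (k.factorial * ((k + 1) ^ M * M.factorial))) := by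
      field_simp
    have e2 : (M.factorial : ℝ) * (x ^ M)⁻¹ * (x ^ (k + M) / (k + M).factorial) =
        M.factorial * x ^ k * (1 / (k + M).factorial) := by
      rw [pow_add]; field_simp
    rw [e1, e2]
    gcongr
  have hsum := Summable.of_nonneg_of_le (fun k => by positivity) hle (hs2.mul_left _)
  refine ⟨hsum, (hsum.tsum_le_tsum hle (hs2.mul_left _)).trans ?_⟩
  rw [tsum_mul_left, ← mul_assoc]
  gcongr

/-- The weights `x ^ k / k!` concentrate near `k = x`. To make this quantitative, `((k + 1) / x) ^
μ` is bounded by an integral power plus its inverse, which reduces to the two preceding series. -/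
theorem exists_tsum_rpow_mul_pow_div_factorial_le (μ : ℝ) : ∃ C : ℝ, 0 < C ∧ ∀ x : ℝ, 1 ≤ x →
    Summable (fun k : ℕ => ((k : ℝ) + 1) ^ μ * (x ^ k / k.factorial)) ∧
    ∑' k : ℕ, ((k : ℝ) + 1) ^ μ * (x ^ k / k.factorial) ≤ C * (x ^ μ * Real.exp x) := by
  obtain ⟨M, hM⟩ := exists_nat_ge |μ|
  refine ⟨M.factorial * Real.exp 3 + M.factorial, by positivity, fun x hx => ?_⟩
  have hx0 : 0 < x := by linarith
  obtain ⟨s1, b1⟩ := summable_pow_mul_pow_div_factorial M hx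
  obtain ⟨s2, b2⟩ := summable_inv_pow_mul_pow_div_factorial M hx
  have hle : ∀ k : ℕ, ((k : ℝ) + 1) ^ μ * (x ^ k / k.factorial) ≤
      x ^ μ * (x ^ M)⁻¹ * (((k : ℝ) + 1) ^ M * (x ^ k / k.factorial)) +
      x ^ μ * x ^ M * ((((k : ℝ) + 1) ^ M)⁻¹ * (x ^ k / k.factorial)) := by
    intro k
    have h := rpow_le_pow_add_inv_pow (r := (k + 1) / x) (by positivity) hM
    rw [Real.div_rpow (by positivity) hx0.le, div_le_iff₀ (by positivity), div_pow, inv_div] at h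
    calc _ ≤ ((((k : ℝ) + 1) ^ M / x ^ M + x ^ M / (k + 1) ^ M) * x ^ μ) *
          (x ^ k / k.factorial) := by gcongr
      _ = _ := by ring
  have s := (s1.mul_left (x ^ μ * (x ^ M)⁻¹)).add (s2.mul_left (x ^ μ * x ^ M))
  have hsum := Summable.of_nonneg_of_le (fun k => by positivity) hle s
  refine ⟨hsum, (hsum.tsum_le_tsum hle s).trans ?_⟩
  rw [(s1.mul_left _).tsum_add (s2.mul_left _), tsum_mul_left, tsum_mul_left]
  calc _ ≤ x ^ μ * (x ^ M)⁻¹ * (M.factorial * Real.exp 3 * (x ^ M * Real.exp x)) +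
        x ^ μ * x ^ M * (M.factorial * ((x ^ M)⁻¹ * Real.exp x)) := by gcongr
    _ = _ := by field_simp

theorem exists_rpow_le_exp (q : ℝ) : ∃ C : ℝ, 0 < C ∧ ∀ x : ℝ, 1 ≤ x → x ^ q ≤ C * Real.exp x := by
  obtain ⟨M, hM⟩ := exists_nat_ge q
  refine ⟨M.factorial, by positivity, fun x hx => ?_⟩
  have h1 := Real.rpow_le_rpow_of_exponent_le hx hM
  have h2 := Real.pow_div_factorial_le_exp x (by linarith) M
  rw [div_le_iff₀ (by positivity)] at h2
  rw [Real.rpow_natCast] at h1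
  linarith

theorem norm_cpow_le_exp_pi {z : ℂ} (hz : z ≠ 0) (s : ℂ) :
    ‖z ^ s‖ ≤ ‖z‖ ^ s.re * Real.exp (Real.pi * |s.im|) :=
  norm_cpow_le hz (Complex.abs_arg_le_pi z) s

/-- The terms of `algSumS`. -/
def algTermS (a b c d : ℂ) (n k : ℕ) (z : ℂ) : ℂ :=
  Complex.Gamma (a + k) * Complex.Gamma (b - a - n - k) /
    (Complex.Gamma (c - a - k) * Complex.Gamma (d - a - n - k)) *
    ((-1) ^ k / (k.factorial : ℂ)) * z ^ (-a - (k : ℂ))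

/-- The terms of `algSumT`. -/
def algTermT (a b c d : ℂ) (n k : ℕ) (z : ℂ) : ℂ :=
  Complex.Gamma (b - n + k) * Complex.Gamma (a - b + n - k) /
    (Complex.Gamma (d - b - k) * Complex.Gamma (c - b + n - k)) *
    ((-1) ^ k / (k.factorial : ℂ)) * z ^ ((n : ℂ) - b - (k : ℂ))

theorem exists_norm_algTermS_le (a b c d : ℂ) (k : ℕ) : ∃ C : ℝ, 0 < C ∧ ∀ (n : ℕ) (z : ℂ),
    z ≠ 0 → ‖algTermS a b c d n k z‖ ≤ C * (((n : ℝ) + 1) ^ (b - d).re * ‖z‖ ^ (-a.re - k)) := by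
  obtain ⟨C, hC, h⟩ := exists_norm_Gamma_sub_nat_div_le (b - a - k) (d - a - k)
  set K := ‖Complex.Gamma (a + k) / Complex.Gamma (c - a - k) * ((-1) ^ k / (k.factorial : ℂ))‖ with hK
  refine ⟨(K + 1) * C * Real.exp (Real.pi * |a.im|), by positivity, fun n z hz => ?_⟩
  have h1 := h n
  have h2 := norm_cpow_le_exp_pi hz (-a - k)
  simp only [Complex.sub_re, Complex.neg_re, Complex.natCast_re, Complex.sub_im, Complex.neg_im,
    Complex.natCast_im, sub_zero, abs_neg] at h2
  rw [show b - a - k - (d - a - k) = b - d by ring] at h1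
  have e : algTermS a b c d n k z =
      (Complex.Gamma (a + k) / Complex.Gamma (c - a - k) * ((-1) ^ k / (k.factorial : ℂ))) *
      (Complex.Gamma (b - a - k - n) / Complex.Gamma (d - a - k - n)) * z ^ (-a - (k : ℂ)) := by
    rw [algTermS, show b - a - (n : ℂ) - k = b - a - k - n by ring,
      show d - a - (n : ℂ) - k = d - a - k - n by ring]
    ring
  rw [e, norm_mul, norm_mul, ← hK]
  calc _ ≤ (K + 1) * (C * ((n : ℝ) + 1) ^ (b - d).re) *
        (‖z‖ ^ (-a.re - k) * Real.exp (Real.pi * |a.im|)) := by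
        gcongr
        linarith
    _ = _ := by ring

/-- Counting the index from `n` removes `n` from every factor except `1 / (Γ(d - b - k) * k!)`,
which behaves like a power of `k + 1` with exponent `Re (b - d)`. -/
theorem exists_norm_algTermT_add_le (a b c d : ℂ) (j : ℕ) : ∃ C : ℝ, 0 < C ∧ ∀ (n : ℕ) (z : ℂ),
    z ≠ 0 → ‖algTermT a b c d n (n + j) z‖ ≤
      C * (((n : ℝ) + 1) ^ (b - d).re * ‖z‖ ^ (-b.re - j)) := by
  obtain ⟨C, hC, h⟩ := exists_norm_inv_Gamma_sub_nat_mul_factorial_le (d - b)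
  set K := ‖Complex.Gamma (b + j) * Complex.Gamma (a - b - j) / Complex.Gamma (c - b - j)‖ with hK
  refine ⟨(K + 1) * (C * ((j : ℝ) + 1) ^ |(b - d).re|) * Real.exp (Real.pi * |b.im|),
    by positivity, fun n z hz => ?_⟩
  have h1 := h (n + j)
  have h2 := norm_cpow_le_exp_pi hz (-b - j)
  simp only [Complex.sub_re, Complex.neg_re, Complex.natCast_re, Complex.sub_im, Complex.neg_im,
    Complex.natCast_im, sub_zero, abs_neg] at h2
  have h3 : (((n + j : ℕ) : ℝ) + 1) ^ (-(d - b).re) ≤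
      ((j : ℝ) + 1) ^ |(b - d).re| * ((n : ℝ) + 1) ^ (b - d).re := by
    rw [show -(d - b).re = (b - d).re by simp]
    have hn : (0 : ℝ) ≤ n := n.cast_nonneg
    have hj : (0 : ℝ) ≤ j := j.cast_nonneg
    push_cast
    exact rpow_le_rpow_abs_mul_rpow (by positivity) (by positivity) (by positivity)
      (by nlinarith) (by nlinarith) _
  have e : algTermT a b c d n (n + j) z =
      (Complex.Gamma (b + j) * Complex.Gamma (a - b - j) / Complex.Gamma (c - b - j)) *
      (Complex.Gamma (d - b - (n + j : ℕ)) * ((n + j).factorial : ℂ))⁻¹ * z ^ (-b - (j : ℂ)) *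
      (-1) ^ (n + j) := by
    rw [algTermT, show b - n + ((n + j : ℕ) : ℂ) = b + j by push_cast; ring,
      show a - b + n - ((n + j : ℕ) : ℂ) = a - b - j by push_cast; ring,
      show c - b + n - ((n + j : ℕ) : ℂ) = c - b - j by push_cast; ring,
      show (n : ℂ) - b - ((n + j : ℕ) : ℂ) = - b - j by push_cast; ring, mul_inv]
    ring
  rw [e, norm_mul, norm_mul, norm_mul, ← hK, norm_pow, norm_neg, norm_one, one_pow, mul_one]
  calc _ ≤ (K + 1) * (C * (((j : ℝ) + 1) ^ |(b - d).re| * ((n : ℝ) + 1) ^ (b - d).re)) *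
        (‖z‖ ^ (-b.re - j) * Real.exp (Real.pi * |b.im|)) := by
        gcongr
        · linarith
        · exact h1.trans (by gcongr)
    _ = _ := by ring

/-- Counted backwards from `n`, the term carries `Γ(b - j)`, which decays like `1 / j!` up to a
power. Inserting `j!` exposes the factor `‖z‖ ^ j / j!`, so that sums over `j ≤ n` can be bounded by
an exponential series independent of `n`. -/
theorem exists_norm_algTermT_sub_le (a b c d : ℂ) : ∃ C : ℝ, 0 < C ∧ ∀ (n j : ℕ) (z : ℂ),
    j ≤ n → z ≠ 0 → ‖algTermT a b c d n (n - j) z‖ ≤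
      C * (((n : ℝ) + 1) ^ |(b - d).re| * ‖z‖ ^ (-b.re)) *
        (((j : ℝ) + 1) ^ ((a + b - c - d).re + b.re) * (‖z‖ ^ j / j.factorial)) := by
  obtain ⟨C₁, hC₁, h₁⟩ := exists_norm_inv_Gamma_sub_nat_mul_factorial_le (d - b)
  obtain ⟨C₂, hC₂, h₂⟩ := exists_norm_Gamma_sub_nat_mul_factorial_le b
  obtain ⟨C₃, hC₃, h₃⟩ := exists_norm_Gamma_add_nat_div_le (a - b) (c - b)
  refine ⟨C₁ * C₂ * C₃ * Real.exp (Real.pi * |b.im|), by positivity, fun n j z hj hz => ?_⟩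
  have hz0 : 0 < ‖z‖ := norm_pos_iff.2 hz
  have h1 := h₁ (n - j)
  have h2 := h₂ j
  have h3 := h₃ j
  rw [show a - b - (c - b) = a - c by ring] at h3
  have h4 := norm_cpow_le_exp_pi hz (-b + j)
  simp only [Complex.add_re, Complex.neg_re, Complex.natCast_re, Complex.add_im, Complex.neg_im,
    Complex.natCast_im, add_zero, abs_neg] at h4
  have h5 : (((n - j : ℕ) : ℝ) + 1) ^ (-(d - b).re) ≤
      ((n : ℝ) + 1) ^ |(b - d).re| * ((j : ℝ) + 1) ^ (b - d).re := by
    rw [show -(d - b).re = (b - d).re by simp]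
    have hj' : (0 : ℝ) ≤ j := j.cast_nonneg
    have hjn : (j : ℝ) ≤ n := by exact_mod_cast hj
    rw [Nat.cast_sub hj]
    exact rpow_le_rpow_abs_mul_rpow (by linarith) (by positivity) (by positivity)
      (by nlinarith) (by nlinarith) _
  have hf : (j.factorial : ℂ) ≠ 0 := by exact_mod_cast j.factorial_ne_zero
  have e : algTermT a b c d n (n - j) z =
      (Complex.Gamma (b - j) * (j.factorial : ℂ)) *
      (Complex.Gamma (a - b + j) / Complex.Gamma (c - b + j)) *
      (Complex.Gamma (d - b - (n - j : ℕ)) * ((n - j).factorial : ℂ))⁻¹ *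
      z ^ (-b + (j : ℂ)) * (j.factorial : ℂ)⁻¹ * (-1) ^ (n - j) := by
    have ec : ((n - j : ℕ) : ℂ) = n - j := Nat.cast_sub hj
    rw [algTermT, show b - n + ((n - j : ℕ) : ℂ) = b - j by rw [ec]; ring,
      show a - b + n - ((n - j : ℕ) : ℂ) = a - b + j by rw [ec]; ring,
      show c - b + n - ((n - j : ℕ) : ℂ) = c - b + j by rw [ec]; ring,
      show (n : ℂ) - b - ((n - j : ℕ) : ℂ) = - b + j by rw [ec]; ring, mul_inv]
    field_simp
  have hj1 : (0 : ℝ) < (j : ℝ) + 1 := by positivity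
  rw [e, norm_mul, norm_mul, norm_mul, norm_mul, norm_mul, norm_pow (-1 : ℂ), norm_neg, norm_one, one_pow,
    mul_one, norm_inv (j.factorial : ℂ), Complex.norm_natCast]
  calc _ ≤ (C₂ * ((j : ℝ) + 1) ^ b.re) * (C₃ * ((j : ℝ) + 1) ^ (a - c).re) *
        (C₁ * (((n : ℝ) + 1) ^ |(b - d).re| * ((j : ℝ) + 1) ^ (b - d).re)) *
        (‖z‖ ^ (-b.re + j) * Real.exp (Real.pi * |b.im|)) * (j.factorial : ℝ)⁻¹ := by
        gcongr
        exact h1.trans (by gcongr)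
    _ = C₁ * C₂ * C₃ * Real.exp (Real.pi * |b.im|) * ((n : ℝ) + 1) ^ |(b - d).re| *
        ‖z‖ ^ (-b.re + j) * ((((j : ℝ) + 1) ^ (a - c).re * ((j : ℝ) + 1) ^ (b - d).re *
          ((j : ℝ) + 1) ^ b.re) * (j.factorial : ℝ)⁻¹) := by ring
    _ = _ := by
        rw [← Real.rpow_add hj1, ← Real.rpow_add hj1, Real.rpow_add hz0, Real.rpow_natCast,
          show (a - c).re + (b - d).re = (a + b - c - d).re by simp; ring]
        ring

/-- The quotient depends only on `k - n`, so it is a power of `|k - n| + 1`. This number agrees with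
`k + 1` up to a factor `n + 1` in either direction, which is why the exponent of `n + 1` is an
absolute value. -/
theorem exists_norm_Gamma_sub_add_div_le (b d : ℂ) : ∃ C : ℝ, 0 < C ∧ ∀ n k : ℕ,
    ‖Complex.Gamma (b - n + k) / Complex.Gamma (d - n + k)‖ ≤
      C * (((n : ℝ) + 1) ^ |(b - d).re| * ((k : ℝ) + 1) ^ (b - d).re) := by
  obtain ⟨C₁, hC₁, h₁⟩ := exists_norm_Gamma_add_nat_div_le b d
  obtain ⟨C₂, hC₂, h₂⟩ := exists_norm_Gamma_sub_nat_div_le b d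
  refine ⟨C₁ + C₂, by positivity, fun n k => ?_⟩
  have hn : (0 : ℝ) ≤ n := n.cast_nonneg
  have hk : (0 : ℝ) ≤ k := k.cast_nonneg
  have key : ∀ m : ℕ, (m : ℝ) + 1 ≤ (n + 1) * (k + 1) → (k : ℝ) + 1 ≤ (n + 1) * (m + 1) →
      ((m : ℝ) + 1) ^ (b - d).re ≤ ((n : ℝ) + 1) ^ |(b - d).re| * ((k : ℝ) + 1) ^ (b - d).re :=
    fun m h1 h2 => rpow_le_rpow_abs_mul_rpow (by positivity) (by positivity) (by positivity) h1 h2 _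
  have hE : 0 < ((n : ℝ) + 1) ^ |(b - d).re| * ((k : ℝ) + 1) ^ (b - d).re := by positivity
  rcases le_total n k with hnk | hnk
  · obtain ⟨m, rfl⟩ := Nat.exists_eq_add_of_le hnk
    have h := key m (by push_cast; nlinarith [(m.cast_nonneg : (0 : ℝ) ≤ m)])
      (by push_cast; nlinarith [(m.cast_nonneg : (0 : ℝ) ≤ m)])
    have e : ∀ x : ℂ, x - n + ((n + m : ℕ) : ℂ) = x + m := fun x => by push_cast; ring
    rw [e, e]
    refine (h₁ m).trans ?_
    gcongr
    linarith
  · obtain ⟨m, rfl⟩ := Nat.exists_eq_add_of_le hnk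
    have h := key m (by push_cast; nlinarith [(m.cast_nonneg : (0 : ℝ) ≤ m)])
      (by push_cast; nlinarith [(m.cast_nonneg : (0 : ℝ) ≤ m)])
    have e : ∀ x : ℂ, x - ((k + m : ℕ) : ℂ) + k = x - m := fun x => by push_cast; ring
    rw [e, e]
    refine (h₂ m).trans ?_
    gcongr
    linarith

theorem exists_norm_mbCoeff_sub_nat_le (a b c d : ℂ) : ∃ C : ℝ, 0 < C ∧ ∀ n k : ℕ,
    ‖mbCoeff a (b - n) c (d - n) k‖ ≤
      C * (((n : ℝ) + 1) ^ |(b - d).re| * ((k : ℝ) + 1) ^ (a + b - c - d).re) := by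
  obtain ⟨C₁, hC₁, h₁⟩ := exists_norm_Gamma_add_nat_div_le a c
  obtain ⟨C₂, hC₂, h₂⟩ := exists_norm_Gamma_sub_add_div_le b d
  refine ⟨C₁ * C₂, by positivity, fun n k => ?_⟩
  have hk : (0 : ℝ) < (k : ℝ) + 1 := by positivity
  rw [mbCoeff, ← div_mul_div_comm, norm_mul]
  calc _ ≤ (C₁ * ((k : ℝ) + 1) ^ (a - c).re) *
        (C₂ * (((n : ℝ) + 1) ^ |(b - d).re| * ((k : ℝ) + 1) ^ (b - d).re)) := by
        gcongr
        · exact h₁ k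
        · exact h₂ n k
    _ = C₁ * C₂ * (((n : ℝ) + 1) ^ |(b - d).re| *
        (((k : ℝ) + 1) ^ (a - c).re * ((k : ℝ) + 1) ^ (b - d).re)) := by ring
    _ = _ := by
        rw [← Real.rpow_add hk, show (a - c).re + (b - d).re = (a + b - c - d).re by simp; ring]

theorem exists_norm_mbSeries_le (a b c d : ℂ) : ∃ C : ℝ, 0 < C ∧ ∀ (n : ℕ) (z : ℂ), 1 ≤ ‖z‖ →
    ‖mbSeries a (b - n) c (d - n) z‖ ≤
      C * (((n : ℝ) + 1) ^ |(b - d).re| * (‖z‖ ^ (a + b - c - d).re * Real.exp ‖z‖)) := by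
  obtain ⟨C₁, hC₁, h₁⟩ := exists_norm_mbCoeff_sub_nat_le a b c d
  obtain ⟨C₃, hC₃, h₃⟩ := exists_tsum_rpow_mul_pow_div_factorial_le (a + b - c - d).re
  refine ⟨C₁ * C₃, by positivity, fun n z hz => ?_⟩
  obtain ⟨hs, hb⟩ := h₃ ‖z‖ hz
  set E := ((n : ℝ) + 1) ^ |(b - d).re| with hE
  have hle : ∀ k : ℕ, ‖mbCoeff a (b - n) c (d - n) k * ((-z) ^ k / (k.factorial : ℂ))‖ ≤
      C₁ * E * (((k : ℝ) + 1) ^ (a + b - c - d).re * (‖z‖ ^ k / k.factorial)) := by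
    intro k
    rw [norm_mul, norm_div, norm_pow, norm_neg, Complex.norm_natCast]
    calc _ ≤ C₁ * (E * ((k : ℝ) + 1) ^ (a + b - c - d).re) * (‖z‖ ^ k / k.factorial) := by
          gcongr
          exact h₁ n k
      _ = _ := by ring
  refine (tsum_of_norm_bounded (hs.mul_left (C₁ * E)).hasSum hle).trans ?_
  rw [tsum_mul_left]
  calc _ ≤ C₁ * E * (C₃ * (‖z‖ ^ (a + b - c - d).re * Real.exp ‖z‖)) := by gcongr
    _ = _ := by ring

theorem differentiable_mbSeries (a b c d : ℂ) (n : ℕ) :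
    Differentiable ℂ (mbSeries a (b - n) c (d - n)) := by
  intro z
  obtain ⟨C₁, hC₁, h₁⟩ := exists_norm_mbCoeff_sub_nat_le a b c d
  obtain ⟨C₃, hC₃, h₃⟩ := exists_tsum_rpow_mul_pow_div_factorial_le (a + b - c - d).re
  have hR : 1 ≤ ‖z‖ + 1 := by linarith [norm_nonneg z]
  obtain ⟨hs, -⟩ := h₃ (‖z‖ + 1) hR
  have hd := Complex.differentiableOn_tsum_of_summable_norm (U := Metric.ball 0 (‖z‖ + 1))
    (F := fun (k : ℕ) z => mbCoeff a (b - n) c (d - n) k * ((-z) ^ k / (k.factorial : ℂ)))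
    (hs.mul_left (C₁ * ((n : ℝ) + 1) ^ |(b - d).re|)) (fun k => by fun_prop) Metric.isOpen_ball
    fun k y hy => by
      have hy' : ‖y‖ ≤ ‖z‖ + 1 := (mem_ball_zero_iff.1 hy).le
      rw [norm_mul, norm_div, norm_pow, norm_neg, Complex.norm_natCast]
      calc _ ≤ C₁ * (((n : ℝ) + 1) ^ |(b - d).re| * ((k : ℝ) + 1) ^ (a + b - c - d).re) *
            ((‖z‖ + 1) ^ k / k.factorial) := by
            gcongr
            exact h₁ n k
        _ = _ := by ring
  exact hd.differentiableAt (Metric.isOpen_ball.mem_nhds (mem_ball_zero_iff.2 (by linarith)))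

theorem differentiableAt_hypRemainder (a b c d : ℂ) (w : ℝ) (n : ℕ) {z : ℂ}
    (hz : z ∈ Complex.slitPlane) : DifferentiableAt ℂ (hypRemainder a b c d w n) z := by
  have hp : ∀ s : ℂ, DifferentiableAt ℂ (fun z : ℂ => z ^ s) z := fun s =>
    differentiableAt_id.cpow_const hz
  unfold hypRemainder algSumS algSumT
  exact ((differentiable_mbSeries a b c d n z).sub
    (DifferentiableAt.fun_sum fun k _ => (hp _).const_mul _)).sub
    (DifferentiableAt.fun_sum fun k _ => (hp _).const_mul _)

theorem exists_rpow_le_rpow_mul_exp (q p : ℝ) : ∃ C : ℝ, 0 < C ∧ ∀ x : ℝ, 1 ≤ x →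
    x ^ q ≤ C * (x ^ p * Real.exp x) := by
  obtain ⟨C, hC, h⟩ := exists_rpow_le_exp (q - p)
  refine ⟨C, hC, fun x hx => ?_⟩
  have hx0 : 0 < x := by linarith
  have := h x hx
  rw [Real.rpow_sub hx0, div_le_iff₀ (by positivity)] at this
  linarith

theorem exists_sum_le {ι X : Type*} (s : Finset ι) {f : ι → X → ℂ} {g : X → ℝ} {P : X → Prop}
    (hg : ∀ x, P x → 0 ≤ g x)
    (h : ∀ i ∈ s, ∃ C : ℝ, 0 < C ∧ ∀ x, P x → ‖f i x‖ ≤ C * g x) :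
    ∃ C : ℝ, 0 < C ∧ ∀ x, P x → ‖∑ i ∈ s, f i x‖ ≤ C * g x := by
  classical
  induction s using Finset.induction_on with
  | empty => exact ⟨1, one_pos, fun x hx => by simpa using hg x hx⟩
  | insert i s hi ih =>
    obtain ⟨C₁, hC₁, h₁⟩ := h i (Finset.mem_insert_self i s)
    obtain ⟨C₂, hC₂, h₂⟩ := ih fun j hj => h j (Finset.mem_insert_of_mem hj)
    refine ⟨C₁ + C₂, by positivity, fun x hx => ?_⟩
    rw [Finset.sum_insert hi, add_mul]
    exact (norm_add_le _ _).trans (add_le_add (h₁ x hx) (h₂ x hx))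

theorem exists_norm_algSumS_le (a b c d : ℂ) (w : ℝ) : ∃ C : ℝ, 0 < C ∧ ∀ (n : ℕ) (z : ℂ),
    1 ≤ ‖z‖ → ‖algSumS a b c d w n z‖ ≤
      C * (((n : ℝ) + 1) ^ |(b - d).re| * (‖z‖ ^ (a + b - c - d).re * Real.exp ‖z‖)) := by
  obtain ⟨C, hC, h⟩ := exists_sum_le (X := ℕ × ℂ) (Finset.range (⌊w - a.re⌋₊ + 1))
    (f := fun k x => algTermS a b c d x.1 k x.2) (P := fun x => 1 ≤ ‖x.2‖)
    (g := fun x => ((x.1 : ℝ) + 1) ^ |(b - d).re| *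
      (‖x.2‖ ^ (a + b - c - d).re * Real.exp ‖x.2‖)) (fun x _ => by positivity) fun k _ => by
    obtain ⟨C₁, hC₁, h₁⟩ := exists_norm_algTermS_le a b c d k
    obtain ⟨C₂, hC₂, h₂⟩ := exists_rpow_le_rpow_mul_exp (-a.re - k) (a + b - c - d).re
    refine ⟨C₁ * C₂, by positivity, fun x hx => ?_⟩
    have hz : x.2 ≠ 0 := norm_pos_iff.1 (by linarith)
    refine (h₁ x.1 x.2 hz).trans ?_
    have h3 := h₂ _ hx
    have h4 : ((x.1 : ℝ) + 1) ^ (b - d).re ≤ ((x.1 : ℝ) + 1) ^ |(b - d).re| :=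
      Real.rpow_le_rpow_of_exponent_le (by simp) (le_abs_self _)
    calc _ ≤ C₁ * (((x.1 : ℝ) + 1) ^ |(b - d).re| *
          (C₂ * (‖x.2‖ ^ (a + b - c - d).re * Real.exp ‖x.2‖))) := by gcongr
      _ = _ := by ring
  exact ⟨C, hC, fun n z hz => h (n, z) hz⟩

/-- Separates the `n` terms whose number grows with `n`, which need a convergent majorant, from a
fixed number of terms that can be bounded one by one. -/
theorem algSumT_eq_add (a b c d : ℂ) (w : ℝ) (n : ℕ) (z : ℂ) :
    algSumT a b c d w n z = ∑ k ∈ Finset.range n, algTermT a b c d n k z +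
      ∑ j ∈ Finset.range (⌊w - b.re⌋₊ + 1), algTermT a b c d n (n + j) z := by
  rw [algSumT, show ⌊w - b.re⌋₊ + n + 1 = n + (⌊w - b.re⌋₊ + 1) by ring, Finset.sum_range_add]
  rfl

theorem exists_norm_algSumT_le (a b c d : ℂ) (w : ℝ) : ∃ C : ℝ, 0 < C ∧ ∀ (n : ℕ) (z : ℂ),
    1 ≤ ‖z‖ → ‖algSumT a b c d w n z‖ ≤
      C * (((n : ℝ) + 1) ^ |(b - d).re| * (‖z‖ ^ (a + b - c - d).re * Real.exp ‖z‖)) := by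
  obtain ⟨C, hC, h⟩ := exists_sum_le (X := ℕ × ℂ) (Finset.range (⌊w - b.re⌋₊ + 1))
    (f := fun j x => algTermT a b c d x.1 (x.1 + j) x.2) (P := fun x => 1 ≤ ‖x.2‖)
    (g := fun x => ((x.1 : ℝ) + 1) ^ |(b - d).re| *
      (‖x.2‖ ^ (a + b - c - d).re * Real.exp ‖x.2‖)) (fun x _ => by positivity) fun j _ => by
    obtain ⟨C₁, hC₁, h₁⟩ := exists_norm_algTermT_add_le a b c d j
    obtain ⟨C₂, hC₂, h₂⟩ := exists_rpow_le_rpow_mul_exp (-b.re - j) (a + b - c - d).re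
    refine ⟨C₁ * C₂, by positivity, fun x hx => ?_⟩
    have hz : x.2 ≠ 0 := norm_pos_iff.1 (by linarith)
    refine (h₁ x.1 x.2 hz).trans ?_
    have h3 := h₂ _ hx
    have h4 : ((x.1 : ℝ) + 1) ^ (b - d).re ≤ ((x.1 : ℝ) + 1) ^ |(b - d).re| :=
      Real.rpow_le_rpow_of_exponent_le (by simp) (le_abs_self _)
    calc _ ≤ C₁ * (((x.1 : ℝ) + 1) ^ |(b - d).re| *
          (C₂ * (‖x.2‖ ^ (a + b - c - d).re * Real.exp ‖x.2‖))) := by gcongr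
      _ = _ := by ring
  obtain ⟨C₁, hC₁, h₁⟩ := exists_norm_algTermT_sub_le a b c d
  obtain ⟨C₂, hC₂, h₂⟩ := exists_tsum_rpow_mul_pow_div_factorial_le ((a + b - c - d).re + b.re)
  refine ⟨C₁ * C₂ + C, by positivity, fun n z hz => ?_⟩
  have hz0 : 0 < ‖z‖ := by linarith
  obtain ⟨hs, hb⟩ := h₂ ‖z‖ hz
  set E := ((n : ℝ) + 1) ^ |(b - d).re| with hE
  set B := C₁ * (E * ‖z‖ ^ (-b.re)) with hB
  set g : ℕ → ℝ := fun j => ((j : ℝ) + 1) ^ ((a + b - c - d).re + b.re) *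
    (‖z‖ ^ j / j.factorial) with hg
  have hg0 : ∀ j, 0 ≤ g j := fun j => by positivity
  -- The term `k = n` is added so that reversing the sum gives `n - j` with `0 ≤ j ≤ n`; the
  -- majorant is then a partial sum of a series that does not involve `n`.
  have h3 : ‖∑ k ∈ Finset.range n, algTermT a b c d n k z‖ ≤ B * ∑' j, g j := by
    calc _ ≤ ∑ k ∈ Finset.range n, ‖algTermT a b c d n k z‖ := norm_sum_le _ _
      _ ≤ ∑ k ∈ Finset.range (n + 1), ‖algTermT a b c d n k z‖ := by
          rw [Finset.sum_range_succ]
          exact le_add_of_nonneg_right (norm_nonneg _)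
      _ = ∑ j ∈ Finset.range (n + 1), ‖algTermT a b c d n (n - j) z‖ :=
          (Finset.sum_flip fun k => ‖algTermT a b c d n k z‖).symm
      _ ≤ ∑ j ∈ Finset.range (n + 1), B * g j := Finset.sum_le_sum fun j hj =>
          h₁ n j z (Nat.lt_succ_iff.1 (Finset.mem_range.1 hj)) (norm_pos_iff.1 hz0)
      _ = B * ∑ j ∈ Finset.range (n + 1), g j := by rw [Finset.mul_sum]
      _ ≤ B * ∑' j, g j := by
          gcongr
          exact hs.sum_le_tsum _ fun j _ => hg0 j
  have h4 : ‖z‖ ^ (-b.re) * ‖z‖ ^ ((a + b - c - d).re + b.re) = ‖z‖ ^ (a + b - c - d).re := by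
    rw [← Real.rpow_add hz0]; congr 1; ring
  rw [algSumT_eq_add, add_mul]
  refine (norm_add_le _ _).trans (add_le_add (h3.trans ?_) (h (n, z) hz))
  calc _ ≤ B * (C₂ * (‖z‖ ^ ((a + b - c - d).re + b.re) * Real.exp ‖z‖)) := by gcongr
    _ = C₁ * C₂ * (E * (‖z‖ ^ (-b.re) * ‖z‖ ^ ((a + b - c - d).re + b.re) * Real.exp ‖z‖)) := by
        rw [hB]; ring
    _ = _ := by rw [h4]

/-- A bound for the remainder that is valid in all directions. -/
theorem exists_norm_hypRemainder_le_exp (a b c d : ℂ) (w : ℝ) : ∃ C : ℝ, 0 < C ∧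
    ∀ (n : ℕ) (z : ℂ), 1 ≤ ‖z‖ → ‖hypRemainder a b c d w n z‖ ≤
      C * (((n : ℝ) + 1) ^ |(b - d).re| * (‖z‖ ^ (a + b - c - d).re * Real.exp ‖z‖)) := by
  obtain ⟨C₁, hC₁, h₁⟩ := exists_norm_mbSeries_le a b c d
  obtain ⟨C₂, hC₂, h₂⟩ := exists_norm_algSumS_le a b c d w
  obtain ⟨C₃, hC₃, h₃⟩ := exists_norm_algSumT_le a b c d w
  refine ⟨C₁ + C₂ + C₃, by positivity, fun n z hz => ?_⟩
  rw [hypRemainder, add_mul, add_mul]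
  exact (norm_sub_le _ _).trans (add_le_add ((norm_sub_le _ _).trans
    (add_le_add (h₁ n z hz) (h₂ n z hz))) (h₃ n z hz))

/-! ### Changing the truncation parameter -/

/-- Raising `w` to `w + N` changes the remainder by `O(‖z‖ ^ (-w))`. -/
theorem exists_norm_hypRemainder_sub_le {a b c d : ℂ} {w : ℝ} (hwa : a.re < w) (hwb : b.re < w)
    (N : ℕ) : ∃ C : ℝ, 0 < C ∧ ∀ (n : ℕ) (z : ℂ), 1 ≤ ‖z‖ →
      ‖hypRemainder a b c d w n z - hypRemainder a b c d (w + N) n z‖ ≤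
        C * (((n : ℝ) + 1) ^ max 0 (b - d).re * ‖z‖ ^ (-w)) := by
  have hfl : ∀ x : ℂ, x.re < w → ⌊w + N - x.re⌋₊ = ⌊w - x.re⌋₊ + N := fun x hx => by
    rw [← Nat.floor_add_natCast (by linarith)]; congr 1; ring
  -- Added terms have index at least `⌊w - y.re⌋₊ + 1`, hence greater than `w - y.re`, so their
  -- power of `‖z‖` is at most `‖z‖ ^ (-w)`.
  have hexp : ∀ {x : ℝ}, 1 ≤ x → ∀ {y : ℂ} {k : ℕ}, ⌊w - y.re⌋₊ + 1 ≤ k →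
      x ^ (-y.re - k) ≤ x ^ (-w) := fun {x} hx {y k} hk => by
    refine Real.rpow_le_rpow_of_exponent_le hx ?_
    have h1 := Nat.lt_floor_add_one (w - y.re)
    have h2 : ((⌊w - y.re⌋₊ + 1 : ℕ) : ℝ) ≤ k := by exact_mod_cast hk
    push_cast at h2
    linarith
  have hmax : ∀ n : ℕ, ((n : ℝ) + 1) ^ (b - d).re ≤ ((n : ℝ) + 1) ^ max 0 (b - d).re := fun n =>
    Real.rpow_le_rpow_of_exponent_le (by simp) (le_max_right _ _)
  obtain ⟨C₁, hC₁, h₁⟩ := exists_sum_le (X := ℕ × ℂ) (Finset.range N)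
    (f := fun k x => algTermS a b c d x.1 (⌊w - a.re⌋₊ + 1 + k) x.2) (P := fun x => 1 ≤ ‖x.2‖)
    (g := fun x => ((x.1 : ℝ) + 1) ^ max 0 (b - d).re * ‖x.2‖ ^ (-w)) (fun x _ => by positivity)
    fun k _ => by
    obtain ⟨C, hC, h⟩ := exists_norm_algTermS_le a b c d (⌊w - a.re⌋₊ + 1 + k)
    refine ⟨C, hC, fun x hx => (h x.1 x.2 (norm_pos_iff.1 (by linarith))).trans ?_⟩
    exact mul_le_mul_of_nonneg_left (mul_le_mul (hmax _) (hexp hx (Nat.le_add_right _ _))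
      (by positivity) (by positivity)) hC.le
  obtain ⟨C₂, hC₂, h₂⟩ := exists_sum_le (X := ℕ × ℂ) (Finset.range N)
    (f := fun k x => algTermT a b c d x.1 (x.1 + (⌊w - b.re⌋₊ + 1 + k)) x.2)
    (P := fun x => 1 ≤ ‖x.2‖)
    (g := fun x => ((x.1 : ℝ) + 1) ^ max 0 (b - d).re * ‖x.2‖ ^ (-w)) (fun x _ => by positivity)
    fun k _ => by
    obtain ⟨C, hC, h⟩ := exists_norm_algTermT_add_le a b c d (⌊w - b.re⌋₊ + 1 + k)
    refine ⟨C, hC, fun x hx => (h x.1 x.2 (norm_pos_iff.1 (by linarith))).trans ?_⟩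
    exact mul_le_mul_of_nonneg_left (mul_le_mul (hmax _) (hexp hx (Nat.le_add_right _ _))
      (by positivity) (by positivity)) hC.le
  refine ⟨C₁ + C₂, by positivity, fun n z hz => ?_⟩
  have e1 : algSumS a b c d (w + N) n z = algSumS a b c d w n z +
      ∑ k ∈ Finset.range N, algTermS a b c d n (⌊w - a.re⌋₊ + 1 + k) z := by
    rw [algSumS, hfl a hwa, show ⌊w - a.re⌋₊ + N + 1 = ⌊w - a.re⌋₊ + 1 + N by ring,
      Finset.sum_range_add]
    rfl
  have e2 : algSumT a b c d (w + N) n z = algSumT a b c d w n z +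
      ∑ k ∈ Finset.range N, algTermT a b c d n (n + (⌊w - b.re⌋₊ + 1 + k)) z := by
    rw [algSumT_eq_add, algSumT_eq_add, hfl b hwb,
      show ⌊w - b.re⌋₊ + N + 1 = ⌊w - b.re⌋₊ + 1 + N by ring, Finset.sum_range_add, add_assoc]
  have e3 : hypRemainder a b c d w n z - hypRemainder a b c d (w + N) n z =
      ∑ k ∈ Finset.range N, algTermS a b c d n (⌊w - a.re⌋₊ + 1 + k) z +
      ∑ k ∈ Finset.range N, algTermT a b c d n (n + (⌊w - b.re⌋₊ + 1 + k)) z := by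
    rw [hypRemainder, hypRemainder, e1, e2]; ring
  rw [e3, add_mul]
  exact (norm_add_le _ _).trans (add_le_add (h₁ (n, z) hz) (h₂ (n, z) hz))

/-! ### Phragmén–Lindelöf and the estimate in the upper half plane -/

theorem pi_div_four_le_arg {u : ℂ} (hu : u ≠ 0) (h0 : 0 ≤ u.im) (h : u.re ≤ u.im) :
    Real.pi / 4 ≤ u.arg := by
  by_contra! hlt
  have hpi := Real.pi_pos
  have ha := Complex.arg_nonneg_iff.2 h0
  have hn := norm_pos_iff.2 hu
  have h1 : Real.sin u.arg < Real.sin (Real.pi / 4) :=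
    Real.sin_lt_sin_of_lt_of_le_pi_div_two (by linarith) (by linarith) hlt
  have h2 : Real.cos (Real.pi / 4) < Real.cos u.arg :=
    Real.cos_lt_cos_of_nonneg_of_le_pi ha (by linarith) hlt
  rw [Real.sin_pi_div_four] at h1
  rw [Real.cos_pi_div_four] at h2
  have h3 := Complex.norm_mul_cos_arg u
  have h4 := Complex.norm_mul_sin_arg u
  nlinarith

theorem abs_arg_le_pi_div_four {u : ℂ} (hu : u ≠ 0) (h0 : 0 ≤ u.im) (h : u.im ≤ u.re) :
    |u.arg| ≤ Real.pi / 4 := by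
  have hpi := Real.pi_pos
  have ha := Complex.arg_nonneg_iff.2 h0
  rw [abs_of_nonneg ha]
  by_contra! hlt
  have hn := norm_pos_iff.2 hu
  have h2 : Real.cos u.arg < Real.cos (Real.pi / 4) :=
    Real.cos_lt_cos_of_nonneg_of_le_pi (by positivity) (Complex.arg_le_pi u) hlt
  rw [Real.cos_pi_div_four] at h2
  have h3 := Complex.norm_mul_cos_arg u
  have h4 : u.re < ‖u‖ * (√2 / 2) := by rw [← h3]; gcongr
  have h5 := Complex.sq_norm u
  rw [Complex.normSq_apply] at h5
  have h6 : (√2 / 2) ^ 2 = 1 / 2 := by rw [div_pow, Real.sq_sqrt (by norm_num)]; norm_num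
  have h7 : u.re ^ 2 < (‖u‖ * (√2 / 2)) ^ 2 := by
    gcongr
    linarith
  rw [mul_pow, h6] at h7
  nlinarith

/-- A Phragmén–Lindelöf principle between the diagonal ray and a horizontal ray. -/
theorem norm_le_of_diagonal_of_horizontal {H : ℂ → ℂ} {ρ K B C : ℝ} (hρ : 0 < ρ)
    (hd : ∀ z : ℂ, 0 < z.im → DifferentiableAt ℂ H z)
    (h₁ : ∀ x : ℝ, ρ ≤ x → ‖H (x + x * Complex.I)‖ ≤ K)
    (h₂ : ∀ t : ℝ, t ≤ ρ → ‖H (t + ρ * Complex.I)‖ ≤ K) (hB : 0 ≤ B) (hC : 0 ≤ C)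
    (h₃ : ∀ z : ℂ, ρ ≤ z.im → ‖H z‖ ≤ C * Real.exp (B * ‖z‖)) {z : ℂ} (hz : ρ ≤ z.im)
    (hz' : z.re ≤ z.im) : ‖H z‖ ≤ K := by
  have hpi := Real.pi_pos
  set z₀ : ℂ := ρ + ρ * Complex.I with hz₀
  have hre₀ : z₀.re = ρ := by simp [hz₀]
  have him₀ : z₀.im = ρ := by simp [hz₀]
  have him : ∀ ξ : ℂ, ξ.im ∈ Set.Icc (Real.pi / 4) Real.pi → ρ ≤ (z₀ + Complex.exp ξ).im := by
    intro ξ hξ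
    rw [Complex.add_im, him₀, Complex.exp_im]
    have := Real.sin_nonneg_of_nonneg_of_le_pi (by linarith [hξ.1]) hξ.2
    have := mul_nonneg (Real.exp_pos ξ.re).le this
    linarith
  have hda : ∀ ξ : ℂ, ξ.im ∈ Set.Icc (Real.pi / 4) Real.pi →
      DifferentiableAt ℂ (fun ξ => H (z₀ + Complex.exp ξ)) ξ := fun ξ hξ =>
    (hd _ (hρ.trans_le (him ξ hξ))).comp ξ (by fun_prop)
  by_cases hzz : z - z₀ = 0
  · rw [sub_eq_zero.1 hzz, hz₀]
    exact h₁ ρ le_rfl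
  have hlog : Complex.exp (Complex.log (z - z₀)) = z - z₀ := Complex.exp_log hzz
  -- The map `ξ ↦ z₀ + exp ξ` sends the strip `π / 4 ≤ im ξ ≤ π` to the sector with vertex `z₀`
  -- bounded by the diagonal and the leftward horizontal ray.
  have key := PhragmenLindelof.horizontal_strip (f := fun ξ => H (z₀ + Complex.exp ξ))
    (a := Real.pi / 4) (b := Real.pi) (C := K) (z := Complex.log (z - z₀)) ?_ ?_ ?_ ?_ ?_ ?_
  · simpa only [hlog, add_sub_cancel] using key
  · refine ⟨fun ξ hξ => (hda ξ ⟨hξ.1.le, hξ.2.le⟩).differentiableWithinAt, fun ξ hξ => ?_⟩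
    have hcl : closure (Complex.im ⁻¹' Set.Ioo (Real.pi / 4) Real.pi) ⊆
        Complex.im ⁻¹' Set.Icc (Real.pi / 4) Real.pi :=
      closure_minimal (Set.preimage_mono Set.Ioo_subset_Icc_self)
        (isClosed_Icc.preimage Complex.continuous_im)
    exact (hda ξ (hcl hξ)).continuousAt.continuousWithinAt
  · refine ⟨1, ?_, B, ?_⟩
    · rw [lt_div_iff₀ (by linarith)]; linarith
    · refine Asymptotics.IsBigO.of_bound (C * Real.exp (B * ‖z₀‖)) ?_
      rw [eventually_inf_principal]
      refine Eventually.of_forall fun ξ hξ => ?_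
      refine (h₃ _ (him ξ ⟨hξ.1.le, hξ.2.le⟩)).trans ?_
      rw [Real.norm_of_nonneg (Real.exp_pos _).le, mul_assoc, ← Real.exp_add]
      gcongr
      rw [← mul_add]
      gcongr
      refine (norm_add_le _ _).trans ?_
      gcongr
      rw [Complex.norm_exp, one_mul]
      exact Real.exp_le_exp.2 (le_abs_self _)
  · intro ξ hξ
    have h5 : z₀ + Complex.exp ξ = ((ρ + Real.exp ξ.re * (√2 / 2) : ℝ) : ℂ) +
        ((ρ + Real.exp ξ.re * (√2 / 2) : ℝ) : ℂ) * Complex.I := by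
      apply Complex.ext
      · rw [Complex.add_re, hre₀, Complex.exp_re, hξ, Real.cos_pi_div_four]; generalize Real.exp ξ.re = r; simp
      · rw [Complex.add_im, him₀, Complex.exp_im, hξ, Real.sin_pi_div_four]; generalize Real.exp ξ.re = r; simp
    simp only [h5]
    exact h₁ _ (le_add_of_nonneg_right (by positivity))
  · intro ξ hξ
    have h5 : z₀ + Complex.exp ξ = ((ρ - Real.exp ξ.re : ℝ) : ℂ) + ρ * Complex.I := by
      apply Complex.ext
      · rw [Complex.add_re, hre₀, Complex.exp_re, hξ, Real.cos_pi]; generalize Real.exp ξ.re = r; simp; ring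
      · rw [Complex.add_im, him₀, Complex.exp_im, hξ, Real.sin_pi]; simp
    simp only [h5]
    exact h₂ _ (by linarith [Real.exp_pos ξ.re])
  · rw [Complex.log_im]
    refine pi_div_four_le_arg hzz ?_ ?_
    · rw [Complex.sub_im, him₀]; linarith
    · rw [Complex.sub_im, Complex.sub_re, him₀, hre₀]; linarith
  · rw [Complex.log_im]
    exact Complex.arg_le_pi _

/-- Near the negative real axis `exp ‖z‖` and `exp (-Re z)` agree up to a constant, so there the
crude bound already has the required exponential form. -/
theorem norm_add_re_le {z : ℂ} {ρ : ℝ} (h0 : 0 ≤ z.im) (hi : z.im ≤ ρ) (hr : z.re ≤ ρ) :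
    ‖z‖ + z.re ≤ 3 * ρ := by
  have h := Complex.norm_le_abs_re_add_abs_im z
  rw [abs_of_nonneg h0] at h
  rcases abs_cases z.re with h1 | h1 <;> linarith

/-- The estimate in the upper half plane, for large `w`. -/
theorem exists_norm_hypRemainder_le_of_im_nonneg {a b c d : ℂ} (ha : ∀ m : ℕ, a ≠ -m)
    (hc : ∀ m : ℕ, c ≠ -m) (hd : ∀ m : ℤ, d ≠ m) (hab : ∀ m : ℤ, a - b ≠ m) :
    ∃ M : ℝ, ∀ w : ℝ, M ≤ w → (∀ m : ℤ, w - a.re ≠ m) → (∀ m : ℤ, w - b.re ≠ m) →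
    ∃ C : ℝ, 0 < C ∧ ∀ n : ℕ, (∀ m : ℕ, b - n ≠ -m) → ∀ z : ℂ, 1 ≤ ‖z‖ → 0 ≤ z.im →
      ‖hypRemainder a b c d w n z‖ ≤ C * (((n : ℝ) + 1) ^ max 0 (b - d).re * ‖z‖ ^ (-w)) +
        C * (((n : ℝ) + 1) ^ |(b - d).re| * ‖z‖ ^ (a + b - c - d).re * Real.exp (-z.re)) := by
  obtain ⟨M₁, h₁⟩ := exists_norm_hypRemainder_sector_le ha hc hd hab
  obtain ⟨M₂, h₂⟩ := exists_algRemainder a b c d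
  obtain ⟨M₃, h₃⟩ := exists_norm_hypRemainder_sub_algRemainder_le ha hc hd hab
  refine ⟨max M₁ (max M₂ M₃), fun w hw hwa hwb => ?_⟩
  simp only [max_le_iff] at hw
  obtain ⟨C₁, hC₁, h₁⟩ := h₁ w hw.1 hwa hwb
  obtain ⟨⟨C₂, hC₂, h₂⟩, hA⟩ := h₂ w hw.2.1 hwa hwb
  obtain ⟨x₀, C₃, hC₃, h₃⟩ := h₃ w hw.2.2 hwa hwb
  obtain ⟨C₄, hC₄, h₄⟩ := exists_norm_hypRemainder_le_exp a b c d w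
  set p := (a + b - c - d).re with hp
  obtain ⟨C₅, hC₅, h₅⟩ := exists_rpow_le_rpow_mul_exp (-w) p
  set ρ := max x₀ 1 with hρ
  have hρ1 : 1 ≤ ρ := le_max_right _ _
  have hmax : ∀ n : ℕ, ((n : ℝ) + 1) ^ max 0 (b - d).re ≤ ((n : ℝ) + 1) ^ |(b - d).re| := fun n =>
    Real.rpow_le_rpow_of_exponent_le (by simp) (max_le (abs_nonneg _) (le_abs_self _))
  -- The first summand bounds the normalized difference on the horizontal ray, by the crude
  -- estimate; the second bounds it on the diagonal, by the saddle estimate, with `‖z‖ = √2 * x`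
  -- there.
  set K := (C₄ + C₂ * C₅) * Real.exp (3 * ρ) + C₃ * (√2 ^ p)⁻¹ with hK
  have hK0 : 0 < K := by positivity
  have hfar : ∀ n : ℕ, (∀ m : ℕ, b - n ≠ -m) → ∀ z : ℂ, ρ ≤ z.im → z.re ≤ z.im →
      ‖hypRemainder a b c d w n z - algRemainder a b c d w n z‖ ≤
        K * ((n : ℝ) + 1) ^ |(b - d).re| * ‖z‖ ^ p * Real.exp (-z.re) := by
    intro n hn z hz hz'
    set E := ((n : ℝ) + 1) ^ |(b - d).re| with hE
    have hE0 : 0 < E := by positivity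
    -- Multiplication by `exp z * z ^ (-p)` normalizes the expected size to a constant. The complex
    -- power has modulus `‖z‖ ^ (-p)` exactly, since `p` is real.
    set H : ℂ → ℂ := fun z => (hypRemainder a b c d w n z - algRemainder a b c d w n z) *
      (Complex.exp z * z ^ (-p : ℂ)) with hH
    have hnorm : ∀ z : ℂ, z ≠ 0 → ‖H z‖ = ‖hypRemainder a b c d w n z -
        algRemainder a b c d w n z‖ * (Real.exp z.re * (‖z‖ ^ p)⁻¹) := by
      intro z hz
      rw [hH, norm_mul, norm_mul, Complex.norm_exp, Complex.norm_cpow_of_ne_zero hz,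
        ← Real.rpow_neg (norm_nonneg z)]
      simp
    have hge : ∀ z : ℂ, ρ ≤ z.im → 1 ≤ ‖z‖ := fun z hz =>
      hρ1.trans (hz.trans ((le_abs_self _).trans (Complex.abs_im_le_norm z)))
    have hne : ∀ z : ℂ, ρ ≤ z.im → z ≠ 0 := fun z hz => norm_pos_iff.1 (by linarith [hge z hz])
    have hcrude : ∀ z : ℂ, ρ ≤ z.im → ‖H z‖ ≤ (C₄ + C₂ * C₅) * E * Real.exp (‖z‖ + z.re) := by
      intro z hz
      have hz1 := hge z hz
      have hz0 : 0 < ‖z‖ := by linarith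
      have b1 := h₄ n z hz1
      have b2 := h₂ n z (hne z hz) (by linarith)
      have b3 := h₅ ‖z‖ hz1
      rw [hnorm z (hne z hz)]
      calc _ ≤ ((C₄ + C₂ * C₅) * E * (‖z‖ ^ p * Real.exp ‖z‖)) *
            (Real.exp z.re * (‖z‖ ^ p)⁻¹) := by
            gcongr
            refine (norm_sub_le _ _).trans ?_
            calc _ ≤ C₄ * (E * (‖z‖ ^ p * Real.exp ‖z‖)) +
                  C₂ * (E * (C₅ * (‖z‖ ^ p * Real.exp ‖z‖))) := by
                  refine add_le_add b1 (b2.trans ?_)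
                  gcongr
                  exact hmax n
              _ = _ := by ring
        _ = _ := by
            rw [Real.exp_add]
            field_simp
    have key := norm_le_of_diagonal_of_horizontal (H := H) (ρ := ρ) (K := K * E) (B := 2)
      (C := (C₄ + C₂ * C₅) * E) (by linarith) ?_ ?_ ?_ (by norm_num) (by positivity) ?_ hz hz'
    · rw [hnorm z (hne z hz), ← mul_assoc, ← div_eq_mul_inv, div_le_iff₀
        (Real.rpow_pos_of_pos (by linarith [hge z hz]) _)] at key
      rw [Real.exp_neg, ← div_eq_mul_inv, le_div_iff₀ (Real.exp_pos _)]
      exact key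
    · intro z hz
      have hs : z ∈ Complex.slitPlane := Or.inr hz.ne'
      exact ((differentiableAt_hypRemainder a b c d w n hs).sub (hA n z hz)).mul
        (Complex.differentiableAt_exp.mul (differentiableAt_id.cpow_const hs))
    · intro x hx
      have hx0 : 0 < x := by linarith
      have b1 := h₃ n hn x ((le_max_left _ _).trans hx)
      have him : ρ ≤ (x + x * Complex.I : ℂ).im := by simpa using hx
      have hzn : ‖(x + x * Complex.I : ℂ)‖ = x * √2 := by
        rw [norm_eq_mul_sqrt (by simpa using hx0)]
        simp [hx0.ne']; norm_num
      rw [hnorm _ (hne _ him), hzn, Real.mul_rpow hx0.le (by positivity)]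
      have hre : (x + x * Complex.I : ℂ).re = x := by simp
      rw [hre]
      calc _ ≤ (C₃ * (E * (x ^ p * Real.exp (-x)))) *
            (Real.exp x * (x ^ p * √2 ^ p)⁻¹) := by
            gcongr
            refine b1.trans ?_
            gcongr
            exact hmax n
        _ = C₃ * (√2 ^ p)⁻¹ * E := by
            rw [Real.exp_neg]
            field_simp
        _ ≤ K * E := by
            gcongr
            exact le_add_of_nonneg_left (by positivity)
    · intro t ht
      have him : (t + ρ * Complex.I : ℂ).im = ρ := by simp
      have hre : (t + ρ * Complex.I : ℂ).re = t := by simp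
      have h6 := norm_add_re_le (z := t + ρ * Complex.I) (ρ := ρ) (by rw [him]; linarith) him.le
        (hre.trans_le ht)
      refine (hcrude _ him.ge).trans ?_
      calc _ ≤ (C₄ + C₂ * C₅) * E * Real.exp (3 * ρ) := by gcongr
        _ = (C₄ + C₂ * C₅) * Real.exp (3 * ρ) * E := by ring
        _ ≤ K * E := by
            gcongr
            exact le_add_of_nonneg_right (by positivity)
    · intro z hz
      refine (hcrude z hz).trans ?_
      gcongr
      linarith [Complex.re_le_norm z]
  refine ⟨C₁ + C₂ + K + C₄ * Real.exp (3 * ρ), by positivity, fun n hn z hz hi => ?_⟩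
  have hz0 : z ≠ 0 := norm_pos_iff.1 (by linarith)
  set C := C₁ + C₂ + K + C₄ * Real.exp (3 * ρ) with hC
  set X := ((n : ℝ) + 1) ^ max 0 (b - d).re * ‖z‖ ^ (-w) with hX
  set Y := ((n : ℝ) + 1) ^ |(b - d).re| * ‖z‖ ^ p * Real.exp (-z.re) with hY
  have hX0 : 0 ≤ X := by positivity
  have hY0 : 0 ≤ Y := by positivity
  have hexp : 0 < C₄ * Real.exp (3 * ρ) := by positivity
  -- Three regions: the sector `arg z ≤ π / 4` by direct estimation, the part above the diagonal
  -- with `ρ ≤ im z` by Phragmén–Lindelöf plus the bound for `algRemainder`, and the strip below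
  -- height `ρ` by the crude bound.
  rcases le_or_gt z.im z.re with h | h
  · have := h₁ n hn z hz0 (abs_arg_le_pi_div_four hz0 hi h)
    have h6 : C₁ * X ≤ C * X := by gcongr; linarith
    have h7 : 0 ≤ C * Y := by positivity
    linarith
  · rcases le_or_gt ρ z.im with h8 | h8
    · have b1 := hfar n hn z h8 h.le
      have b2 := h₂ n z hz0 hi
      have b3 := norm_le_norm_add_norm_sub (algRemainder a b c d w n z)
        (hypRemainder a b c d w n z)
      rw [norm_sub_rev] at b3
      have h6 : C₂ * X ≤ C * X := by gcongr; linarith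
      have h7 : K * Y ≤ C * Y := by gcongr; linarith
      have h9 : K * ((n : ℝ) + 1) ^ |(b - d).re| * ‖z‖ ^ p * Real.exp (-z.re) = K * Y := by
        rw [hY]; ring
      linarith
    · have b1 := h₄ n z hz
      have b2 := norm_add_re_le hi h8.le (by linarith)
      have b3 : Real.exp ‖z‖ ≤ Real.exp (3 * ρ) * Real.exp (-z.re) := by
        rw [← Real.exp_add]
        exact Real.exp_le_exp.2 (by linarith)
      have b4 : C₄ * (((n : ℝ) + 1) ^ |(b - d).re| * (‖z‖ ^ p * Real.exp ‖z‖)) ≤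
          C₄ * Real.exp (3 * ρ) * Y := by
        calc _ ≤ C₄ * (((n : ℝ) + 1) ^ |(b - d).re| *
              (‖z‖ ^ p * (Real.exp (3 * ρ) * Real.exp (-z.re)))) := by gcongr
          _ = _ := by rw [hY]; ring
      have h7 : C₄ * Real.exp (3 * ρ) * Y ≤ C * Y := by gcongr; linarith
      have h6 : 0 ≤ C * X := by positivity
      linarith

/-! ### Lower half plane, general truncation and conclusion -/

theorem mbCoeff_conj (a b c d : ℂ) (k : ℕ) :
    mbCoeff (starRingEnd ℂ a) (starRingEnd ℂ b) (starRingEnd ℂ c) (starRingEnd ℂ d) k =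
      starRingEnd ℂ (mbCoeff a b c d k) := by
  simp only [mbCoeff, map_div₀, map_mul, ← Complex.Gamma_conj, map_add, map_natCast]

/-- Reduces the lower half plane to the upper one with conjugated parameters. Principal powers
commute with conjugation only off the negative axis, whence the condition on the argument. -/
theorem hypRemainder_conj (a b c d : ℂ) (w : ℝ) (n : ℕ) {z : ℂ} (hz : z.arg ≠ Real.pi) :
    hypRemainder (starRingEnd ℂ a) (starRingEnd ℂ b) (starRingEnd ℂ c) (starRingEnd ℂ d) w n
      (starRingEnd ℂ z) = starRingEnd ℂ (hypRemainder a b c d w n z) := by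
  have hcpow : ∀ s : ℂ, starRingEnd ℂ (z ^ s) = (starRingEnd ℂ z) ^ (starRingEnd ℂ s) := fun s => by
    rw [Complex.conj_cpow _ _ hz, Complex.conj_conj]
  have h1 : mbSeries (starRingEnd ℂ a) (starRingEnd ℂ b - n) (starRingEnd ℂ c)
      (starRingEnd ℂ d - n) (starRingEnd ℂ z) =
      starRingEnd ℂ (mbSeries a (b - n) c (d - n) z) := by
    rw [mbSeries, mbSeries, Complex.conj_tsum]
    refine tsum_congr fun k => ?_
    rw [map_mul, ← mbCoeff_conj]
    simp
  rw [hypRemainder, hypRemainder, map_sub, map_sub, h1, algSumS, algSumS, algSumT, algSumT,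
    map_sum, map_sum]
  simp only [Complex.conj_re, map_mul, map_div₀, hcpow, ← Complex.Gamma_conj, map_add, map_sub,
    map_natCast, map_pow, map_neg, map_one]

/-- The estimate for large `w`. -/
theorem exists_norm_hypRemainder_le_of_large {a b c d : ℂ} (ha : ∀ m : ℕ, a ≠ -m)
    (hc : ∀ m : ℕ, c ≠ -m) (hd : ∀ m : ℤ, d ≠ m) (hab : ∀ m : ℤ, a - b ≠ m) :
    ∃ M : ℝ, ∀ w : ℝ, M ≤ w → (∀ m : ℤ, w - a.re ≠ m) → (∀ m : ℤ, w - b.re ≠ m) →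
    ∃ C : ℝ, 0 < C ∧ ∀ n : ℕ, (∀ m : ℕ, b - n ≠ -m) → ∀ z : ℂ, 1 ≤ ‖z‖ → z.arg ≠ Real.pi →
      ‖hypRemainder a b c d w n z‖ ≤ C * (((n : ℝ) + 1) ^ max 0 (b - d).re * ‖z‖ ^ (-w)) +
        C * (((n : ℝ) + 1) ^ |(b - d).re| * ‖z‖ ^ (a + b - c - d).re * Real.exp (-z.re)) := by
  have hinj : ∀ {x y : ℂ}, starRingEnd ℂ x = y → x = starRingEnd ℂ y := fun h => by
    rw [← h, Complex.conj_conj]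
  obtain ⟨M₁, h₁⟩ := exists_norm_hypRemainder_le_of_im_nonneg ha hc hd hab
  obtain ⟨M₂, h₂⟩ := exists_norm_hypRemainder_le_of_im_nonneg (a := starRingEnd ℂ a)
    (b := starRingEnd ℂ b) (c := starRingEnd ℂ c) (d := starRingEnd ℂ d)
    (fun m h => ha m (by simpa using hinj h)) (fun m h => hc m (by simpa using hinj h))
    (fun m h => hd m (by simpa using hinj h))
    (fun m h => hab m (by rw [← map_sub] at h; simpa using hinj h))
  refine ⟨max M₁ M₂, fun w hw hwa hwb => ?_⟩
  obtain ⟨C₁, hC₁, h₁⟩ := h₁ w (le_trans (le_max_left _ _) hw) hwa hwb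
  obtain ⟨C₂, hC₂, h₂⟩ := h₂ w (le_trans (le_max_right _ _) hw) (by simpa using hwa)
    (by simpa using hwb)
  refine ⟨C₁ + C₂, by positivity, fun n hn z hz harg => ?_⟩
  set X := ((n : ℝ) + 1) ^ max 0 (b - d).re * ‖z‖ ^ (-w) with hX
  set Y := ((n : ℝ) + 1) ^ |(b - d).re| * ‖z‖ ^ (a + b - c - d).re * Real.exp (-z.re) with hY
  have hX0 : 0 ≤ X := by positivity
  have hY0 : 0 ≤ Y := by positivity
  rcases le_or_gt 0 z.im with hi | hi
  · refine (h₁ n hn z hz hi).trans ?_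
    gcongr <;> linarith
  · have h3 := h₂ n (fun m h => hn m (by
      have e : starRingEnd ℂ (b - n) = -m := by rw [map_sub, map_natCast, h]
      simpa using hinj e)) (starRingEnd ℂ z) (by simpa using hz) (by simp; linarith)
    rw [hypRemainder_conj a b c d w n harg, Complex.norm_conj, Complex.norm_conj, ← map_sub,
      ← map_add, ← map_sub, ← map_sub, Complex.conj_re, Complex.conj_re, Complex.conj_re] at h3
    refine h3.trans ?_
    gcongr <;> linarith

/-- Adding an integer `N` to `w` reaches the range of the large-`w` estimate and preserves
non-integrality of `w - Re a` and `w - Re b`; returning to `w` costs only `O(‖z‖ ^ (-w))`. -/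
theorem exists_norm_hypRemainder_le {a b c d : ℂ} {w : ℝ} (ha : ∀ m : ℕ, a ≠ -m)
    (hc : ∀ m : ℕ, c ≠ -m) (hd : ∀ m : ℤ, d ≠ m) (hab : ∀ m : ℤ, a - b ≠ m) (hwa : a.re < w)
    (hwb : b.re < w) (hfa : ∀ m : ℤ, w - a.re ≠ m) (hfb : ∀ m : ℤ, w - b.re ≠ m) :
    ∃ C : ℝ, 0 < C ∧ ∀ n : ℕ, (∀ m : ℕ, b - n ≠ -m) → ∀ z : ℂ, 1 ≤ ‖z‖ → z.arg ≠ Real.pi →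
      ‖hypRemainder a b c d w n z‖ ≤ C * (((n : ℝ) + 1) ^ max 0 (b - d).re * ‖z‖ ^ (-w)) +
        C * (((n : ℝ) + 1) ^ |(b - d).re| * ‖z‖ ^ (a + b - c - d).re * Real.exp (-z.re)) := by
  obtain ⟨M, hM⟩ := exists_norm_hypRemainder_le_of_large ha hc hd hab
  obtain ⟨N, hN⟩ := exists_nat_ge (M - w)
  have hfract : ∀ x : ℂ, (∀ m : ℤ, w - x.re ≠ m) → ∀ m : ℤ, w + N - x.re ≠ m := fun x hx m h =>
    hx (m - N) (by push_cast; linarith)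
  obtain ⟨C₁, hC₁, h₁⟩ := hM (w + N) (by linarith) (hfract a hfa) (hfract b hfb)
  obtain ⟨C₂, hC₂, h₂⟩ := exists_norm_hypRemainder_sub_le (c := c) (d := d) hwa hwb N
  refine ⟨C₁ + C₂, by positivity, fun n hn z hz harg => ?_⟩
  have b1 := h₁ n hn z hz harg
  have b2 := h₂ n z hz
  have b3 := norm_le_norm_add_norm_sub (hypRemainder a b c d (w + N) n z)
    (hypRemainder a b c d w n z)
  rw [norm_sub_rev] at b3
  have b4 : ‖z‖ ^ (-(w + N)) ≤ ‖z‖ ^ (-w) :=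
    Real.rpow_le_rpow_of_exponent_le hz (by linarith [(N.cast_nonneg : (0 : ℝ) ≤ N)])
  have b5 : C₁ * (((n : ℝ) + 1) ^ max 0 (b - d).re * ‖z‖ ^ (-(w + N))) ≤
      C₁ * (((n : ℝ) + 1) ^ max 0 (b - d).re * ‖z‖ ^ (-w)) := by gcongr
  have b6 : 0 ≤ C₂ * (((n : ℝ) + 1) ^ |(b - d).re| * ‖z‖ ^ (a + b - c - d).re *
    Real.exp (-z.re)) := by positivity
  rw [norm_sub_rev] at b3
  rw [add_mul, add_mul]
  rw [norm_sub_rev] at b3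
  linarith

end

theorem theorem4 (a b c d : ℂ) (w ε : ℝ)
    (ha : ∀ m : ℕ, a ≠ -(m : ℂ))
    (hc : ∀ m : ℕ, c ≠ -(m : ℂ))
    (hd : ∀ m : ℤ, d ≠ (m : ℂ))
    (hab : ∀ m : ℤ, a - b ≠ (m : ℂ))
    (hw : 0 < w) (hwa : a.re < w) (hwb : b.re < w) (hwd : d.re < w)
    (hε : 0 < ε)
    (hfa : Int.fract (w - a.re) ∈ Set.Ioo ε 1)
    (hfb : Int.fract (w - b.re) ∈ Set.Ioo ε 1) :
    ∃ R : ℕ → ℂ → ℂ,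
      (∀ n : ℕ, (∀ m : ℕ, b - n ≠ -(m : ℂ)) → ∀ z : ℂ, z ≠ 0 → |z.arg| < Real.pi →
        hyp2F2 a (b - n) c (d - n) (-z) =
          Complex.Gamma c * Complex.Gamma (d - n) / (Complex.Gamma a * Complex.Gamma (b - n)) *
            (algSumS a b c d w n z + algSumT a b c d w n z + R n z)) ∧
      ∀ δ : ℝ, 0 < δ → ∃ K : ℝ, 0 < K ∧ ∃ r : ℝ, 0 < r ∧
        ∀ n : ℕ, (∀ m : ℕ, b - n ≠ -(m : ℂ)) → ∀ z : ℂ, r ≤ ‖z‖ → |z.arg| < Real.pi →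
          (∀ k : ℤ, δ ≤ ‖z - (-b + k)‖) →
          ‖R n z‖ ≤
            K * (((n : ℝ) + 1) ^ max 0 (b - d).re * ‖z‖ ^ (-w)) +
            K * (((n : ℝ) + 1) ^ (2 * ‖b - d‖) * ‖z‖ ^ (a + b - c - d).re * Real.exp (-z.re)) := by
  have hfract : ∀ x : ℝ, Int.fract x ∈ Set.Ioo ε 1 → ∀ m : ℤ, x ≠ m := fun x hx m h => by
    rw [h, Int.fract_intCast] at hx
    exact lt_asymm hε hx.1
  obtain ⟨C, hC, h⟩ := exists_norm_hypRemainder_le ha hc hd hab hwa hwb (hfract _ hfa)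
    (hfract _ hfb)
  refine ⟨hypRemainder a b c d w, fun n hn z hz harg => ?_, fun δ hδ =>
    ⟨C, hC, 1, one_pos, fun n hn z hz harg _ => ?_⟩⟩
  · have hd' : ∀ m : ℕ, d - n ≠ -m := fun m hm => hd (n - m) (by
      push_cast; linear_combination hm)
    have h1 := Complex.Gamma_ne_zero ha
    have h2 := Complex.Gamma_ne_zero hn
    have h3 := Complex.Gamma_ne_zero hc
    have h4 := Complex.Gamma_ne_zero hd'
    rw [hypRemainder, (mbSeries_eq ha hn hc hd' z).1]
    field_simp
    ring
  · refine (h n hn z hz fun h => ?_).trans ?_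
    · rw [h, abs_of_pos Real.pi_pos] at harg
      exact lt_irrefl _ harg
    -- The estimate obtained has exponent `|Re (b - d)|` of `n + 1`, which is at most the one
    -- asserted.
    · have h1 : |(b - d).re| ≤ 2 * ‖b - d‖ := by
        linarith [Complex.abs_re_le_norm (b - d), norm_nonneg (b - d)]
      gcongr
      simp
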